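/- Let $L_1,L_2,L,\omega,\varepsilon,\mu>0$, $\Omega=(0,L_1)\times(0,L_2)$, $W=\Omega\times(-\infty,0)$, $k=\omega\sqrt{\varepsilon\mu}$, and let $\vec J\in (L^2(\Omega))^3$ (complex valued). For $n=(n_1,n_2)\in\mathbb N_0^2=\{(n_1,n_2)\ \text{nonnegative integers}\}\setminus\{(0,0)\}$ put $p=\pi n_1/L_1$, $q=\pi n_2/L_2$, $\lambda_n=p^2+q^2$, let $m_n=1$ if $n_1n_2=0$ and $m_n=3$ otherwise, and let $\vec\Phi_n^{(s)}$, $1\le s\le m_n$, be $$\vec\Phi^{(1)}_n=\delta_{n_2 0}\,(0,\sin px_1,0)+\delta_{n_1 0}\,(\sin qx_2,0,0)\quad\text{if } n_1n_2=0,$$ and, if $n_1n_2\neq0$, $$\vec\Phi^{(1)}_n=(q\cos px_1\sin qx_2,\,-p\sin px_1\cos qx_2,\,0),\quad \vec\Phi^{(2)}_n=(p\cos px_1\sin qx_2,\,q\sin px_1\cos qx_2,\,0),\quad \vec\Phi^{(3)}_n=(0,0,\sin px_1\sin qx_2).$$ Let $\beta_n=\sqrt{k^2-\lambda_n}$ if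 $\lambda_n\le k^2$ and $\beta_n=i\sqrt{\lambda_n-k^2}$ if $\lambda_n>k^2$, and assume that $k$ is not a cut-off wavenumber: $\lambda_n\ne k^2$ for all $n\in\mathbb N_0^2$. (a) The $\vec\Phi_n^{(s)}$ are eigenfunctions of the vectorial Laplacian: $-\Delta\vec\Phi_n^{(s)}=\lambda_n\vec\Phi_n^{(s)}$ in $\Omega$, with vanishing tangential and longitudinal components and vanishing (two-dimensional) divergence on $\partial\Omega$; they form an orthogonal basis of $(L^2(\Omega))^3$. (b) The problem $$\vec\nabla\times\vec\nabla\times\vec E-k^2\vec E=i\omega\mu\,\vec J(x)\,\delta(x_3+L)\ \text{ in } W,\qquad \vec n\times\vec E=0\ \text{ on }\partial W,$$ with $\vec E$ bounded and outgoing as $x_3\to-\infty$, has exactly one solution. Here $\vec E$ is a distribution in $x_3$, up to $x_3=0$, with values in $(L^2(\Omega))^3$; the equation and boundary condition hold weakly, $\langle \vec E,\vec\nabla\times\vec\nabla\times\vec V-k^2\vec V\rangle=i\omega\mu\int_\Omega\vec J(x)\cdot\vec V(x,-L)\,dx$ for all smooth fields $\vec V$ that vanish for large $|x_3|$ and satisfy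 $\vec n\times\vec V=0$ on $\partial W$; bounded is meant in the sense of distributions; outgoing means that every coefficient $g$ of $\vec E$ with respect to $\vec\Phi^{(s)}_n$ with $\lambda_n<k^2$ satisfies $g'+i\beta_ng\to0$ as $x_3\to-\infty$ in the sense of distributions. (c) For $x_3\ne-L$ the solution is a continuous function in $W$, and pointwise for $x\in\Omega$, with unconditionally convergent series, $$\vec E(x,x_3)=\sum_{n}\sum_{s=1}^{m_n}\vec\Phi_n^{(s)}(x)\big(a^{+(s)}_ne^{i\beta_nx_3}+b^{+(s)}_ne^{-i\beta_nx_3}\big),\quad -L<x_3<0,$$ $$\vec E(x,x_3)=\sum_{n}\sum_{s=1}^{m_n}\vec\Phi_n^{(s)}(x)\,b^{-(s)}_ne^{-i\beta_nx_3},\quad x_3<-L,$$ where, with $c_n^{(s)}=\langle\vec\Phi_n^{(s)},\vec J\rangle/\|\vec\Phi_n^{(s)}\|^2$ and the inner product of $(L^2(\Omega))^3$ linear in its second argument, $$b_n^{+(1)}=-a_n^{+(1)}=\frac{\omega\mu}{2\beta_n}c_n^{(1)}e^{i\beta_nL},\qquad b_n^{-(1)}=\frac{\omega\mu}{2\beta_n}c_n^{(1)}\big[e^{i\beta_nL}-e^{-i\beta_nL}\big],$$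 $$b_n^{+(2)}=-a_n^{+(2)}=\Big[\frac{\omega\mu\beta_n}{2k^2}c_n^{(2)}+\frac{i\omega\mu}{2k^2}c_n^{(3)}\Big]e^{i\beta_nL},$$ $$b_n^{-(2)}=\frac{\omega\mu\beta_n}{2k^2}c_n^{(2)}\big[e^{i\beta_nL}-e^{-i\beta_nL}\big]+\frac{i\omega\mu}{2k^2}c_n^{(3)}\big[e^{i\beta_nL}+e^{-i\beta_nL}\big],$$ $$a_n^{+(3)}=-\frac{i\lambda_n}{\beta_n}a_n^{+(2)},\qquad b_n^{\pm(3)}=\frac{i\lambda_n}{\beta_n}b_n^{\pm(2)}.$$ (d) For finitely many $n$ the wavenumber $\beta_n$ is real and positive (propagating modes); for all the remaining, infinitely many $n$ it is $i$ times a positive number (evanescent modes). -/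

import Mathlib

open MeasureTheory Filter Topology Set
open scoped ContDiff Matrix

noncomputable section

/-- The physical data: cross-section `(0, L₁) × (0, L₂)`, current sheet at `x₃ = -L`, angular
frequency `freq`, permittivity `eps` and permeability `mu` of the homogeneous medium (written
`ω`, `ε`, `μ` in the comments below). -/
structure Waveguide where
  L₁ : ℝ
  L₂ : ℝ
  L : ℝ
  freq : ℝ
  eps : ℝ
  mu : ℝ
  L₁_pos : 0 < L₁
  L₂_pos : 0 < L₂
  L_pos : 0 < L
  freq_pos : 0 < freq
  eps_pos : 0 < eps
  mu_pos : 0 < mu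

namespace Waveguide

/-! ### Points, partial derivatives, curl. A point is `(x, x₃)` with `x = (x₁, x₂)`. -/

/-- The coordinate directions of `(ℝ × ℝ) × ℝ`. -/
def dir : Fin 3 → (ℝ × ℝ) × ℝ := ![((1, 0), 0), ((0, 1), 0), ((0, 0), 1)]

/-- The partial derivative in the `j`-th coordinate. -/
def pd (j : Fin 3) (V : (ℝ × ℝ) × ℝ → Fin 3 → ℂ) : (ℝ × ℝ) × ℝ → Fin 3 → ℂ :=
  fun x => fderiv ℝ V x (dir j)

/-- The curl of a vector field. -/
def curl (V : (ℝ × ℝ) × ℝ → Fin 3 → ℂ) : (ℝ × ℝ) × ℝ → Fin 3 → ℂ :=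
  fun x => ![pd 1 V x 2 - pd 2 V x 1, pd 2 V x 0 - pd 0 V x 2, pd 0 V x 1 - pd 1 V x 0]

/-! ### Test fields: smooth fields that vanish for large `|x₃|` (the cross-section is bounded, so
nothing is asked in the directions `x₁`, `x₂`, and no boundary value is prescribed). -/

/-- The space of test fields. -/
def testFields : Submodule ℂ ((ℝ × ℝ) × ℝ → Fin 3 → ℂ) where
  carrier := {V | ContDiff ℝ ∞ V ∧ ∃ R : ℝ, ∀ x, R < |x.2| → V x = 0}
  zero_mem' := ⟨contDiff_const, 0, fun _ _ => rfl⟩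
  add_mem' := by
    rintro U V ⟨hU, R, hR⟩ ⟨hV, S, hS⟩
    refine ⟨hU.add hV, max R S, fun x hx => ?_⟩
    simp [hR x ((le_max_left _ _).trans_lt hx), hS x ((le_max_right _ _).trans_lt hx)]
  smul_mem' := by
    rintro c V ⟨hV, R, hR⟩
    refine ⟨contDiff_const.smul hV, R, fun x hx => ?_⟩
    simp [hR x hx]

theorem pd_mem {V : (ℝ × ℝ) × ℝ → Fin 3 → ℂ} (hV : V ∈ testFields) (j : Fin 3) :
    pd j V ∈ testFields := by
  obtain ⟨hV, R, hR⟩ := hV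
  refine ⟨(hV.fderiv_right (m := ∞) (by simp)).clm_apply contDiff_const, R, fun x hx => ?_⟩
  have h : V =ᶠ[𝓝 x] fun _ => 0 := by
    have ho : IsOpen {y : (ℝ × ℝ) × ℝ | R < |y.2|} :=
      isOpen_lt continuous_const (by fun_prop)
    filter_upwards [ho.mem_nhds hx] with y hy using hR y hy
  simp [pd, h.fderiv_eq]

theorem curl_mem {V : (ℝ × ℝ) × ℝ → Fin 3 → ℂ} (hV : V ∈ testFields) : curl V ∈ testFields := by
  have hc : ∀ j i, ContDiff ℝ ∞ fun x => pd j V x i := fun j i =>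
    (contDiff_pi.1 (pd_mem hV j).1) i
  obtain ⟨R0, h0⟩ := (pd_mem hV 0).2
  obtain ⟨R1, h1⟩ := (pd_mem hV 1).2
  obtain ⟨R2, h2⟩ := (pd_mem hV 2).2
  refine ⟨?_, max R0 (max R1 R2), fun x hx => ?_⟩
  · refine contDiff_pi.2 fun i => ?_
    fin_cases i
    · exact (hc 1 2).sub (hc 2 1)
    · exact (hc 2 0).sub (hc 0 2)
    · exact (hc 0 1).sub (hc 1 0)
  · simp only [max_lt_iff] at hx
    ext i
    fin_cases i <;> simp [curl, h0 x hx.1, h1 x hx.2.1, h2 x hx.2.2]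

theorem shift_mem {V : (ℝ × ℝ) × ℝ → Fin 3 → ℂ} (hV : V ∈ testFields) (τ : ℝ) :
    (fun x => V (x.1, x.2 + τ)) ∈ testFields := by
  obtain ⟨hV, R, hR⟩ := hV
  refine ⟨hV.comp (by fun_prop), R + |τ|, fun x hx => hR _ ?_⟩
  have := abs_sub_abs_le_abs_sub x.2 (-τ)
  simp only [abs_neg, sub_neg_eq_add] at this
  show R < |x.2 + τ|
  linarith

/-- The curl of a test field. -/
def curlT (V : testFields) : testFields := ⟨curl V, curl_mem V.2⟩

/-- The longitudinal derivative `∂/∂x₃` of a test field. -/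
def dz (V : testFields) : testFields := ⟨pd 2 V, pd_mem V.2 2⟩

/-- The translate of a test field by `τ` towards `x₃ = -∞`. -/
def shift (τ : ℝ) (V : testFields) : testFields :=
  ⟨fun x => (V : (ℝ × ℝ) × ℝ → Fin 3 → ℂ) (x.1, x.2 + τ), shift_mem V.2 τ⟩

variable (G : Waveguide)

/-- The wavenumber `k = ω √(ε μ)`. -/
def k : ℝ := G.freq * √(G.eps * G.mu)

/-- The cross-section `Ω`. -/
def Ω : Set (ℝ × ℝ) := Ioo 0 G.L₁ ×ˢ Ioo 0 G.L₂

/-- The terminating waveguide `W = Ω × (-∞, 0)`. -/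
def W : Set ((ℝ × ℝ) × ℝ) := G.Ω ×ˢ Iio 0

/-- `ν` is a unit outer normal of `W` at the boundary point `x` (on the edges, the outer normal of
one of the faces that meet there). -/
def IsOuterNormal (x : (ℝ × ℝ) × ℝ) (ν : Fin 3 → ℂ) : Prop :=
  x ∈ closure G.W ∧
    ((x.1.1 = 0 ∧ ν = ![-1, 0, 0]) ∨ (x.1.1 = G.L₁ ∧ ν = ![1, 0, 0]) ∨
      (x.1.2 = 0 ∧ ν = ![0, -1, 0]) ∨ (x.1.2 = G.L₂ ∧ ν = ![0, 1, 0]) ∨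
      (x.2 = 0 ∧ ν = ![0, 0, 1]))

/-- The condition `n × V = 0` on `∂W`. -/
def TangentialZero (V : (ℝ × ℝ) × ℝ → Fin 3 → ℂ) : Prop :=
  ∀ x ν, G.IsOuterNormal x ν → ν ⨯₃ V x = 0

/-! ### The modes -/

/-- The index pairs `(n₁, n₂) ≠ (0, 0)` of nonnegative integers. -/
abbrev Idx : Type := {n : ℕ × ℕ // n ≠ (0, 0)}

/-- The number `mₙ` of eigenfunctions with index pair `n`. -/
def mult (n : ℕ × ℕ) : ℕ := if n.1 * n.2 = 0 then 1 else 3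

/-- The indices `(n, s)` of the modes; `s = 0, 1, 2` stands for the first, second, third. -/
abbrev ModeIdx : Type := Σ n : Idx, Fin (mult n.1)

/-- The eigenvalue `λₙ = (π n₁ / L₁)² + (π n₂ / L₂)²`. -/
def eig (n : ℕ × ℕ) : ℝ := (Real.pi * n.1 / G.L₁) ^ 2 + (Real.pi * n.2 / G.L₂) ^ 2

/-- The eigenfunctions: `s = 0` transverse electric, `s = 1` transverse and curl free,
`s = 2` longitudinal. -/
def Φ (n : ℕ × ℕ) (s : ℕ) (x : ℝ × ℝ) : Fin 3 → ℂ :=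
  let p : ℝ := Real.pi * n.1 / G.L₁
  let q : ℝ := Real.pi * n.2 / G.L₂
  if n.1 * n.2 = 0 then
    (if n.2 = 0 then ![0, ((Real.sin (p * x.1) : ℝ) : ℂ), 0] else 0) +
      (if n.1 = 0 then ![((Real.sin (q * x.2) : ℝ) : ℂ), 0, 0] else 0)
  else
    match s with
    | 0 => ![((q * Real.cos (p * x.1) * Real.sin (q * x.2) : ℝ) : ℂ),
             ((-(p * Real.sin (p * x.1) * Real.cos (q * x.2)) : ℝ) : ℂ), 0]
    | 1 => ![((p * Real.cos (p * x.1) * Real.sin (q * x.2) : ℝ) : ℂ),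
             ((q * Real.sin (p * x.1) * Real.cos (q * x.2) : ℝ) : ℂ), 0]
    | _ => ![0, 0, ((Real.sin (p * x.1) * Real.sin (q * x.2) : ℝ) : ℂ)]

/-- The inner product of `(L²(Ω))³`, linear in the second argument. -/
def innerΩ (u v : ℝ × ℝ → Fin 3 → ℂ) : ℂ := ∫ x in G.Ω, star (u x) ⬝ᵥ v x

/-- First and second partial derivatives in the cross-section. -/
def pd2 (e : ℝ × ℝ) (u : ℝ × ℝ → Fin 3 → ℂ) : ℝ × ℝ → Fin 3 → ℂ := fun x => fderiv ℝ u x e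

/-- `u` is a (smooth) eigenfunction, for the eigenvalue `l`, of the vectorial Laplacian
in `Ω` with the boundary conditions `n^⊥ · (u₁, u₂) = u₃ = 0` and `∂₁ u₁ + ∂₂ u₂ = 0` on `∂Ω`. -/
structure IsVectorEigenfunction (l : ℝ) (u : ℝ × ℝ → Fin 3 → ℂ) : Prop where
  smooth : ContDiff ℝ ∞ u
  nonzero : ∃ x ∈ G.Ω, u x ≠ 0
  eqn : ∀ x ∈ G.Ω, -(pd2 (1, 0) (pd2 (1, 0) u) x + pd2 (0, 1) (pd2 (0, 1) u) x) = (l : ℂ) • u x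
  tangential₁ : ∀ x ∈ frontier G.Ω, (x.1 = 0 ∨ x.1 = G.L₁) → u x 1 = 0
  tangential₂ : ∀ x ∈ frontier G.Ω, (x.2 = 0 ∨ x.2 = G.L₂) → u x 0 = 0
  longitudinal : ∀ x ∈ frontier G.Ω, u x 2 = 0
  divergence : ∀ x ∈ frontier G.Ω, pd2 (1, 0) u x 0 + pd2 (0, 1) u x 1 = 0

/-- The longitudinal wavenumber `βₙ`. -/
def β (n : ℕ × ℕ) : ℂ :=
  if G.eig n ≤ G.k ^ 2 then ((√(G.k ^ 2 - G.eig n) : ℝ) : ℂ)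
  else Complex.I * ((√(G.eig n - G.k ^ 2) : ℝ) : ℂ)

/-! ### Solutions of the boundary value problem

The source `δ(x₃ + L)` makes the field singular at `x₃ = -L` (a longitudinal current even produces
a multiple of `δ(x₃ + L)` in the field), so the field is a generalized one: a linear functional on
test fields, to be thought of as `V ↦ ∫_W E · V`. -/

/-- The functional `T` is a distribution in `x₃ < 0`, up to `x₃ = 0`, with values in `(L²(Ω))³`:
it is controlled by finitely many `x₃`-derivatives of the test field, measured in the norm
of `(L²(Ω))³` on the cross-sections of `W`. -/
def IsCrossSectionL2 (T : testFields →ₗ[ℂ] ℂ) : Prop :=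
  ∀ R : ℝ, ∃ (N : ℕ) (C : ℝ), ∀ V : testFields, (∀ x, x.2 < -R → V.1 x = 0) →
    ∀ M : ℝ, 0 ≤ M →
      (∀ m ≤ N, ∀ t < 0, ∫ x in G.Ω, ∑ i, ‖(dz^[m] V).1 (x, t) i‖ ^ 2 ≤ M ^ 2) →
      ‖T V‖ ≤ C * M

/-- Weak form of `curl curl E - k² E = i ω μ J δ(x₃ + L)` in `W` with `n × E = 0` on `∂W`.
The test fields satisfy `n × V = 0` on `∂W`, while their curl is unrestricted there, so that the
boundary condition on `E` is encoded (Green's formula leaves the boundary term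
`∫_{∂W} (n × E) · curl V`). -/
def SolvesMaxwell (J : ℝ × ℝ → Fin 3 → ℂ) (T : testFields →ₗ[ℂ] ℂ) : Prop :=
  ∀ V : testFields, G.TangentialZero V.1 →
    T (curlT (curlT V) - ((G.k : ℂ) ^ 2) • V) =
      Complex.I * G.freq * G.mu * ∫ x in G.Ω, J x ⬝ᵥ V.1 (x, -G.L)

/-- The field stays bounded (in the sense of distributions) as `x₃ → -∞`. -/
def IsBoundedAtInfinity (T : testFields →ₗ[ℂ] ℂ) : Prop :=
  ∀ V : testFields, ∃ C : ℝ, ∀ τ : ℝ, 0 ≤ τ → ‖T (shift τ V)‖ ≤ C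

/-- Sommerfeld's radiation condition for the propagating modes: each coefficient `g` of the field
with respect to `Φₙ⁽ˢ⁾`, `λₙ < k²`, satisfies `g' + i βₙ g → 0` as `x₃ → -∞` (in the sense of
distributions). With time dependence `exp(-iωt)`, as in Maxwell's equations here, this selects
the waves travelling towards `x₃ = -∞`. -/
def IsOutgoing (T : testFields →ₗ[ℂ] ℂ) : Prop :=
  ∀ p : ModeIdx, G.eig p.1.1 < G.k ^ 2 → ∀ (V : testFields) (h : ℝ → ℂ),
    (∀ x, V.1 x = h x.2 • G.Φ p.1.1 p.2 x.1) →
    Tendsto (fun τ : ℝ => T (shift τ (-dz V + (Complex.I * G.β p.1.1) • V))) atTop (𝓝 0)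

/-- `T` is a solution of the boundary value problem with the radiation condition. -/
structure IsSolution (J : ℝ × ℝ → Fin 3 → ℂ) (T : testFields →ₗ[ℂ] ℂ) : Prop where
  crossSectionL2 : G.IsCrossSectionL2 T
  maxwell : G.SolvesMaxwell J T
  bounded : IsBoundedAtInfinity T
  outgoing : G.IsOutgoing T

/-- Off the source plane the generalized field `T` is the continuous function `E`. -/
structure IsFieldOffSource (T : testFields →ₗ[ℂ] ℂ) (E : (ℝ × ℝ) × ℝ → Fin 3 → ℂ) : Prop where
  continuousOn : ContinuousOn E (G.W \ {x | x.2 = -G.L})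
  represents : ∀ V : testFields, (∃ δ > 0, ∀ x, |x.2 + G.L| < δ → V.1 x = 0) →
    IntegrableOn (fun x => E x ⬝ᵥ V.1 x) G.W ∧ T V = ∫ x in G.W, E x ⬝ᵥ V.1 x

/-! ### The mode amplitudes -/

/-- `⟨Φₙ⁽ˢ⁾, J⟩ / ‖Φₙ⁽ˢ⁾‖²`. -/
def coef (J : ℝ × ℝ → Fin 3 → ℂ) (n : ℕ × ℕ) (s : ℕ) : ℂ :=
  G.innerΩ (G.Φ n s) J / G.innerΩ (G.Φ n s) (G.Φ n s)

/-- The amplitudes `b⁺` of `exp(-i βₙ x₃)` between the source and the end wall. -/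
def bPlus (J : ℝ × ℝ → Fin 3 → ℂ) (n : ℕ × ℕ) (s : ℕ) : ℂ :=
  let tm : ℂ := (G.freq * G.mu * G.β n / (2 * G.k ^ 2) * G.coef J n 1 +
    Complex.I * G.freq * G.mu / (2 * G.k ^ 2) * G.coef J n 2) *
      Complex.exp (Complex.I * G.β n * G.L)
  match s with
  | 0 => G.freq * G.mu / (2 * G.β n) * G.coef J n 0 * Complex.exp (Complex.I * G.β n * G.L)
  | 1 => tm
  | _ => Complex.I * G.eig n / G.β n * tm

/-- The amplitudes `a⁺` of `exp(i βₙ x₃)` between the source and the end wall. -/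
def aPlus (J : ℝ × ℝ → Fin 3 → ℂ) (n : ℕ × ℕ) (s : ℕ) : ℂ :=
  match s with
  | 0 => -G.bPlus J n 0
  | 1 => -G.bPlus J n 1
  | _ => G.bPlus J n 2

/-- The amplitudes `b⁻` of `exp(-i βₙ x₃)` beyond the source. -/
def bMinus (J : ℝ × ℝ → Fin 3 → ℂ) (n : ℕ × ℕ) (s : ℕ) : ℂ :=
  let eP : ℂ := Complex.exp (Complex.I * G.β n * G.L)
  let eM : ℂ := Complex.exp (-(Complex.I * G.β n * G.L))
  let tm : ℂ := G.freq * G.mu * G.β n / (2 * G.k ^ 2) * G.coef J n 1 * (eP - eM) +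
    Complex.I * G.freq * G.mu / (2 * G.k ^ 2) * G.coef J n 2 * (eP + eM)
  match s with
  | 0 => G.freq * G.mu / (2 * G.β n) * G.coef J n 0 * (eP - eM)
  | 1 => tm
  | _ => Complex.I * G.eig n / G.β n * tm

end Waveguide

end

open MeasureTheory Filter Topology Set
open scoped ContDiff Matrix

noncomputable section

namespace Waveguide

variable (G : Waveguide)

/-! The proof is separation of variables, carried out for distributions in x₃.

Basis. Orthogonality comes from the product-to-sum formulas. For completeness, an integrable
function on Ω that is orthogonal to all products of cosines vanishes by Stone–Weierstrass
(`ae_eq_zero_of_cosCos`). Multiplication by sin(πy/l), which is positive inside the interval,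
reduces sine factors to cosine factors. For a fixed index pair the te and tm fields can be solved
for the two fields with a single transverse component, so orthogonality to all modes gives
orthogonality of each component to its own trigonometric system (`ae_eq_zero_of_innerΩ_mode`).

Uniqueness. A generalized field is determined by its mode coefficients, because the mode expansion
of a test field converges in every norm that may control the functional (`tendsto_proj`). For the
difference of two solutions each coefficient g satisfies g'' + β²g = 0 and g(0) = 0 weakly: at once
for te, and for tm after elimination of the longitudinal coefficient, which is then determined
because β ≠ 0. Every f orthogonal to exp(-iβs) - exp(iβs) on s < 0 agrees there with some h'' + β²h,
h(0) = 0 (Duhamel's formula). So g is a multiple of that standing wave, which is excluded by the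
radiation condition if β is real and by boundedness if β is imaginary (`functional_eq_zero`).

Existence. The solution is the sum of the explicit contributions `modeSol`. Multiplied by the norm
of its mode, a profile is at most a constant times the source coefficients times |β| exp(-Im β |x₃ +
L|), with one constant for all modes, since |β| stays away from zero (`exists_norm_profile_le`). The
integral of the last factor over an interval is bounded uniformly in the mode, so the sum converges
by Cauchy–Schwarz at the price of one x₃-derivative of the test field. Maxwell's equations then
reduce to the jumps of the profiles at -L; the tm and longitudinal modes balance only together, and
only with the term concentrated on the source plane (`modeSol_tm_lo`). At positive distance from
that plane the exponential decay gives a summable majorant (`exists_majorant`), hence continuity and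
the pointwise series. -/

/-! ### Fields with separated variables -/

/-- The field on the cross-section with components `fᵢ(x₁) gᵢ(x₂)`. -/
def sepField (f g : Fin 3 → ℝ → ℝ) : ℝ × ℝ → Fin 3 → ℂ :=
  fun x i => ((f i x.1 * g i x.2 : ℝ) : ℂ)

theorem contDiff_sepField {f g : Fin 3 → ℝ → ℝ} (hf : ∀ i, ContDiff ℝ ∞ (f i))
    (hg : ∀ i, ContDiff ℝ ∞ (g i)) : ContDiff ℝ ∞ (sepField f g) := by
  refine contDiff_pi.2 fun i => ?_
  exact Complex.ofRealCLM.contDiff.comp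
    (((hf i).comp contDiff_fst).mul ((hg i).comp contDiff_snd))

theorem pd2_apply {u : ℝ × ℝ → Fin 3 → ℂ} {x : ℝ × ℝ} (hu : DifferentiableAt ℝ u x) (e : ℝ × ℝ)
    (i : Fin 3) : pd2 e u x i = fderiv ℝ (fun y => u y i) x e := by
  rw [pd2, fderiv_apply hu]; rfl

theorem hasFDerivAt_sepField {f f' g g' : Fin 3 → ℝ → ℝ} (hf : ∀ i y, HasDerivAt (f i) (f' i y) y)
    (hg : ∀ i y, HasDerivAt (g i) (g' i y) y) (x : ℝ × ℝ) :
    HasFDerivAt (sepField f g) (ContinuousLinearMap.pi fun i => Complex.ofRealCLM.comp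
      (f i x.1 • (g' i x.2 • ContinuousLinearMap.snd ℝ ℝ ℝ) +
        g i x.2 • (f' i x.1 • ContinuousLinearMap.fst ℝ ℝ ℝ))) x := by
  refine hasFDerivAt_pi.2 fun i => ?_
  exact Complex.ofRealCLM.hasFDerivAt.comp x
    (((hf i x.1).comp_hasFDerivAt x hasFDerivAt_fst).mul
      ((hg i x.2).comp_hasFDerivAt x hasFDerivAt_snd))

theorem pd2_fst_sepField {f f' g : Fin 3 → ℝ → ℝ} (hf : ∀ i y, HasDerivAt (f i) (f' i y) y)
    (hg : ∀ i, Differentiable ℝ (g i)) : pd2 (1, 0) (sepField f g) = sepField f' g := by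
  funext x i
  simp [pd2, (hasFDerivAt_sepField hf (fun i y => (hg i y).hasDerivAt) x).fderiv, sepField, mul_comm]

theorem pd2_snd_sepField {f g g' : Fin 3 → ℝ → ℝ} (hf : ∀ i, Differentiable ℝ (f i))
    (hg : ∀ i y, HasDerivAt (g i) (g' i y) y) :
    pd2 (0, 1) (sepField f g) = sepField f g' := by
  funext x i
  simp [pd2, (hasFDerivAt_sepField (fun i y => (hf i y).hasDerivAt) hg x).fderiv, sepField]

theorem pd2_const_smul (c : ℂ) {u : ℝ × ℝ → Fin 3 → ℂ} (e : ℝ × ℝ) :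
    pd2 e (c • u) = c • pd2 e u := by
  funext x
  simp only [pd2, fderiv_const_smul_field, Pi.smul_apply]
  rfl

/-! ### The trigonometric fields -/

/-- The curl of a field that does not depend on `x₃`. -/
def rot (u : ℝ × ℝ → Fin 3 → ℂ) : ℝ × ℝ → Fin 3 → ℂ := fun x =>
  ![pd2 (0, 1) u x 2, -pd2 (1, 0) u x 2, pd2 (1, 0) u x 1 - pd2 (0, 1) u x 0]

/-- The vector product `u × e₃`. -/
def crossAxis (u : ℝ × ℝ → Fin 3 → ℂ) : ℝ × ℝ → Fin 3 → ℂ := fun x => ![u x 1, -u x 0, 0]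

/-- The transverse electric field. -/
def te (p q : ℝ) : ℝ × ℝ → Fin 3 → ℂ :=
  sepField ![fun y => q * Real.cos (p * y), fun y => -(p * Real.sin (p * y)), fun _ => 0]
    ![fun y => Real.sin (q * y), fun y => Real.cos (q * y), fun _ => 0]

/-- The transverse curl free field. -/
def tm (p q : ℝ) : ℝ × ℝ → Fin 3 → ℂ :=
  sepField ![fun y => p * Real.cos (p * y), fun y => q * Real.sin (p * y), fun _ => 0]
    ![fun y => Real.sin (q * y), fun y => Real.cos (q * y), fun _ => 0]

/-- The longitudinal field. -/
def lo (p q : ℝ) : ℝ × ℝ → Fin 3 → ℂ :=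
  sepField ![fun _ => 0, fun _ => 0, fun y => Real.sin (p * y)]
    ![fun _ => 0, fun _ => 0, fun y => Real.sin (q * y)]

theorem hasDerivAt_sin_mul (p y : ℝ) :
    HasDerivAt (fun y => Real.sin (p * y)) (p * Real.cos (p * y)) y := by
  simpa [mul_comm] using ((hasDerivAt_id y).const_mul p).sin

theorem hasDerivAt_cos_mul (p y : ℝ) :
    HasDerivAt (fun y => Real.cos (p * y)) (-(p * Real.sin (p * y))) y := by
  simpa [mul_comm] using ((hasDerivAt_id y).const_mul p).cos

/-- The magnetic field of `te`, up to a factor. -/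
def cc (p q : ℝ) : ℝ × ℝ → Fin 3 → ℂ :=
  sepField ![fun _ => 0, fun _ => 0, fun y => Real.cos (p * y)]
    ![fun _ => 0, fun _ => 0, fun y => Real.cos (q * y)]

theorem pd2_fst_te (p q : ℝ) : pd2 (1, 0) (te p q) =
    sepField ![fun y => q * -(p * Real.sin (p * y)), fun y => -(p * (p * Real.cos (p * y))),
      fun _ => 0] ![fun y => Real.sin (q * y), fun y => Real.cos (q * y), fun _ => 0] := by
  refine pd2_fst_sepField ?_ ?_
  · intro i y; fin_cases i
    · exact (hasDerivAt_cos_mul p y).const_mul q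
    · exact ((hasDerivAt_sin_mul p y).const_mul p).neg
    · exact hasDerivAt_const y 0
  · intro i; fin_cases i <;> simp <;> fun_prop

theorem pd2_snd_te (p q : ℝ) : pd2 (0, 1) (te p q) =
    sepField ![fun y => q * Real.cos (p * y), fun y => -(p * Real.sin (p * y)), fun _ => 0]
    ![fun y => q * Real.cos (q * y), fun y => -(q * Real.sin (q * y)), fun _ => 0] := by
  refine pd2_snd_sepField ?_ ?_
  · intro i; fin_cases i <;> simp <;> fun_prop
  · intro i y; fin_cases i
    · exact hasDerivAt_sin_mul q y
    · exact hasDerivAt_cos_mul q y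
    · exact hasDerivAt_const y 0

theorem pd2_fst_tm (p q : ℝ) : pd2 (1, 0) (tm p q) =
    sepField ![fun y => p * -(p * Real.sin (p * y)), fun y => q * (p * Real.cos (p * y)),
      fun _ => 0] ![fun y => Real.sin (q * y), fun y => Real.cos (q * y), fun _ => 0] := by
  refine pd2_fst_sepField ?_ ?_
  · intro i y; fin_cases i
    · exact (hasDerivAt_cos_mul p y).const_mul p
    · exact (hasDerivAt_sin_mul p y).const_mul q
    · exact hasDerivAt_const y 0
  · intro i; fin_cases i <;> simp <;> fun_prop

theorem pd2_snd_tm (p q : ℝ) : pd2 (0, 1) (tm p q) =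
    sepField ![fun y => p * Real.cos (p * y), fun y => q * Real.sin (p * y), fun _ => 0]
    ![fun y => q * Real.cos (q * y), fun y => -(q * Real.sin (q * y)), fun _ => 0] := by
  refine pd2_snd_sepField ?_ ?_
  · intro i; fin_cases i <;> simp <;> fun_prop
  · intro i y; fin_cases i
    · exact hasDerivAt_sin_mul q y
    · exact hasDerivAt_cos_mul q y
    · exact hasDerivAt_const y 0

theorem pd2_fst_lo (p q : ℝ) : pd2 (1, 0) (lo p q) =
    sepField ![fun _ => 0, fun _ => 0, fun y => p * Real.cos (p * y)]
      ![fun _ => 0, fun _ => 0, fun y => Real.sin (q * y)] := by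
  refine pd2_fst_sepField ?_ ?_
  · intro i y; fin_cases i
    · exact hasDerivAt_const y 0
    · exact hasDerivAt_const y 0
    · exact hasDerivAt_sin_mul p y
  · intro i; fin_cases i <;> simp <;> fun_prop

theorem pd2_snd_lo (p q : ℝ) : pd2 (0, 1) (lo p q) =
    sepField ![fun _ => 0, fun _ => 0, fun y => Real.sin (p * y)]
      ![fun _ => 0, fun _ => 0, fun y => q * Real.cos (q * y)] := by
  refine pd2_snd_sepField ?_ ?_
  · intro i; fin_cases i <;> simp <;> fun_prop
  · intro i y; fin_cases i
    · exact hasDerivAt_const y 0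
    · exact hasDerivAt_const y 0
    · exact hasDerivAt_sin_mul q y

theorem pd2_fst_cc (p q : ℝ) : pd2 (1, 0) (cc p q) =
    sepField ![fun _ => 0, fun _ => 0, fun y => -(p * Real.sin (p * y))]
      ![fun _ => 0, fun _ => 0, fun y => Real.cos (q * y)] := by
  refine pd2_fst_sepField ?_ ?_
  · intro i y; fin_cases i
    · exact hasDerivAt_const y 0
    · exact hasDerivAt_const y 0
    · exact hasDerivAt_cos_mul p y
  · intro i; fin_cases i <;> simp <;> fun_prop

theorem pd2_snd_cc (p q : ℝ) : pd2 (0, 1) (cc p q) =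
    sepField ![fun _ => 0, fun _ => 0, fun y => Real.cos (p * y)]
      ![fun _ => 0, fun _ => 0, fun y => -(q * Real.sin (q * y))] := by
  refine pd2_snd_sepField ?_ ?_
  · intro i; fin_cases i <;> simp <;> fun_prop
  · intro i y; fin_cases i
    · exact hasDerivAt_const y 0
    · exact hasDerivAt_const y 0
    · exact hasDerivAt_cos_mul q y

theorem contDiff_te (p q : ℝ) : ContDiff ℝ ∞ (te p q) := by
  refine contDiff_sepField ?_ ?_ <;> intro i <;> fin_cases i <;> simp <;> fun_prop

theorem contDiff_tm (p q : ℝ) : ContDiff ℝ ∞ (tm p q) := by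
  refine contDiff_sepField ?_ ?_ <;> intro i <;> fin_cases i <;> simp <;> fun_prop

theorem contDiff_lo (p q : ℝ) : ContDiff ℝ ∞ (lo p q) := by
  refine contDiff_sepField ?_ ?_ <;> intro i <;> fin_cases i <;> simp <;> fun_prop

theorem rot_const_smul (c : ℂ) (u : ℝ × ℝ → Fin 3 → ℂ) : rot (c • u) = c • rot u := by
  funext x i
  fin_cases i <;> simp [rot, pd2_const_smul, mul_sub]

theorem crossAxis_const_smul (c : ℂ) (u : ℝ × ℝ → Fin 3 → ℂ) :
    crossAxis (c • u) = c • crossAxis u := by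
  funext x i
  fin_cases i <;> simp [crossAxis]

theorem rot_te (p q : ℝ) : rot (te p q) = (-(p ^ 2 + q ^ 2) : ℂ) • cc p q := by
  funext x i
  fin_cases i <;> simp [rot, pd2_fst_te, pd2_snd_te, sepField, cc]
  ring

theorem rot_cc (p q : ℝ) : rot (cc p q) = (-1 : ℂ) • te p q := by
  funext x i
  fin_cases i <;> simp [rot, pd2_fst_cc, pd2_snd_cc, sepField, te] <;> ring

theorem rot_rot_te (p q : ℝ) : rot (rot (te p q)) = (p ^ 2 + q ^ 2 : ℂ) • te p q := by
  rw [rot_te, rot_const_smul, rot_cc, smul_smul]; simp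

theorem crossAxis_rot_te (p q : ℝ) : crossAxis (rot (te p q)) = 0 := by
  rw [rot_te]
  funext x i
  fin_cases i <;> simp [crossAxis, cc, sepField]

theorem pd2_crossAxis {u : ℝ × ℝ → Fin 3 → ℂ} (hu : ContDiff ℝ ∞ u) (e : ℝ × ℝ) :
    pd2 e (crossAxis u) = crossAxis (pd2 e u) := by
  have hd : Differentiable ℝ u := hu.differentiable (by simp)
  have hd' : ∀ i, Differentiable ℝ fun y => u y i := fun i => by fun_prop
  have hc : Differentiable ℝ (crossAxis u) := by
    refine differentiable_pi.2 fun i => ?_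
    fin_cases i
    · exact hd' 1
    · exact (hd' 0).neg
    · exact differentiable_const _
  funext x i
  rw [pd2_apply (hc x)]
  fin_cases i <;> simp [crossAxis, pd2_apply (hd x)]

/-- The divergence of the transverse part becomes a longitudinal component. It is zero for te, which
therefore decouples, and a multiple of sin sin for tm, which couples tm to lo. -/
theorem rot_crossAxis {u : ℝ × ℝ → Fin 3 → ℂ} (hu : ContDiff ℝ ∞ u) :
    rot (crossAxis u) = fun x => ![0, 0, -(pd2 (1, 0) u x 0 + pd2 (0, 1) u x 1)] := by
  funext x i
  fin_cases i <;> simp [rot, pd2_crossAxis hu, crossAxis]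
  ring

theorem rot_crossAxis_te (p q : ℝ) : rot (crossAxis (te p q)) = 0 := by
  rw [rot_crossAxis (contDiff_te p q)]
  funext x i
  fin_cases i <;> simp [pd2_fst_te, pd2_snd_te, sepField]
  ring

theorem crossAxis_crossAxis_te (p q : ℝ) : crossAxis (crossAxis (te p q)) = -te p q := by
  funext x i
  fin_cases i <;> simp [crossAxis, te, sepField]

theorem rot_tm (p q : ℝ) : rot (tm p q) = 0 := by
  funext x i
  fin_cases i <;> simp [rot, pd2_fst_tm, pd2_snd_tm, sepField]
  ring

theorem rot_crossAxis_tm (p q : ℝ) : rot (crossAxis (tm p q)) = (p ^ 2 + q ^ 2 : ℂ) • lo p q := by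
  rw [rot_crossAxis (contDiff_tm p q)]
  funext x i
  fin_cases i <;> simp [pd2_fst_tm, pd2_snd_tm, sepField, lo]
  ring

theorem crossAxis_crossAxis_tm (p q : ℝ) : crossAxis (crossAxis (tm p q)) = -tm p q := by
  funext x i
  fin_cases i <;> simp [crossAxis, tm, sepField]

theorem rot_lo (p q : ℝ) : rot (lo p q) = crossAxis (tm p q) := by
  funext x i
  fin_cases i <;> simp [rot, pd2_fst_lo, pd2_snd_lo, sepField, tm, crossAxis] <;> ring

theorem crossAxis_lo (p q : ℝ) : crossAxis (lo p q) = 0 := by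
  funext x i
  fin_cases i <;> simp [crossAxis, lo, sepField]

theorem neg_laplacian_te (p q : ℝ) (x : ℝ × ℝ) :
    -(pd2 (1, 0) (pd2 (1, 0) (te p q)) x + pd2 (0, 1) (pd2 (0, 1) (te p q)) x) =
      (p ^ 2 + q ^ 2 : ℂ) • te p q x := by
  have h1 : pd2 (1, 0) (pd2 (1, 0) (te p q)) = sepField
      ![fun y => q * -(p * (p * Real.cos (p * y))), fun y => -(p * (p * -(p * Real.sin (p * y)))),
      fun _ => 0] ![fun y => Real.sin (q * y), fun y => Real.cos (q * y), fun _ => 0] := by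
    rw [pd2_fst_te]
    refine pd2_fst_sepField ?_ ?_
    · intro i y; fin_cases i
      · exact ((hasDerivAt_sin_mul p y).const_mul p).neg.const_mul q
      · exact (((hasDerivAt_cos_mul p y).const_mul p).const_mul p).neg
      · exact hasDerivAt_const y 0
    · intro i; fin_cases i <;> simp <;> fun_prop
  have h2 : pd2 (0, 1) (pd2 (0, 1) (te p q)) = sepField
      ![fun y => q * Real.cos (p * y), fun y => -(p * Real.sin (p * y)), fun _ => 0]
      ![fun y => q * -(q * Real.sin (q * y)), fun y => -(q * (q * Real.cos (q * y))),
        fun _ => 0] := by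
    rw [pd2_snd_te]
    refine pd2_snd_sepField ?_ ?_
    · intro i; fin_cases i <;> simp <;> fun_prop
    · intro i y; fin_cases i
      · exact (hasDerivAt_cos_mul q y).const_mul q
      · exact ((hasDerivAt_sin_mul q y).const_mul q).neg
      · exact hasDerivAt_const y 0
  rw [h1, h2]
  funext i
  fin_cases i <;> simp [sepField, te] <;> ring

theorem neg_laplacian_tm (p q : ℝ) (x : ℝ × ℝ) :
    -(pd2 (1, 0) (pd2 (1, 0) (tm p q)) x + pd2 (0, 1) (pd2 (0, 1) (tm p q)) x) =
      (p ^ 2 + q ^ 2 : ℂ) • tm p q x := by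
  have h1 : pd2 (1, 0) (pd2 (1, 0) (tm p q)) = sepField
      ![fun y => p * -(p * (p * Real.cos (p * y))), fun y => q * (p * -(p * Real.sin (p * y))),
      fun _ => 0] ![fun y => Real.sin (q * y), fun y => Real.cos (q * y), fun _ => 0] := by
    rw [pd2_fst_tm]
    refine pd2_fst_sepField ?_ ?_
    · intro i y; fin_cases i
      · exact ((hasDerivAt_sin_mul p y).const_mul p).neg.const_mul p
      · exact ((hasDerivAt_cos_mul p y).const_mul p).const_mul q
      · exact hasDerivAt_const y 0
    · intro i; fin_cases i <;> simp <;> fun_prop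
  have h2 : pd2 (0, 1) (pd2 (0, 1) (tm p q)) = sepField
      ![fun y => p * Real.cos (p * y), fun y => q * Real.sin (p * y), fun _ => 0]
      ![fun y => q * -(q * Real.sin (q * y)), fun y => -(q * (q * Real.cos (q * y))),
        fun _ => 0] := by
    rw [pd2_snd_tm]
    refine pd2_snd_sepField ?_ ?_
    · intro i; fin_cases i <;> simp <;> fun_prop
    · intro i y; fin_cases i
      · exact (hasDerivAt_cos_mul q y).const_mul q
      · exact ((hasDerivAt_sin_mul q y).const_mul q).neg
      · exact hasDerivAt_const y 0
  rw [h1, h2]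
  funext i
  fin_cases i <;> simp [sepField, tm] <;> ring

theorem neg_laplacian_lo (p q : ℝ) (x : ℝ × ℝ) :
    -(pd2 (1, 0) (pd2 (1, 0) (lo p q)) x + pd2 (0, 1) (pd2 (0, 1) (lo p q)) x) =
      (p ^ 2 + q ^ 2 : ℂ) • lo p q x := by
  have h1 : pd2 (1, 0) (pd2 (1, 0) (lo p q)) = sepField
      ![fun _ => 0, fun _ => 0, fun y => p * -(p * Real.sin (p * y))]
      ![fun _ => 0, fun _ => 0, fun y => Real.sin (q * y)] := by
    rw [pd2_fst_lo]
    refine pd2_fst_sepField ?_ ?_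
    · intro i y; fin_cases i
      · exact hasDerivAt_const y 0
      · exact hasDerivAt_const y 0
      · exact (hasDerivAt_cos_mul p y).const_mul p
    · intro i; fin_cases i <;> simp <;> fun_prop
  have h2 : pd2 (0, 1) (pd2 (0, 1) (lo p q)) = sepField
      ![fun _ => 0, fun _ => 0, fun y => Real.sin (p * y)]
      ![fun _ => 0, fun _ => 0, fun y => q * -(q * Real.sin (q * y))] := by
    rw [pd2_snd_lo]
    refine pd2_snd_sepField ?_ ?_
    · intro i; fin_cases i <;> simp <;> fun_prop
    · intro i y; fin_cases i
      · exact hasDerivAt_const y 0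
      · exact hasDerivAt_const y 0
      · exact (hasDerivAt_cos_mul q y).const_mul q
  rw [h1, h2]
  funext i
  fin_cases i <;> simp [sepField, lo]
  ring

/-! ### Trigonometric integrals -/

/-- Integer frequencies are allowed so that both n - m and n + m of the product-to-sum formulas are
covered. -/
theorem integral_cos_int {l : ℝ} (hl : 0 < l) (j : ℤ) :
    ∫ x in Ioo 0 l, Real.cos (Real.pi * j / l * x) = if j = 0 then l else 0 := by
  rw [← integral_Ioc_eq_integral_Ioo, ← intervalIntegral.integral_of_le hl.le]
  split_ifs with hj
  · simp [hj]
  · have hc : Real.pi * j / l ≠ 0 := by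
      have := Real.pi_ne_zero
      positivity
    rw [intervalIntegral.integral_comp_mul_left (fun x => Real.cos x) hc, integral_cos]
    have : Real.pi * j / l * l = j * Real.pi := by field_simp
    simp [this, Real.sin_int_mul_pi]

theorem integrableOn_Ioo_of_continuous {f : ℝ → ℝ} (hf : Continuous f) (a b : ℝ) :
    IntegrableOn f (Ioo a b) :=
  (hf.continuousOn.integrableOn_compact isCompact_Icc).mono_set Ioo_subset_Icc_self

theorem integral_cos_mul_cos {l : ℝ} (hl : 0 < l) (n m : ℕ) :
    ∫ x in Ioo 0 l, Real.cos (Real.pi * n / l * x) * Real.cos (Real.pi * m / l * x) =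
      ((if (n : ℤ) - m = 0 then l else 0) + (if (n : ℤ) + m = 0 then l else 0)) / 2 := by
  rw [← integral_cos_int hl, ← integral_cos_int hl, ← integral_add, ← integral_div]
  · refine integral_congr_ae (ae_of_all _ fun x => ?_)
    have h1 : Real.pi * ((n - m : ℤ) : ℝ) / l * x =
      Real.pi * n / l * x - Real.pi * m / l * x := by push_cast; ring
    have h2 : Real.pi * ((n + m : ℤ) : ℝ) / l * x =
      Real.pi * n / l * x + Real.pi * m / l * x := by push_cast; ring
    simp only [h1, h2, Real.cos_sub, Real.cos_add]
    ring
  · exact integrableOn_Ioo_of_continuous (by fun_prop) _ _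
  · exact integrableOn_Ioo_of_continuous (by fun_prop) _ _

theorem integral_sin_mul_sin {l : ℝ} (hl : 0 < l) (n m : ℕ) :
    ∫ x in Ioo 0 l, Real.sin (Real.pi * n / l * x) * Real.sin (Real.pi * m / l * x) =
      ((if (n : ℤ) - m = 0 then l else 0) - (if (n : ℤ) + m = 0 then l else 0)) / 2 := by
  rw [← integral_cos_int hl, ← integral_cos_int hl, ← integral_sub, ← integral_div]
  · refine integral_congr_ae (ae_of_all _ fun x => ?_)
    have h1 : Real.pi * ((n - m : ℤ) : ℝ) / l * x =
      Real.pi * n / l * x - Real.pi * m / l * x := by push_cast; ring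
    have h2 : Real.pi * ((n + m : ℤ) : ℝ) / l * x =
      Real.pi * n / l * x + Real.pi * m / l * x := by push_cast; ring
    simp only [h1, h2, Real.cos_sub, Real.cos_add]
    ring
  · exact integrableOn_Ioo_of_continuous (by fun_prop) _ _
  · exact integrableOn_Ioo_of_continuous (by fun_prop) _ _

theorem integral_cos_mul_cos_of_ne {l : ℝ} (hl : 0 < l) {n m : ℕ} (h : n ≠ m) :
    ∫ x in Ioo 0 l, Real.cos (Real.pi * n / l * x) * Real.cos (Real.pi * m / l * x) = 0 := by
  rw [integral_cos_mul_cos hl, if_neg (by omega), if_neg (by omega)]; simp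

theorem integral_sin_mul_sin_of_ne {l : ℝ} (hl : 0 < l) {n m : ℕ} (h : n ≠ m) :
    ∫ x in Ioo 0 l, Real.sin (Real.pi * n / l * x) * Real.sin (Real.pi * m / l * x) = 0 := by
  rw [integral_sin_mul_sin hl, if_neg (by omega), if_neg (by omega)]; simp

theorem integral_cos_mul_self {l : ℝ} (hl : 0 < l) {n : ℕ} (h : n ≠ 0) :
    ∫ x in Ioo 0 l, Real.cos (Real.pi * n / l * x) * Real.cos (Real.pi * n / l * x) = l / 2 := by
  rw [integral_cos_mul_cos hl, if_pos (by omega), if_neg (by omega)]; simp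

theorem integral_sin_mul_self {l : ℝ} (hl : 0 < l) {n : ℕ} (h : n ≠ 0) :
    ∫ x in Ioo 0 l, Real.sin (Real.pi * n / l * x) * Real.sin (Real.pi * n / l * x) = l / 2 := by
  rw [integral_sin_mul_sin hl, if_pos (by omega), if_neg (by omega)]; simp

theorem integrableOn_Ω_of_continuous {E : Type*} [NormedAddCommGroup E] {f : ℝ × ℝ → E}
    (hf : Continuous f) : IntegrableOn f G.Ω :=
  (hf.continuousOn.integrableOn_compact
    (isCompact_Icc.prod isCompact_Icc)).mono_set
      (prod_mono Ioo_subset_Icc_self Ioo_subset_Icc_self)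

theorem measurableSet_Ω : MeasurableSet G.Ω := measurableSet_Ioo.prod measurableSet_Ioo

theorem isOpen_Ω : IsOpen G.Ω := isOpen_Ioo.prod isOpen_Ioo

theorem innerΩ_sepField {f g f' g' : Fin 3 → ℝ → ℝ} (hf : ∀ i, Continuous (f i))
    (hg : ∀ i, Continuous (g i)) (hf' : ∀ i, Continuous (f' i)) (hg' : ∀ i, Continuous (g' i)) :
    G.innerΩ (sepField f g) (sepField f' g') =
      ((∑ i, (∫ x in Ioo 0 G.L₁, f i x * f' i x) * ∫ y in Ioo 0 G.L₂, g i y * g' i y : ℝ) : ℂ) := by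
  have h : ∀ x, star (sepField f g x) ⬝ᵥ sepField f' g' x =
      ((∑ i, (f i x.1 * f' i x.1) * (g i x.2 * g' i x.2) : ℝ) : ℂ) := fun x => by
    simp only [dotProduct, sepField, Pi.star_apply, RCLike.star_def, Complex.conj_ofReal,
      Complex.ofReal_sum, Complex.ofReal_mul, map_mul]
    exact Finset.sum_congr rfl fun i _ => by ring
  simp only [innerΩ, h]
  rw [integral_complex_ofReal, integral_finsetSum]
  · congr 1
    refine Finset.sum_congr rfl fun i _ => ?_
    rw [Ω, Measure.volume_eq_prod, setIntegral_prod_mul (fun x => f i x * f' i x)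
      (fun y => g i y * g' i y)]
  · intro i _
    have := hf i; have := hg i; have := hf' i; have := hg' i
    exact G.integrableOn_Ω_of_continuous (by fun_prop)

/-! ### The modes -/

/-- The wavenumber `π n₁ / L₁`. -/
def kx (n : ℕ × ℕ) : ℝ := Real.pi * n.1 / G.L₁

/-- The wavenumber `π n₂ / L₂`. -/
def ky (n : ℕ × ℕ) : ℝ := Real.pi * n.2 / G.L₂

theorem eig_eq (n : ℕ × ℕ) : G.eig n = G.kx n ^ 2 + G.ky n ^ 2 := rfl

theorem kx_ne_zero {n : ℕ × ℕ} (h : n.1 ≠ 0) : G.kx n ≠ 0 := by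
  have := G.L₁_pos.ne'; have := Real.pi_ne_zero
  rw [kx]; positivity

theorem ky_ne_zero {n : ℕ × ℕ} (h : n.2 ≠ 0) : G.ky n ≠ 0 := by
  have := G.L₂_pos.ne'; have := Real.pi_ne_zero
  rw [ky]; positivity

theorem eig_pos (n : Idx) : 0 < G.eig n.1 := by
  obtain ⟨⟨a, b⟩, h⟩ := n
  rw [eig_eq]
  by_cases ha : a = 0
  · have hb : b ≠ 0 := fun hb => h (by simp [ha, hb])
    have := G.ky_ne_zero (n := (a, b)) hb
    positivity
  · have := G.kx_ne_zero (n := (a, b)) ha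
    positivity

theorem Φ_zero {n : ℕ × ℕ} (h : n.1 * n.2 ≠ 0) : G.Φ n 0 = te (G.kx n) (G.ky n) := by
  funext x i
  simp only [Φ, if_neg h]
  fin_cases i <;> simp [te, sepField, kx, ky]

theorem Φ_one {n : ℕ × ℕ} (h : n.1 * n.2 ≠ 0) : G.Φ n 1 = tm (G.kx n) (G.ky n) := by
  funext x i
  simp only [Φ, if_neg h]
  fin_cases i <;> simp [tm, sepField, kx, ky]

theorem Φ_two {n : ℕ × ℕ} (h : n.1 * n.2 ≠ 0) : G.Φ n 2 = lo (G.kx n) (G.ky n) := by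
  funext x i
  simp only [Φ, if_neg h]
  fin_cases i <;> simp [lo, sepField, kx, ky]

/-- If one index is zero, only one component of te survives, q sin(q x₂) or -p sin(p x₁), and `Φ`
drops its constant factor. Hence r is 1/q or -1/p there, and 1 otherwise; the degenerate index pairs
need no separate theory. -/
theorem exists_Φ_eq_smul_te (n : Idx) :
    ∃ r : ℝ, r ≠ 0 ∧ G.Φ n.1 0 = (r : ℂ) • te (G.kx n.1) (G.ky n.1) := by
  obtain ⟨⟨a, b⟩, hn⟩ := n
  by_cases h : a * b = 0
  · by_cases ha : a = 0
    · subst ha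
      have hb : b ≠ 0 := fun hb => hn (by simp [hb])
      have hq := G.ky_ne_zero (n := (0, b)) hb
      refine ⟨(G.ky (0, b))⁻¹, inv_ne_zero hq, ?_⟩
      have hq' : (G.ky (0, b) : ℂ) ≠ 0 := by exact_mod_cast hq
      funext x i
      have : Real.pi * b / G.L₂ = G.ky (0, b) := rfl
      fin_cases i <;> simp [Φ, te, sepField, kx, hb, this, hq']
    · have hb : b = 0 := by simpa [ha] using h
      subst hb
      have hp := G.kx_ne_zero (n := (a, 0)) ha
      refine ⟨-(G.kx (a, 0))⁻¹, neg_ne_zero.2 (inv_ne_zero hp), ?_⟩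
      have hp' : (G.kx (a, 0) : ℂ) ≠ 0 := by exact_mod_cast hp
      funext x i
      have : Real.pi * a / G.L₁ = G.kx (a, 0) := rfl
      fin_cases i <;> simp [Φ, te, sepField, ky, ha, this, hp']
  · exact ⟨1, one_ne_zero, by simpa using G.Φ_zero (n := (a, b)) h⟩

theorem modeIdx_cases (p : ModeIdx) :
    (p.2 : ℕ) = 0 ∨ (p.1.1.1 * p.1.1.2 ≠ 0 ∧ ((p.2 : ℕ) = 1 ∨ (p.2 : ℕ) = 2)) := by
  obtain ⟨n, s, hs⟩ := p
  simp only [mult] at hs ⊢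
  split_ifs at hs with h
  · left; omega
  · by_cases h0 : s = 0
    · exact Or.inl h0
    · right; exact ⟨h, by omega⟩

/-- A property of fields that is inherited by multiples holds for all modes if it holds for the
three families. -/
theorem mode_induction {P : (ℝ × ℝ → Fin 3 → ℂ) → ℝ × ℝ → Prop}
    (hte : ∀ (r : ℝ) (n : Idx), r ≠ 0 →
      P ((r : ℂ) • te (G.kx n.1) (G.ky n.1)) (G.kx n.1, G.ky n.1))
    (htm : ∀ n : Idx, n.1.1 * n.1.2 ≠ 0 → P (tm (G.kx n.1) (G.ky n.1)) (G.kx n.1, G.ky n.1))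
    (hlo : ∀ n : Idx, n.1.1 * n.1.2 ≠ 0 → P (lo (G.kx n.1) (G.ky n.1)) (G.kx n.1, G.ky n.1))
    (p : ModeIdx) : P (G.Φ p.1.1 p.2) (G.kx p.1.1, G.ky p.1.1) := by
  rcases modeIdx_cases p with h | ⟨hn, h | h⟩
  · obtain ⟨r, hr, h'⟩ := G.exists_Φ_eq_smul_te p.1
    rw [h, h']; exact hte r p.1 hr
  · rw [h, G.Φ_one hn]; exact htm _ hn
  · rw [h, G.Φ_two hn]; exact hlo _ hn

theorem contDiff_mode (p : ModeIdx) : ContDiff ℝ ∞ (G.Φ p.1.1 p.2) :=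
  G.mode_induction (P := fun u _ => ContDiff ℝ ∞ u)
    (fun _ _ _ => contDiff_const.smul (contDiff_te _ _)) (fun _ _ => contDiff_tm _ _)
    (fun _ _ => contDiff_lo _ _) p

theorem continuous_mode (p : ModeIdx) : Continuous (G.Φ p.1.1 p.2) := (G.contDiff_mode p).continuous

/-- The modes are real, so the bilinear pairing of distributions with test fields and the
sesquilinear inner product yield the same coefficients. -/
theorem star_mode (p : ModeIdx) (x : ℝ × ℝ) : star (G.Φ p.1.1 p.2 x) = G.Φ p.1.1 p.2 x := by
  refine G.mode_induction (P := fun u _ => star (u x) = u x) ?_ ?_ ?_ p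
  · intro r n _; funext i; simp [te, sepField]
  · intro n _; funext i; simp [tm, sepField]
  · intro n _; funext i; simp [lo, sepField]

/-- The components that vanish on the lateral walls. -/
structure WallZero (u : ℝ × ℝ → Fin 3 → ℂ) : Prop where
  fst : ∀ x : ℝ × ℝ, x.1 = 0 ∨ x.1 = G.L₁ → u x 1 = 0 ∧ u x 2 = 0
  snd : ∀ x : ℝ × ℝ, x.2 = 0 ∨ x.2 = G.L₂ → u x 0 = 0 ∧ u x 2 = 0

theorem sin_kx {n : ℕ × ℕ} {y : ℝ} (h : y = 0 ∨ y = G.L₁) : Real.sin (G.kx n * y) = 0 := by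
  rcases h with rfl | rfl
  · simp
  · have := G.L₁_pos.ne'
    rw [kx, div_mul_cancel₀ _ this, mul_comm, Real.sin_nat_mul_pi]

theorem sin_ky {n : ℕ × ℕ} {y : ℝ} (h : y = 0 ∨ y = G.L₂) : Real.sin (G.ky n * y) = 0 := by
  rcases h with rfl | rfl
  · simp
  · have := G.L₂_pos.ne'
    rw [ky, div_mul_cancel₀ _ this, mul_comm, Real.sin_nat_mul_pi]

theorem wallZero_mode (p : ModeIdx) : G.WallZero (G.Φ p.1.1 p.2) := by
  refine G.mode_induction (P := fun u _ => G.WallZero u) ?_ ?_ ?_ p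
  · refine fun r n _ => ⟨fun x hx => ?_, fun x hx => ?_⟩
    · simp [te, sepField, G.sin_kx hx, -Complex.ofReal_sin]
    · simp [te, sepField, G.sin_ky hx, -Complex.ofReal_sin]
  · refine fun n _ => ⟨fun x hx => ?_, fun x hx => ?_⟩
    · simp [tm, sepField, G.sin_kx hx, -Complex.ofReal_sin]
    · simp [tm, sepField, G.sin_ky hx, -Complex.ofReal_sin]
  · refine fun n _ => ⟨fun x hx => ?_, fun x hx => ?_⟩
    · simp [lo, sepField, G.sin_kx hx, -Complex.ofReal_sin]
    · simp [lo, sepField, G.sin_ky hx, -Complex.ofReal_sin]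

theorem frontier_Ω_subset {x : ℝ × ℝ} (hx : x ∈ frontier G.Ω) :
    (x.1 = 0 ∨ x.1 = G.L₁) ∨ (x.2 = 0 ∨ x.2 = G.L₂) := by
  rw [Ω, frontier_prod_eq, frontier_Ioo G.L₁_pos, frontier_Ioo G.L₂_pos] at hx
  rcases hx with h | h
  · right; simpa using h.2
  · left; simpa using h.1

/-! ### Orthogonality -/

theorem innerΩ_smul_left (c : ℂ) (u v : ℝ × ℝ → Fin 3 → ℂ) :
    G.innerΩ (c • u) v = star c * G.innerΩ u v := by
  simp only [innerΩ, Pi.smul_apply, star_smul, smul_dotProduct, smul_eq_mul]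
  exact integral_const_mul _ _

theorem innerΩ_smul_right (c : ℂ) (u v : ℝ × ℝ → Fin 3 → ℂ) :
    G.innerΩ u (c • v) = c * G.innerΩ u v := by
  simp only [innerΩ, Pi.smul_apply, dotProduct_smul, smul_eq_mul]
  exact integral_const_mul _ _

section Orthogonality

variable {n m : ℕ × ℕ}

theorem integral_cos_kx_of_ne (h : n.1 ≠ m.1) :
    ∫ x in Ioo 0 G.L₁, Real.cos (G.kx n * x) * Real.cos (G.kx m * x) = 0 :=
  integral_cos_mul_cos_of_ne G.L₁_pos h

theorem integral_cos_ky_of_ne (h : n.2 ≠ m.2) :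
    ∫ x in Ioo 0 G.L₂, Real.cos (G.ky n * x) * Real.cos (G.ky m * x) = 0 :=
  integral_cos_mul_cos_of_ne G.L₂_pos h

theorem integral_sin_kx_of_ne (h : n.1 ≠ m.1) :
    ∫ x in Ioo 0 G.L₁, Real.sin (G.kx n * x) * Real.sin (G.kx m * x) = 0 :=
  integral_sin_mul_sin_of_ne G.L₁_pos h

theorem integral_sin_ky_of_ne (h : n.2 ≠ m.2) :
    ∫ x in Ioo 0 G.L₂, Real.sin (G.ky n * x) * Real.sin (G.ky m * x) = 0 :=
  integral_sin_mul_sin_of_ne G.L₂_pos h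

end Orthogonality

/-- Fields with components `a cos sin`, `b sin cos`, `c sin sin`. -/
def trigField (p q a b c : ℝ) : ℝ × ℝ → Fin 3 → ℂ :=
  sepField ![fun y => a * Real.cos (p * y), fun y => b * Real.sin (p * y),
      fun y => c * Real.sin (p * y)]
    ![fun y => Real.sin (q * y), fun y => Real.cos (q * y), fun y => Real.sin (q * y)]

theorem te_eq_trigField (p q : ℝ) : te p q = trigField p q q (-p) 0 := by
  funext x i
  fin_cases i <;> simp [te, trigField, sepField]

theorem tm_eq_trigField (p q : ℝ) : tm p q = trigField p q p q 0 := by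
  funext x i
  fin_cases i <;> simp [tm, trigField, sepField]

theorem lo_eq_trigField (p q : ℝ) : lo p q = trigField p q 0 0 1 := by
  funext x i
  fin_cases i <;> simp [lo, trigField, sepField]

theorem innerΩ_trigField (p q a b c p' q' a' b' c' : ℝ) :
    G.innerΩ (trigField p q a b c) (trigField p' q' a' b' c') =
      ((a * a' * ((∫ x in Ioo 0 G.L₁, Real.cos (p * x) * Real.cos (p' * x)) *
          ∫ x in Ioo 0 G.L₂, Real.sin (q * x) * Real.sin (q' * x)) +
        b * b' * ((∫ x in Ioo 0 G.L₁, Real.sin (p * x) * Real.sin (p' * x)) *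
          ∫ x in Ioo 0 G.L₂, Real.cos (q * x) * Real.cos (q' * x)) +
        c * c' * ((∫ x in Ioo 0 G.L₁, Real.sin (p * x) * Real.sin (p' * x)) *
          ∫ x in Ioo 0 G.L₂, Real.sin (q * x) * Real.sin (q' * x)) : ℝ) : ℂ) := by
  rw [trigField, trigField, innerΩ_sepField]
  rotate_left
  iterate 4 intro i; fin_cases i <;> simp <;> fun_prop
  have h : ∀ (a a' : ℝ) (f g : ℝ → ℝ), ∫ x in Ioo 0 G.L₁, a * f x * (a' * g x) =
      a * a' * ∫ x in Ioo 0 G.L₁, f x * g x := fun a a' f g => by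
    rw [← integral_const_mul]; congr 1; funext x; ring
  simp only [Fin.sum_univ_three, Matrix.cons_val, h]
  congr 1
  ring

theorem exists_mode_eq_trigField (p : ModeIdx) :
    ∃ a b c : ℝ, G.Φ p.1.1 p.2 = trigField (G.kx p.1.1) (G.ky p.1.1) a b c := by
  refine G.mode_induction (P := fun u k => ∃ a b c : ℝ, u = trigField k.1 k.2 a b c) ?_ ?_ ?_ p
  · intro r n _
    refine ⟨r * G.ky n.1, r * -G.kx n.1, 0, ?_⟩
    funext x i
    fin_cases i <;> simp [te, trigField, sepField, mul_assoc]
  · exact fun n _ => ⟨_, _, _, tm_eq_trigField _ _⟩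
  · exact fun n _ => ⟨_, _, _, lo_eq_trigField _ _⟩

/-- Every mode is a `trigField`, and each component of the inner product is a product of two
one-dimensional integrals. If the index pairs differ in one entry, the factor in that variable is
zero, whether it is a sine or a cosine integral. -/
theorem innerΩ_mode_of_ne {p q : ModeIdx} (h : p.1 ≠ q.1) :
    G.innerΩ (G.Φ p.1.1 p.2) (G.Φ q.1.1 q.2) = 0 := by
  obtain ⟨a, b, c, h1⟩ := G.exists_mode_eq_trigField p
  obtain ⟨a', b', c', h2⟩ := G.exists_mode_eq_trigField q
  rw [h1, h2, innerΩ_trigField]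
  have h : p.1.1.1 ≠ q.1.1.1 ∨ p.1.1.2 ≠ q.1.1.2 := by
    by_contra! hh
    exact h (Subtype.ext (Prod.ext hh.1 hh.2))
  rcases h with h | h
  · simp [G.integral_cos_kx_of_ne h, G.integral_sin_kx_of_ne h]
  · simp [G.integral_cos_ky_of_ne h, G.integral_sin_ky_of_ne h]

/-! ### Inner products within one index pair and norms of the modes -/

section Norms

variable {n : ℕ × ℕ}

theorem integral_cos_kx (h : n.1 ≠ 0) :
    ∫ x in Ioo 0 G.L₁, Real.cos (G.kx n * x) * Real.cos (G.kx n * x) = G.L₁ / 2 :=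
  integral_cos_mul_self G.L₁_pos h

theorem integral_cos_ky (h : n.2 ≠ 0) :
    ∫ x in Ioo 0 G.L₂, Real.cos (G.ky n * x) * Real.cos (G.ky n * x) = G.L₂ / 2 :=
  integral_cos_mul_self G.L₂_pos h

theorem integral_sin_kx (h : n.1 ≠ 0) :
    ∫ x in Ioo 0 G.L₁, Real.sin (G.kx n * x) * Real.sin (G.kx n * x) = G.L₁ / 2 :=
  integral_sin_mul_self G.L₁_pos h

theorem integral_sin_ky (h : n.2 ≠ 0) :
    ∫ x in Ioo 0 G.L₂, Real.sin (G.ky n * x) * Real.sin (G.ky n * x) = G.L₂ / 2 :=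
  integral_sin_mul_self G.L₂_pos h

theorem ne_zero_of_mul_ne_zero (h : n.1 * n.2 ≠ 0) : n.1 ≠ 0 ∧ n.2 ≠ 0 := mul_ne_zero_iff.1 h

theorem innerΩ_te_tm (h : n.1 * n.2 ≠ 0) :
    G.innerΩ (te (G.kx n) (G.ky n)) (tm (G.kx n) (G.ky n)) = 0 := by
  obtain ⟨h1, h2⟩ := ne_zero_of_mul_ne_zero h
  rw [te_eq_trigField, tm_eq_trigField, innerΩ_trigField, G.integral_cos_kx h1,
    G.integral_cos_ky h2, G.integral_sin_kx h1, G.integral_sin_ky h2]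
  simp only [Complex.ofReal_eq_zero]
  ring

theorem innerΩ_te_lo (p q : ℝ) : G.innerΩ (te p q) (lo p q) = 0 := by
  rw [te_eq_trigField, lo_eq_trigField, innerΩ_trigField]; simp

theorem innerΩ_tm_lo (p q : ℝ) : G.innerΩ (tm p q) (lo p q) = 0 := by
  rw [tm_eq_trigField, lo_eq_trigField, innerΩ_trigField]; simp

theorem innerΩ_star (u v : ℝ × ℝ → Fin 3 → ℂ) : star (G.innerΩ u v) = G.innerΩ v u := by
  simp only [innerΩ, RCLike.star_def, ← integral_conj]
  congr 1
  funext x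
  simp [dotProduct, mul_comm]

theorem innerΩ_lo_self (h : n.1 * n.2 ≠ 0) :
    G.innerΩ (lo (G.kx n) (G.ky n)) (lo (G.kx n) (G.ky n)) = (G.L₁ * G.L₂ / 4 : ℝ) := by
  obtain ⟨h1, h2⟩ := ne_zero_of_mul_ne_zero h
  rw [lo_eq_trigField, innerΩ_trigField, G.integral_sin_kx h1, G.integral_sin_ky h2]
  congr 1
  ring

theorem innerΩ_tm_self (h : n.1 * n.2 ≠ 0) :
    G.innerΩ (tm (G.kx n) (G.ky n)) (tm (G.kx n) (G.ky n)) =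
      (G.eig n * (G.L₁ * G.L₂ / 4) : ℝ) := by
  obtain ⟨h1, h2⟩ := ne_zero_of_mul_ne_zero h
  rw [tm_eq_trigField, innerΩ_trigField, G.integral_sin_kx h1, G.integral_sin_ky h2,
    G.integral_cos_kx h1, G.integral_cos_ky h2, eig_eq]
  congr 1
  ring

/-- The constant is L₁L₂/4 for two nonzero indices, and L₁L₂/2 if one is zero, because then the
cosine is constant and its square integrates to the full length. Only the common lower bound is
needed later. -/
theorem innerΩ_te_self (n : Idx) :
    ∃ c : ℝ, G.L₁ * G.L₂ / 4 ≤ c ∧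
      G.innerΩ (te (G.kx n.1) (G.ky n.1)) (te (G.kx n.1) (G.ky n.1)) = (G.eig n.1 * c : ℝ) := by
  obtain ⟨⟨a, b⟩, hn⟩ := n
  have hL : 0 < G.L₁ * G.L₂ := mul_pos G.L₁_pos G.L₂_pos
  by_cases ha : a = 0
  · subst ha
    have hb : b ≠ 0 := fun hb => hn (by simp [hb])
    refine ⟨G.L₁ * G.L₂ / 2, by linarith, ?_⟩
    rw [te_eq_trigField, innerΩ_trigField, G.integral_sin_ky (n := (0, b)) hb, eig_eq]
    have h0 : G.kx (0, b) = 0 := by simp [kx]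
    have := G.L₁_pos.le
    congr 1
    simp [h0, this]
    ring
  · by_cases hb : b = 0
    · subst hb
      refine ⟨G.L₁ * G.L₂ / 2, by linarith, ?_⟩
      rw [te_eq_trigField, innerΩ_trigField, G.integral_sin_kx (n := (a, 0)) ha, eig_eq]
      have h0 : G.ky (a, 0) = 0 := by simp [ky]
      have := G.L₂_pos.le
      congr 1
      simp [h0, this]
      ring
    · refine ⟨_, le_rfl, ?_⟩
      rw [te_eq_trigField, innerΩ_trigField, G.integral_sin_kx (n := (a, b)) ha,
        G.integral_sin_ky (n := (a, b)) hb,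
        G.integral_cos_kx (n := (a, b)) ha, G.integral_cos_ky (n := (a, b)) hb, eig_eq]
      congr 1
      ring

end Norms

theorem innerΩ_mode_eq_zero {p q : ModeIdx} (h : p ≠ q) :
    G.innerΩ (G.Φ p.1.1 p.2) (G.Φ q.1.1 q.2) = 0 := by
  by_cases hpq : p.1 = q.1
  · obtain ⟨n, s⟩ := p
    obtain ⟨m, t⟩ := q
    obtain rfl : n = m := hpq
    have hst : (s : ℕ) ≠ t := fun hst => h (by rw [Fin.ext hst])
    -- Hermitian symmetry leaves three genuine cases out of the six pairs s ≠ t.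
    have hswap : ∀ u v, G.innerΩ u v = 0 → G.innerΩ v u = 0 := fun u v huv => by
      rw [← innerΩ_star, huv, star_zero]
    obtain ⟨r, -, hr⟩ := G.exists_Φ_eq_smul_te n
    rcases modeIdx_cases ⟨n, s⟩ with hs | ⟨hn, hs | hs⟩ <;>
    rcases modeIdx_cases ⟨n, t⟩ with ht | ⟨hn', ht | ht⟩ <;>
    dsimp only at hs ht ⊢ <;>
    first
    | exact absurd (hs.trans ht.symm) hst
    | (rw [hs, ht]
       simp only [G.Φ_one ‹_›, G.Φ_two ‹_›, hr, innerΩ_smul_left, innerΩ_smul_right])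
    · simp [G.innerΩ_te_tm hn']
    · simp [G.innerΩ_te_lo]
    · simp [hswap _ _ (G.innerΩ_te_tm hn)]
    · simp [G.innerΩ_tm_lo]
    · simp [hswap _ _ (G.innerΩ_te_lo _ _)]
    · simp [hswap _ _ (G.innerΩ_tm_lo _ _)]
  · exact G.innerΩ_mode_of_ne hpq

theorem exists_innerΩ_mode_self (p : ModeIdx) :
    ∃ c : ℝ, 0 < c ∧ G.innerΩ (G.Φ p.1.1 p.2) (G.Φ p.1.1 p.2) = c := by
  have hL : 0 < G.L₁ * G.L₂ := mul_pos G.L₁_pos G.L₂_pos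
  rcases modeIdx_cases p with hs | ⟨hn, hs | hs⟩
  · obtain ⟨r, hr0, hr⟩ := G.exists_Φ_eq_smul_te p.1
    obtain ⟨c, hc, h⟩ := G.innerΩ_te_self p.1
    have := G.eig_pos p.1
    have hc' : 0 < c := lt_of_lt_of_le (by positivity) hc
    refine ⟨r * (r * (G.eig p.1.1 * c)), ?_, ?_⟩
    · rw [← mul_assoc]
      exact mul_pos (mul_self_pos.2 hr0) (by positivity)
    · rw [hs, hr, innerΩ_smul_left, innerΩ_smul_right, h]
      simp
  · rw [hs, G.Φ_one hn]
    exact ⟨_, mul_pos (G.eig_pos p.1) (by positivity), G.innerΩ_tm_self hn⟩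
  · rw [hs, G.Φ_two hn]
    exact ⟨_, by positivity, G.innerΩ_lo_self hn⟩

/-! ### The vectorial eigenvalue problem -/

theorem isVectorEigenfunction_mode (p : ModeIdx) :
    G.IsVectorEigenfunction (G.eig p.1.1) (G.Φ p.1.1 p.2) where
  smooth := G.contDiff_mode p
  nonzero := by
    -- A mode vanishing on Ω would have norm zero.
    by_contra! h
    obtain ⟨c, hc, hpc⟩ := G.exists_innerΩ_mode_self p
    have : G.innerΩ (G.Φ p.1.1 p.2) (G.Φ p.1.1 p.2) = 0 := by
      rw [innerΩ]
      exact setIntegral_eq_zero_of_forall_eq_zero fun x hx => by simp [h x hx]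
    rw [this] at hpc
    exact hc.ne (by exact_mod_cast hpc)
  eqn := by
    intro x _
    rw [eig_eq]
    push_cast
    refine G.mode_induction (P := fun u k => -(pd2 (1, 0) (pd2 (1, 0) u) x +
      pd2 (0, 1) (pd2 (0, 1) u) x) = ((k.1 : ℂ) ^ 2 + (k.2 : ℂ) ^ 2) • u x) ?_ ?_ ?_ p
    · intro r n _
      simp only [pd2_const_smul, Pi.smul_apply]
      rw [← smul_add, ← smul_neg, neg_laplacian_te, smul_comm]
    · exact fun n _ => neg_laplacian_tm _ _ x
    · exact fun n _ => neg_laplacian_lo _ _ x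
  tangential₁ := fun x _ h => ((G.wallZero_mode p).fst x h).1
  tangential₂ := fun x _ h => ((G.wallZero_mode p).snd x h).1
  longitudinal := fun x hx => (G.frontier_Ω_subset hx).elim
    (fun h => ((G.wallZero_mode p).fst x h).2) (fun h => ((G.wallZero_mode p).snd x h).2)
  divergence := by
    intro x hx
    refine G.mode_induction (P := fun u _ => pd2 (1, 0) u x 0 + pd2 (0, 1) u x 1 = 0) ?_ ?_ ?_ p
    · intro r n _
      simp only [pd2_const_smul, Pi.smul_apply, pd2_fst_te, pd2_snd_te]
      simp [sepField]
      ring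
    -- The divergence of tm is -(p² + q²) sin(p x₁) sin(q x₂), which is zero only on the walls; for
    -- te and lo it is zero everywhere.
    · intro n _
      rw [pd2_fst_tm, pd2_snd_tm]
      rcases G.frontier_Ω_subset hx with h | h
      · simp [sepField, G.sin_kx h, -Complex.ofReal_sin]
      · simp [sepField, G.sin_ky h, -Complex.ofReal_sin]
    · intro n _
      rw [pd2_fst_lo, pd2_snd_lo]
      simp [sepField]

/-! ### Completeness of the trigonometric products -/

theorem exists_bound_on_Ω {E : Type*} [NormedAddCommGroup E] {f : ℝ × ℝ → E} (hf : Continuous f) :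
    ∃ C : ℝ, 0 ≤ C ∧ ∀ x ∈ G.Ω, ‖f x‖ ≤ C := by
  obtain ⟨C, hC⟩ := (isCompact_Icc.prod isCompact_Icc :
    IsCompact (Icc 0 G.L₁ ×ˢ Icc 0 G.L₂)).exists_bound_of_continuousOn hf.continuousOn
  exact ⟨|C|, abs_nonneg _, fun x hx => (hC x
    (prod_mono Ioo_subset_Icc_self Ioo_subset_Icc_self hx)).trans (le_abs_self C)⟩

theorem integrableOn_smul {f : ℝ × ℝ → ℝ} (hf : Continuous f) {u : ℝ × ℝ → ℂ}
    (hu : IntegrableOn u G.Ω) : IntegrableOn (fun x => f x • u x) G.Ω := by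
  obtain ⟨C, -, hC⟩ := G.exists_bound_on_Ω hf
  exact hu.bdd_smul C hf.aestronglyMeasurable ((ae_restrict_iff' G.measurableSet_Ω).2 (ae_of_all _ hC))

/-- The product of cosines with index pair `(n, m)`. -/
def cosCos (n m : ℕ) (x : ℝ × ℝ) : ℝ :=
  Real.cos (Real.pi * n / G.L₁ * x.1) * Real.cos (Real.pi * m / G.L₂ * x.2)

theorem continuous_cosCos (n m : ℕ) : Continuous (G.cosCos n m) := by
  unfold cosCos; fun_prop

/-- For n = 0 the lower index n - 1 is negative; since cosine is even, its absolute value may be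
used, which keeps all frequencies in ℕ. -/
theorem cos_mul_cos_nat (θ : ℝ) (n : ℕ) :
    Real.cos θ * Real.cos (n * θ) =
      (1 / 2) * Real.cos ((n + 1 : ℕ) * θ) + (1 / 2) * Real.cos (((n : ℤ) - 1).natAbs * θ) := by
  have h : Real.cos (((n : ℤ) - 1).natAbs * θ) = Real.cos ((n - 1) * θ) := by
    rcases n with _ | n
    · simp
    · simp
  rw [h]
  push_cast
  rw [add_mul, sub_mul, one_mul, Real.cos_add, Real.cos_sub]
  ring

theorem cos_mul_cosCos_fst (n m : ℕ) (x : ℝ × ℝ) :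
    Real.cos (Real.pi / G.L₁ * x.1) * G.cosCos n m x =
      (1 / 2) * G.cosCos (n + 1) m x + (1 / 2) * G.cosCos ((n : ℤ) - 1).natAbs m x := by
  have h := cos_mul_cos_nat (Real.pi / G.L₁ * x.1) n
  have e : ∀ k : ℕ, (k : ℝ) * (Real.pi / G.L₁ * x.1) = Real.pi * k / G.L₁ * x.1 :=
    fun k => by ring
  simp only [e] at h
  simp only [cosCos]
  rw [← mul_assoc, h]
  ring

theorem cos_mul_cosCos_snd (n m : ℕ) (x : ℝ × ℝ) :
    Real.cos (Real.pi / G.L₂ * x.2) * G.cosCos n m x =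
      (1 / 2) * G.cosCos n (m + 1) x + (1 / 2) * G.cosCos n ((m : ℤ) - 1).natAbs x := by
  have h := cos_mul_cos_nat (Real.pi / G.L₂ * x.2) m
  have e : ∀ k : ℕ, (k : ℝ) * (Real.pi / G.L₂ * x.2) = Real.pi * k / G.L₂ * x.2 :=
    fun k => by ring
  simp only [e] at h
  simp only [cosCos]
  rw [mul_left_comm, h]
  ring

/-- The continuous functions that, as multipliers, preserve the orthogonality of `· u` to all
products of cosines. -/
def cosStabilizer {u : ℝ × ℝ → ℂ} (hu : IntegrableOn u G.Ω) : Subalgebra ℝ C(ℝ × ℝ, ℝ) where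
  -- Quantifying over all g, and not only g = 1, makes the set closed under products without any
  -- description of trigonometric polynomials.
  carrier := {f | ∀ g : C(ℝ × ℝ, ℝ), (∀ n m, ∫ x in G.Ω, (G.cosCos n m x * g x) • u x = 0) →
    ∀ n m, ∫ x in G.Ω, (G.cosCos n m x * (f x * g x)) • u x = 0}
  mul_mem' := fun {a b} ha hb g hg n m => by
    simpa [mul_assoc] using ha (b * g) (fun n m => by simpa using hb g hg n m) n m
  add_mem' := fun {a b} ha hb g hg n m => by
    have hc := G.continuous_cosCos n m
    have := ha g hg n m
    rw [← zero_add (0 : ℂ)]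
    nth_rewrite 1 [← ha g hg n m]
    rw [← hb g hg n m, ← integral_add]
    · congr 1; funext x
      simp only [ContinuousMap.add_apply, ← add_smul]
      congr 1; ring
    · exact G.integrableOn_smul (by fun_prop) hu
    · exact G.integrableOn_smul (by fun_prop) hu
  algebraMap_mem' := fun r g hg n m => by
    rw [← smul_zero r, ← hg n m, ← integral_smul]
    congr 1; funext x
    simp only [algebraMap_apply, smul_smul]
    congr 1
    simp
    ring

theorem cos_fst_mem_cosStabilizer {u : ℝ × ℝ → ℂ} (hu : IntegrableOn u G.Ω) :
    (⟨fun x => Real.cos (Real.pi / G.L₁ * x.1), by fun_prop⟩ : C(ℝ × ℝ, ℝ)) ∈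
      G.cosStabilizer hu := by
  intro g hg n m
  have h1 := G.continuous_cosCos (n + 1) m
  have h2 := G.continuous_cosCos ((n : ℤ) - 1).natAbs m
  have e : ∀ x, (G.cosCos n m x * (Real.cos (Real.pi / G.L₁ * x.1) * g x)) • u x =
      (1 / 2 : ℝ) • ((G.cosCos (n + 1) m x * g x) • u x) +
        (1 / 2 : ℝ) • ((G.cosCos ((n : ℤ) - 1).natAbs m x * g x) • u x) := fun x => by
    rw [smul_smul, smul_smul, ← add_smul, ← mul_assoc, mul_comm (G.cosCos n m x),
      cos_mul_cosCos_fst]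
    congr 1; ring
  simp only [ContinuousMap.coe_mk, e]
  rw [integral_add, integral_smul, integral_smul, hg, hg]
  · simp
  · exact (G.integrableOn_smul (by fun_prop) hu).smul (1 / 2 : ℝ)
  · exact (G.integrableOn_smul (by fun_prop) hu).smul (1 / 2 : ℝ)

theorem cos_snd_mem_cosStabilizer {u : ℝ × ℝ → ℂ} (hu : IntegrableOn u G.Ω) :
    (⟨fun x => Real.cos (Real.pi / G.L₂ * x.2), by fun_prop⟩ : C(ℝ × ℝ, ℝ)) ∈
      G.cosStabilizer hu := by
  intro g hg n m
  have h1 := G.continuous_cosCos n (m + 1)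
  have h2 := G.continuous_cosCos n ((m : ℤ) - 1).natAbs
  have e : ∀ x, (G.cosCos n m x * (Real.cos (Real.pi / G.L₂ * x.2) * g x)) • u x =
      (1 / 2 : ℝ) • ((G.cosCos n (m + 1) x * g x) • u x) +
        (1 / 2 : ℝ) • ((G.cosCos n ((m : ℤ) - 1).natAbs x * g x) • u x) := fun x => by
    rw [smul_smul, smul_smul, ← add_smul, ← mul_assoc, mul_comm (G.cosCos n m x),
      cos_mul_cosCos_snd]
    congr 1; ring
  simp only [ContinuousMap.coe_mk, e]
  rw [integral_add, integral_smul, integral_smul, hg, hg]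
  · simp
  · exact (G.integrableOn_smul (by fun_prop) hu).smul (1 / 2 : ℝ)
  · exact (G.integrableOn_smul (by fun_prop) hu).smul (1 / 2 : ℝ)

theorem cos_pi_div_injOn {l : ℝ} (hl : 0 < l) :
    InjOn (fun y => Real.cos (Real.pi / l * y)) (Icc 0 l) := by
  have hpi := Real.pi_pos
  intro x hx y hy h
  have hm : ∀ z ∈ Icc 0 l, Real.pi / l * z ∈ Icc 0 Real.pi := fun z hz => by
    refine ⟨mul_nonneg (by positivity) hz.1, ?_⟩
    rw [div_mul_eq_mul_div, div_le_iff₀ hl]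
    exact mul_le_mul_of_nonneg_left hz.2 hpi.le
  exact mul_left_cancel₀ (by positivity) (Real.injOn_cos (hm x hx) (hm y hy) h)

theorem exists_mem_cosStabilizer_near {u : ℝ × ℝ → ℂ} (hu : IntegrableOn u G.Ω) {g : ℝ × ℝ → ℝ}
    (hg : Continuous g) {ε : ℝ} (hε : 0 < ε) :
    ∃ f ∈ G.cosStabilizer hu, ∀ x ∈ G.Ω, ‖g x - f x‖ ≤ ε := by
  let K : Set (ℝ × ℝ) := Icc 0 G.L₁ ×ˢ Icc 0 G.L₂
  have hK : IsCompact K := isCompact_Icc.prod isCompact_Icc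
  have : CompactSpace K := isCompact_iff_compactSpace.1 hK
  -- Stone–Weierstrass needs a compact space: the closed rectangle. Points are separated by the two
  -- functions cos(πx₁/L₁) and cos(πx₂/L₂), which are injective on the sides.
  let res : C(ℝ × ℝ, ℝ) →ₐ[ℝ] C(K, ℝ) :=
    ContinuousMap.compRightAlgHom ℝ ℝ ⟨Subtype.val, continuous_subtype_val⟩
  have hsep : ((G.cosStabilizer hu).map res).SeparatesPoints := by
    intro x y hxy
    have hxy' : x.1.1 ≠ y.1.1 ∨ x.1.2 ≠ y.1.2 := by
      by_contra! h
      exact hxy (Subtype.ext (Prod.ext h.1 h.2))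
    rcases hxy' with h | h
    · refine ⟨_, ⟨_, ⟨_, G.cos_fst_mem_cosStabilizer hu, rfl⟩, rfl⟩, fun he => h ?_⟩
      exact cos_pi_div_injOn G.L₁_pos x.2.1 y.2.1 he
    · refine ⟨_, ⟨_, ⟨_, G.cos_snd_mem_cosStabilizer hu, rfl⟩, rfl⟩, fun he => h ?_⟩
      exact cos_pi_div_injOn G.L₂_pos x.2.2 y.2.2 he
  obtain ⟨⟨_, f, hf, rfl⟩, h⟩ :=
    ContinuousMap.exists_mem_subalgebra_near_continuous_of_separatesPoints _ hsep
      (fun x : K => g x) (hg.comp continuous_subtype_val) ε hε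
  refine ⟨f, hf, fun x hx => ?_⟩
  have := h ⟨x, prod_mono Ioo_subset_Icc_self Ioo_subset_Icc_self hx⟩
  rw [norm_sub_rev]
  exact this.le

/-- The hypothesis makes u orthogonal to the whole stabilizer, hence by uniform approximation to
every continuous function, in particular to every smooth function supported in Ω. -/
theorem ae_eq_zero_of_cosCos {u : ℝ × ℝ → ℂ} (hu : IntegrableOn u G.Ω)
    (h : ∀ n m, ∫ x in G.Ω, G.cosCos n m x • u x = 0) : ∀ᵐ x, x ∈ G.Ω → u x = 0 := by
  refine G.isOpen_Ω.ae_eq_zero_of_integral_contDiff_smul_eq_zero hu.locallyIntegrableOn ?_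
  intro g hg _ hsupp
  have h0 : ∀ f ∈ G.cosStabilizer hu, ∫ x in G.Ω, f x • u x = 0 := fun f hf => by
    -- Orthogonality to f itself is the case g = 1, n = m = 0.
    simpa [cosCos] using hf 1 (fun n m => by simpa using h n m) 0 0
  rw [← setIntegral_eq_integral_of_forall_compl_eq_zero (s := G.Ω) fun x hx => by
    rw [image_eq_zero_of_notMem_tsupport fun hx' => hx (hsupp hx'), zero_smul]]
  have hle : ∀ ε > 0, ‖∫ x in G.Ω, g x • u x‖ ≤ ε * ∫ x in G.Ω, ‖u x‖ := by
    intro ε hε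
    obtain ⟨f, hf, hfg⟩ := G.exists_mem_cosStabilizer_near hu hg.continuous hε
    rw [← sub_zero (∫ x in G.Ω, g x • u x), ← h0 f hf, ← integral_sub
      (G.integrableOn_smul hg.continuous hu) (G.integrableOn_smul f.continuous hu),
      ← integral_const_mul]
    refine norm_integral_le_of_norm_le (hu.norm.const_mul ε) ?_
    filter_upwards [ae_restrict_mem G.measurableSet_Ω] with x hx
    rw [← sub_smul, norm_smul]
    exact mul_le_mul_of_nonneg_right (hfg x hx) (norm_nonneg _)
  have hlim : Tendsto (fun ε : ℝ => ε * ∫ x in G.Ω, ‖u x‖) (𝓝[>] 0) (𝓝 0) := by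
    have : Tendsto (fun ε : ℝ => ε * ∫ x in G.Ω, ‖u x‖) (𝓝 0) (𝓝 (0 * ∫ x in G.Ω, ‖u x‖)) :=
      tendsto_id.mul_const _
    rw [zero_mul] at this
    exact this.mono_left nhdsWithin_le_nhds
  have := ge_of_tendsto hlim (eventually_nhdsWithin_of_forall fun ε hε => hle ε hε)
  simpa using this

/-- For n = 0 both terms on the right are (1/2) sin θ, which explains the exceptional sign of the
second coefficient. -/
theorem sin_mul_cos_nat (θ : ℝ) (n : ℕ) :
    Real.sin θ * Real.cos (n * θ) = (1 / 2) * Real.sin ((n + 1 : ℕ) * θ) +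
      (if n = 0 then 1 / 2 else -1 / 2) * Real.sin (((n : ℤ) - 1).natAbs * θ) := by
  rcases n with _ | n
  · simp; ring
  · have h : (((n + 1 : ℕ) : ℤ) - 1).natAbs = n := by simp
    rw [h, if_neg (by omega)]
    have e1 : ((n + 1 + 1 : ℕ) : ℝ) * θ = (n + 1 : ℕ) * θ + θ := by push_cast; ring
    have e2 : (n : ℝ) * θ = (n + 1 : ℕ) * θ - θ := by push_cast; ring
    rw [e1, e2, Real.sin_add, Real.sin_sub]
    ring

/-- Here `π` is a coordinate function, not the number. Orthogonality of w to all sines gives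
orthogonality of sin(πy/l) w to all cosines; as that sine has no zero inside the interval, the
cosine result applies and the factor can be cancelled. -/
theorem integral_sin_mul_cos {l : ℝ} {w : ℝ × ℝ → ℂ} (hw : IntegrableOn w G.Ω) {π : ℝ × ℝ → ℝ}
    (hπ : Continuous π) (h : ∀ n : ℕ, ∫ x in G.Ω, Real.sin (Real.pi * n / l * π x) • w x = 0)
    (n : ℕ) : ∫ x in G.Ω, (Real.sin (Real.pi / l * π x) *
      Real.cos (Real.pi * n / l * π x)) • w x = 0 := by
  have e : ∀ (k : ℕ) x, (k : ℝ) * (Real.pi / l * π x) = Real.pi * k / l * π x := fun k x => by ring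
  simp only [← e, sin_mul_cos_nat, add_smul, mul_smul]
  simp only [e]
  rw [integral_add, integral_smul, integral_smul, h, h]
  · simp
  · exact (G.integrableOn_smul (by fun_prop) hw).smul _
  · exact (G.integrableOn_smul (by fun_prop) hw).smul _

theorem sin_pi_div_pos {l y : ℝ} (hy : y ∈ Ioo 0 l) : 0 < Real.sin (Real.pi / l * y) := by
  have hl : 0 < l := hy.1.trans hy.2
  have hpi := Real.pi_pos
  refine Real.sin_pos_of_pos_of_lt_pi (mul_pos (by positivity) hy.1) ?_
  rw [div_mul_eq_mul_div, div_lt_iff₀ hl]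
  exact mul_lt_mul_of_pos_left hy.2 hpi

theorem ae_eq_zero_of_sinCos {u : ℝ × ℝ → ℂ} (hu : IntegrableOn u G.Ω)
    (h : ∀ n m : ℕ, ∫ x in G.Ω, (Real.sin (Real.pi * n / G.L₁ * x.1) *
      Real.cos (Real.pi * m / G.L₂ * x.2)) • u x = 0) : ∀ᵐ x, x ∈ G.Ω → u x = 0 := by
  have := G.ae_eq_zero_of_cosCos (u := fun x => Real.sin (Real.pi / G.L₁ * x.1) • u x)
    (G.integrableOn_smul (by fun_prop) hu) fun n m => by
      rw [← G.integral_sin_mul_cos (l := G.L₁) (π := Prod.fst)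
        (w := fun x => Real.cos (Real.pi * m / G.L₂ * x.2) • u x)
        (G.integrableOn_smul (by fun_prop) hu) continuous_fst
        (fun n => by simpa only [smul_smul] using h n m) n]
      congr 1; funext x
      simp only [cosCos, smul_smul]
      congr 1; ring
  filter_upwards [this] with x hx hxΩ
  exact (smul_eq_zero.1 (hx hxΩ)).resolve_left (sin_pi_div_pos hxΩ.1).ne'

theorem ae_eq_zero_of_cosSin {u : ℝ × ℝ → ℂ} (hu : IntegrableOn u G.Ω)
    (h : ∀ n m : ℕ, ∫ x in G.Ω, (Real.cos (Real.pi * n / G.L₁ * x.1) *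
      Real.sin (Real.pi * m / G.L₂ * x.2)) • u x = 0) : ∀ᵐ x, x ∈ G.Ω → u x = 0 := by
  have := G.ae_eq_zero_of_cosCos (u := fun x => Real.sin (Real.pi / G.L₂ * x.2) • u x)
    (G.integrableOn_smul (by fun_prop) hu) fun n m => by
      rw [← G.integral_sin_mul_cos (l := G.L₂) (π := Prod.snd)
        (w := fun x => Real.cos (Real.pi * n / G.L₁ * x.1) • u x)
        (G.integrableOn_smul (by fun_prop) hu) continuous_snd
        (fun m => by
          rw [← h n m]
          congr 1; funext x
          rw [smul_smul, mul_comm]) m]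
      congr 1; funext x
      simp only [cosCos, smul_smul]
      congr 1; ring
  filter_upwards [this] with x hx hxΩ
  exact (smul_eq_zero.1 (hx hxΩ)).resolve_left (sin_pi_div_pos hxΩ.2).ne'

theorem ae_eq_zero_of_sinSin {u : ℝ × ℝ → ℂ} (hu : IntegrableOn u G.Ω)
    (h : ∀ n m : ℕ, ∫ x in G.Ω, (Real.sin (Real.pi * n / G.L₁ * x.1) *
      Real.sin (Real.pi * m / G.L₂ * x.2)) • u x = 0) : ∀ᵐ x, x ∈ G.Ω → u x = 0 := by
  have := G.ae_eq_zero_of_sinCos (u := fun x => Real.sin (Real.pi / G.L₂ * x.2) • u x)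
    (G.integrableOn_smul (by fun_prop) hu) fun n m => by
      rw [← G.integral_sin_mul_cos (l := G.L₂) (π := Prod.snd)
        (w := fun x => Real.sin (Real.pi * n / G.L₁ * x.1) • u x)
        (G.integrableOn_smul (by fun_prop) hu) continuous_snd
        (fun m => by
          rw [← h n m]
          congr 1; funext x
          rw [smul_smul, mul_comm]) m]
      congr 1; funext x
      simp only [smul_smul]
      congr 1; ring
  filter_upwards [this] with x hx hxΩ
  exact (smul_eq_zero.1 (hx hxΩ)).resolve_left (sin_pi_div_pos hxΩ.2).ne'

/-! ### The modes form an orthogonal basis -/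

theorem isBounded_Ω : Bornology.IsBounded G.Ω :=
  (Metric.isBounded_Ioo _ _).prod (Metric.isBounded_Ioo _ _)

instance isFiniteMeasure_Ω : IsFiniteMeasure (volume.restrict G.Ω) :=
  ⟨by rw [Measure.restrict_apply_univ]; exact G.isBounded_Ω.measure_lt_top⟩

theorem memLp_of_continuous {u : ℝ × ℝ → Fin 3 → ℂ} (hu : Continuous u) :
    MemLp u 2 (volume.restrict G.Ω) := by
  obtain ⟨C, -, hC⟩ := G.exists_bound_on_Ω hu
  exact MemLp.of_bound hu.aestronglyMeasurable C
    ((ae_restrict_iff' G.measurableSet_Ω).2 (ae_of_all _ hC))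

theorem integrableOn_apply {u : ℝ × ℝ → Fin 3 → ℂ} (hu : MemLp u 2 (volume.restrict G.Ω))
    (i : Fin 3) : IntegrableOn (fun x => u x i) G.Ω :=
  (hu.eval i).integrable (by norm_num)

theorem innerΩ_trigField_left (p q a b c : ℝ) {u : ℝ × ℝ → Fin 3 → ℂ}
    (hu : MemLp u 2 (volume.restrict G.Ω)) : G.innerΩ (trigField p q a b c) u =
      a * (∫ x in G.Ω, (Real.cos (p * x.1) * Real.sin (q * x.2)) • u x 0) +
      b * (∫ x in G.Ω, (Real.sin (p * x.1) * Real.cos (q * x.2)) • u x 1) +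
      c * ∫ x in G.Ω, (Real.sin (p * x.1) * Real.sin (q * x.2)) • u x 2 := by
  rw [← integral_const_mul, ← integral_const_mul, ← integral_const_mul, ← integral_add,
    ← integral_add]
  · rw [innerΩ]
    congr 1; funext x
    simp only [dotProduct, Fin.sum_univ_three, trigField, sepField, Pi.star_apply, RCLike.star_def,
      Complex.conj_ofReal, Matrix.cons_val, Complex.real_smul]
    push_cast
    ring
  · exact ((G.integrableOn_smul (by fun_prop) (G.integrableOn_apply hu 0)).const_mul _).add
      ((G.integrableOn_smul (by fun_prop) (G.integrableOn_apply hu 1)).const_mul _)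
  · exact (G.integrableOn_smul (by fun_prop) (G.integrableOn_apply hu 2)).const_mul _
  · exact (G.integrableOn_smul (by fun_prop) (G.integrableOn_apply hu 0)).const_mul _
  · exact (G.integrableOn_smul (by fun_prop) (G.integrableOn_apply hu 1)).const_mul _

theorem ae_eq_zero_of_innerΩ_mode {u : ℝ × ℝ → Fin 3 → ℂ} (hu : MemLp u 2 (volume.restrict G.Ω))
    (h : ∀ p : ModeIdx, G.innerΩ (G.Φ p.1.1 p.2) u = 0) : u =ᵐ[volume.restrict G.Ω] 0 := by
  have hte : ∀ n : Idx, G.innerΩ (te (G.kx n.1) (G.ky n.1)) u = 0 := fun n => by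
    obtain ⟨r, hr, h'⟩ := G.exists_Φ_eq_smul_te n
    have h0 := h ⟨n, ⟨0, by unfold mult; split_ifs <;> norm_num⟩⟩
    simp only [h', innerΩ_smul_left] at h0
    refine (mul_eq_zero.1 h0).resolve_left ?_
    simpa using hr
  have htm : ∀ n : ℕ × ℕ, n.1 * n.2 ≠ 0 → G.innerΩ (tm (G.kx n) (G.ky n)) u = 0 := fun n hn => by
    have h0 := h ⟨⟨n, fun h => hn (by simp [h])⟩, ⟨1, by simp [mult, hn]⟩⟩
    rwa [← G.Φ_one hn]
  have hlo : ∀ n : ℕ × ℕ, n.1 * n.2 ≠ 0 → G.innerΩ (lo (G.kx n) (G.ky n)) u = 0 := fun n hn => by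
    have h0 := h ⟨⟨n, fun h => hn (by simp [h])⟩, ⟨2, by simp [mult, hn]⟩⟩
    rwa [← G.Φ_two hn]
  have h1 : ∀ n : ℕ × ℕ,
      (∫ x in G.Ω, (Real.cos (G.kx n * x.1) * Real.sin (G.ky n * x.2)) • u x 0) = 0 ∧
      (∫ x in G.Ω, (Real.sin (G.kx n * x.1) * Real.cos (G.ky n * x.2)) • u x 1) = 0 := by
    rintro ⟨a, b⟩
    by_cases ha : a = 0
    · have hp : G.kx (a, b) = 0 := by simp [kx, ha]
      by_cases hb : b = 0
      · have hq : G.ky (a, b) = 0 := by simp [ky, hb]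
        -- Both integrands contain the sine of zero, which is why the pair (0, 0) carries no mode.
        simp [hp, hq]
      · have hq := G.ky_ne_zero (n := (a, b)) hb
        have h2 := hte ⟨(a, b), by simp [hb]⟩
        rw [te_eq_trigField, G.innerΩ_trigField_left _ _ _ _ _ hu] at h2
        simp only [hp] at h2 ⊢
        simpa [hq, -Complex.ofReal_sin] using h2
    · have hp := G.kx_ne_zero (n := (a, b)) ha
      have h2 := hte ⟨(a, b), by simp [ha]⟩
      rw [te_eq_trigField, G.innerΩ_trigField_left _ _ _ _ _ hu] at h2
      by_cases hb : b = 0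
      · have hq : G.ky (a, b) = 0 := by simp [ky, hb]
        simp only [hq] at h2 ⊢
        simpa [hp, -Complex.ofReal_sin] using h2
      · have hq := G.ky_ne_zero (n := (a, b)) hb
        have h3 := htm (a, b) (mul_ne_zero ha hb)
        rw [tm_eq_trigField, G.innerΩ_trigField_left _ _ _ _ _ hu] at h3
        set A := ∫ x in G.Ω, (Real.cos (G.kx (a, b) * x.1) * Real.sin (G.ky (a, b) * x.2)) • u x 0
        set B := ∫ x in G.Ω, (Real.sin (G.kx (a, b) * x.1) * Real.cos (G.ky (a, b) * x.2)) • u x 1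
        simp only [Complex.ofReal_zero, zero_mul, add_zero, Complex.ofReal_neg] at h2 h3
        -- The te and tm relations read q A - p B = 0 and p A + q B = 0, a system with determinant
        -- p² + q².
        have hpq : (G.kx (a, b) ^ 2 + G.ky (a, b) ^ 2 : ℂ) ≠ 0 := by
          have : G.kx (a, b) ^ 2 + G.ky (a, b) ^ 2 ≠ 0 := by positivity
          exact_mod_cast this
        constructor
        · refine (mul_eq_zero.1 ?_).resolve_left hpq
          linear_combination (G.ky (a, b) : ℂ) * h2 + (G.kx (a, b) : ℂ) * h3
        · refine (mul_eq_zero.1 ?_).resolve_left hpq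
          linear_combination (-G.kx (a, b) : ℂ) * h2 + (G.ky (a, b) : ℂ) * h3
  have h2 : ∀ n : ℕ × ℕ,
      ∫ x in G.Ω, (Real.sin (G.kx n * x.1) * Real.sin (G.ky n * x.2)) • u x 2 = 0 := by
    rintro ⟨a, b⟩
    by_cases hab : a * b = 0
    · rcases mul_eq_zero.1 hab with rfl | rfl <;> simp [kx, ky]
    · have h3 := hlo (a, b) hab
      rw [lo_eq_trigField, G.innerΩ_trigField_left _ _ _ _ _ hu] at h3
      simpa using h3
  have c0 := G.ae_eq_zero_of_cosSin (G.integrableOn_apply hu 0) fun n m => (h1 (n, m)).1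
  have c1 := G.ae_eq_zero_of_sinCos (G.integrableOn_apply hu 1) fun n m => (h1 (n, m)).2
  have c2 := G.ae_eq_zero_of_sinSin (G.integrableOn_apply hu 2) fun n m => h2 (n, m)
  rw [EventuallyEq, ae_restrict_iff' G.measurableSet_Ω]
  filter_upwards [c0, c1, c2] with x h0 h1 h2 hx
  funext i
  fin_cases i
  · exact h0 hx
  · exact h1 hx
  · exact h2 hx

/-- The Hilbert space `(L²(Ω))³`. -/
abbrev L2Ω : Type := Lp (EuclideanSpace ℂ (Fin 3)) 2 (volume.restrict G.Ω)

theorem memLp_toLp {u : ℝ × ℝ → Fin 3 → ℂ} (hu : MemLp u 2 (volume.restrict G.Ω)) :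
    MemLp (fun x => (WithLp.toLp 2 (u x) : EuclideanSpace ℂ (Fin 3))) 2 (volume.restrict G.Ω) :=
  MemLp.of_eval_piLp fun i => hu.eval i

/-- The class of a square integrable field. -/
def toL2 {u : ℝ × ℝ → Fin 3 → ℂ} (hu : MemLp u 2 (volume.restrict G.Ω)) : G.L2Ω :=
  (G.memLp_toLp hu).toLp _

theorem inner_toL2 {u v : ℝ × ℝ → Fin 3 → ℂ} (hu : MemLp u 2 (volume.restrict G.Ω))
    (hv : MemLp v 2 (volume.restrict G.Ω)) : inner ℂ (G.toL2 hu) (G.toL2 hv) = G.innerΩ u v := by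
  rw [L2.inner_def, innerΩ]
  refine integral_congr_ae ?_
  filter_upwards [(G.memLp_toLp hu).coeFn_toLp, (G.memLp_toLp hv).coeFn_toLp] with x h1 h2
  rw [toL2, toL2, h1, h2, EuclideanSpace.inner_eq_star_dotProduct, dotProduct_comm]

theorem exists_eq_toL2 (f : G.L2Ω) :
    ∃ (u : ℝ × ℝ → Fin 3 → ℂ) (hu : MemLp u 2 (volume.restrict G.Ω)), f = G.toL2 hu := by
  refine ⟨fun x => (f x).ofLp, MemLp.of_eval fun i => MemLp.eval_piLp (Lp.memLp f) i, ?_⟩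
  refine Lp.ext ?_
  rw [toL2]
  exact (MemLp.coeFn_toLp _).symm

theorem memLp_mode (p : ModeIdx) : MemLp (G.Φ p.1.1 p.2) 2 (volume.restrict G.Ω) :=
  G.memLp_of_continuous (G.continuous_mode p)

/-- The norm of a mode. -/
def modeNorm (p : ModeIdx) : ℝ := √(G.innerΩ (G.Φ p.1.1 p.2) (G.Φ p.1.1 p.2)).re

theorem modeNorm_pos (p : ModeIdx) : 0 < G.modeNorm p := by
  obtain ⟨c, hc, h⟩ := G.exists_innerΩ_mode_self p
  rw [modeNorm, h]
  exact Real.sqrt_pos.2 hc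

theorem innerΩ_mode_self (p : ModeIdx) :
    G.innerΩ (G.Φ p.1.1 p.2) (G.Φ p.1.1 p.2) = (G.modeNorm p : ℂ) ^ 2 := by
  obtain ⟨c, hc, h⟩ := G.exists_innerΩ_mode_self p
  rw [modeNorm, h, Complex.ofReal_re]
  exact_mod_cast (Real.sq_sqrt hc.le).symm

/-- The coefficient with respect to the normalized mode. -/
def hat (p : ModeIdx) (u : ℝ × ℝ → Fin 3 → ℂ) : ℂ := G.innerΩ (G.Φ p.1.1 p.2) u / G.modeNorm p

theorem modeNorm_ne_zero (p : ModeIdx) : (G.modeNorm p : ℂ) ≠ 0 := by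
  exact_mod_cast (G.modeNorm_pos p).ne'

theorem orthonormal_modes :
    Orthonormal ℂ fun p : ModeIdx => ((G.modeNorm p : ℂ)⁻¹) • G.toL2 (G.memLp_mode p) := by
  classical
  rw [orthonormal_iff_ite]
  intro p q
  rw [inner_smul_left, inner_smul_right, inner_toL2]
  split_ifs with h
  · subst h
    have := G.modeNorm_ne_zero p
    rw [innerΩ_mode_self, map_inv₀, Complex.conj_ofReal]
    field_simp
  · rw [G.innerΩ_mode_eq_zero h]; simp

theorem span_modes_orthogonal :
    (Submodule.span ℂ (range fun p : ModeIdx =>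
      ((G.modeNorm p : ℂ)⁻¹) • G.toL2 (G.memLp_mode p)))ᗮ = ⊥ := by
  rw [Submodule.eq_bot_iff]
  intro f hf
  obtain ⟨u, hu, rfl⟩ := G.exists_eq_toL2 f
  have h : ∀ p : ModeIdx, G.innerΩ (G.Φ p.1.1 p.2) u = 0 := fun p => by
    have := (Submodule.mem_orthogonal _ _).1 hf _ (Submodule.subset_span ⟨p, rfl⟩)
    rw [inner_smul_left, inner_toL2] at this
    refine (mul_eq_zero.1 this).resolve_left ?_
    simpa using G.modeNorm_ne_zero p
  have h0 := G.ae_eq_zero_of_innerΩ_mode hu h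
  rw [Lp.eq_zero_iff_ae_eq_zero]
  filter_upwards [h0, (G.memLp_toLp hu).coeFn_toLp] with x hx hx'
  rw [toL2, hx', hx]; rfl

/-- The normalized modes as a Hilbert basis. -/
def modeBasis : HilbertBasis ModeIdx ℂ G.L2Ω :=
  HilbertBasis.mkOfOrthogonalEqBot G.orthonormal_modes G.span_modes_orthogonal

theorem inner_modeBasis (p : ModeIdx) {u : ℝ × ℝ → Fin 3 → ℂ}
    (hu : MemLp u 2 (volume.restrict G.Ω)) : inner ℂ (G.modeBasis p) (G.toL2 hu) = G.hat p u := by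
  rw [modeBasis, HilbertBasis.coe_mkOfOrthogonalEqBot, inner_smul_left, inner_toL2, hat, map_inv₀,
    Complex.conj_ofReal]
  field_simp

theorem hasSum_star_hat_mul_hat {u v : ℝ × ℝ → Fin 3 → ℂ} (hu : MemLp u 2 (volume.restrict G.Ω))
    (hv : MemLp v 2 (volume.restrict G.Ω)) :
    HasSum (fun p => star (G.hat p u) * G.hat p v) (G.innerΩ u v) := by
  have := G.modeBasis.hasSum_inner_mul_inner (G.toL2 hu) (G.toL2 hv)
  rw [inner_toL2] at this
  refine this.congr_fun fun p => ?_
  rw [inner_modeBasis, ← inner_conj_symm, inner_modeBasis]; rfl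

/-- This turns the sesquilinear Parseval identity into the bilinear one that fits the pairing with
test fields. -/
theorem hat_star (p : ModeIdx) (u : ℝ × ℝ → Fin 3 → ℂ) : G.hat p (star u) = star (G.hat p u) := by
  rw [hat, hat, star_div₀, innerΩ_star]
  congr 1
  · simp only [innerΩ]
    congr 1; funext x
    rw [G.star_mode, dotProduct_comm]; rfl
  · simp

theorem memLp_star {u : ℝ × ℝ → Fin 3 → ℂ} (hu : MemLp u 2 (volume.restrict G.Ω)) :
    MemLp (star u) 2 (volume.restrict G.Ω) :=
  MemLp.of_eval fun i => (hu.eval i).star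

/-- Parseval's identity, in bilinear form. -/
theorem hasSum_hat_mul_hat {u v : ℝ × ℝ → Fin 3 → ℂ} (hu : MemLp u 2 (volume.restrict G.Ω))
    (hv : MemLp v 2 (volume.restrict G.Ω)) :
    HasSum (fun p => G.hat p u * G.hat p v) (∫ x in G.Ω, u x ⬝ᵥ v x) := by
  have := G.hasSum_star_hat_mul_hat (G.memLp_star hu) hv
  simpa [hat_star, innerΩ] using this

theorem innerΩ_self (u : ℝ × ℝ → Fin 3 → ℂ) :
    G.innerΩ u u = ((∫ x in G.Ω, ∑ i, ‖u x i‖ ^ 2 : ℝ) : ℂ) := by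
  rw [innerΩ, ← integral_complex_ofReal]
  congr 1; funext x
  simp [dotProduct, Complex.conj_mul']

/-- Parseval's identity. -/
theorem hasSum_norm_hat_sq {u : ℝ × ℝ → Fin 3 → ℂ} (hu : MemLp u 2 (volume.restrict G.Ω)) :
    HasSum (fun p => ‖G.hat p u‖ ^ 2) (∫ x in G.Ω, ∑ i, ‖u x i‖ ^ 2) := by
  have := G.hasSum_star_hat_mul_hat hu hu
  rw [innerΩ_self] at this
  rw [← Complex.hasSum_ofReal]
  convert this using 2 with p
  simp [Complex.conj_mul']

/-! ### Pairing a field with a mode on the cross-sections -/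

/-- The integral of `Ψ · V` over the cross-section at `t`. -/
def pair (Ψ : ℝ × ℝ → Fin 3 → ℂ) (V : (ℝ × ℝ) × ℝ → Fin 3 → ℂ) (t : ℝ) : ℂ :=
  ∫ x in G.Ω, Ψ x ⬝ᵥ V (x, t)

theorem pair_smul_left (c : ℂ) (Ψ : ℝ × ℝ → Fin 3 → ℂ) (V : (ℝ × ℝ) × ℝ → Fin 3 → ℂ) (t : ℝ) :
    G.pair (c • Ψ) V t = c * G.pair Ψ V t := by
  simp only [pair, Pi.smul_apply, smul_dotProduct, smul_eq_mul]
  exact integral_const_mul _ _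

theorem pair_neg_left (Ψ : ℝ × ℝ → Fin 3 → ℂ) (V : (ℝ × ℝ) × ℝ → Fin 3 → ℂ) (t : ℝ) :
    G.pair (-Ψ) V t = -G.pair Ψ V t := by
  simp only [pair, Pi.neg_apply, neg_dotProduct]
  exact integral_neg _

theorem pair_zero_left (V : (ℝ × ℝ) × ℝ → Fin 3 → ℂ) (t : ℝ) : G.pair 0 V t = 0 := by
  simp [pair]

theorem pair_smul_right (c : ℂ) (Ψ : ℝ × ℝ → Fin 3 → ℂ) (V : (ℝ × ℝ) × ℝ → Fin 3 → ℂ) (t : ℝ) :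
    G.pair Ψ (c • V) t = c * G.pair Ψ V t := by
  simp only [pair, Pi.smul_apply, dotProduct_smul, smul_eq_mul]
  exact integral_const_mul _ _

theorem integrableOn_dotProduct {Ψ : ℝ × ℝ → Fin 3 → ℂ} {V : (ℝ × ℝ) × ℝ → Fin 3 → ℂ}
    (hΨ : Continuous Ψ) (hV : Continuous V) (t : ℝ) :
    IntegrableOn (fun x => Ψ x ⬝ᵥ V (x, t)) G.Ω :=
  G.integrableOn_Ω_of_continuous (by unfold dotProduct; fun_prop)

theorem pair_add_right {Ψ : ℝ × ℝ → Fin 3 → ℂ} {U V : (ℝ × ℝ) × ℝ → Fin 3 → ℂ}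
    (hΨ : Continuous Ψ) (hU : Continuous U) (hV : Continuous V) (t : ℝ) :
    G.pair Ψ (U + V) t = G.pair Ψ U t + G.pair Ψ V t := by
  simp only [pair]
  rw [← integral_add (G.integrableOn_dotProduct hΨ hU t) (G.integrableOn_dotProduct hΨ hV t)]
  simp [dotProduct_add]

theorem pair_sub_right {Ψ : ℝ × ℝ → Fin 3 → ℂ} {U V : (ℝ × ℝ) × ℝ → Fin 3 → ℂ}
    (hΨ : Continuous Ψ) (hU : Continuous U) (hV : Continuous V) (t : ℝ) :
    G.pair Ψ (U - V) t = G.pair Ψ U t - G.pair Ψ V t := by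
  simp only [pair]
  rw [← integral_sub (G.integrableOn_dotProduct hΨ hU t) (G.integrableOn_dotProduct hΨ hV t)]
  simp [dotProduct_sub]

theorem contDiff_pd {V : (ℝ × ℝ) × ℝ → Fin 3 → ℂ} (hV : ContDiff ℝ ∞ V) (j : Fin 3) :
    ContDiff ℝ ∞ (pd j V) :=
  (hV.fderiv_right (m := ∞) (by simp)).clm_apply contDiff_const

theorem contDiff_curl {V : (ℝ × ℝ) × ℝ → Fin 3 → ℂ} (hV : ContDiff ℝ ∞ V) :
    ContDiff ℝ ∞ (curl V) := by
  have hc : ∀ j i, ContDiff ℝ ∞ fun x => pd j V x i := fun j i =>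
    (contDiff_pi.1 (contDiff_pd hV j)) i
  refine contDiff_pi.2 fun i => ?_
  fin_cases i
  · exact (hc 1 2).sub (hc 2 1)
  · exact (hc 2 0).sub (hc 0 2)
  · exact (hc 0 1).sub (hc 1 0)

theorem hasDerivAt_slice {V : (ℝ × ℝ) × ℝ → Fin 3 → ℂ} (hV : ContDiff ℝ ∞ V) (x : ℝ × ℝ) (t : ℝ) :
    HasDerivAt (fun s => V (x, s)) (pd 2 V (x, t)) t := by
  have h1 : HasFDerivAt V (fderiv ℝ V (x, t)) (x, t) :=
    (hV.differentiable (by simp) (x, t)).hasFDerivAt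
  have h2 : HasDerivAt (fun s : ℝ => (x, s)) ((0 : ℝ × ℝ), (1 : ℝ)) t :=
    (hasDerivAt_const t x).prodMk (hasDerivAt_id t)
  exact h1.comp_hasDerivAt t h2

theorem continuous_pair {Ψ : ℝ × ℝ → Fin 3 → ℂ} {V : (ℝ × ℝ) × ℝ → Fin 3 → ℂ}
    (hΨ : Continuous Ψ) (hV : Continuous V) : Continuous (G.pair Ψ V) := by
  have hc : Continuous fun y : ℝ × (ℝ × ℝ) => Ψ y.2 ⬝ᵥ V (y.2, y.1) := by
    unfold dotProduct; fun_prop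
  rw [continuous_iff_continuousAt]
  intro t
  obtain ⟨C, hC⟩ := ((isCompact_closedBall t 1).prod
    (isCompact_Icc.prod isCompact_Icc : IsCompact (Icc 0 G.L₁ ×ˢ Icc 0 G.L₂))
      ).exists_bound_of_continuousOn hc.continuousOn
  refine continuousAt_of_dominated (bound := fun _ => C) ?_ ?_ (integrable_const C) ?_
  · exact Eventually.of_forall fun s => (G.integrableOn_dotProduct hΨ hV s).aestronglyMeasurable
  · filter_upwards [Metric.closedBall_mem_nhds t one_pos] with s hs
    filter_upwards [ae_restrict_mem G.measurableSet_Ω] with x hx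
    exact hC (s, x) ⟨hs, prod_mono Ioo_subset_Icc_self Ioo_subset_Icc_self hx⟩
  · exact ae_of_all _ fun x => by
      have : Continuous fun s : ℝ => Ψ x ⬝ᵥ V (x, s) := by unfold dotProduct; fun_prop
      exact this.continuousAt

theorem hasDerivAt_pair {Ψ : ℝ × ℝ → Fin 3 → ℂ} {V : (ℝ × ℝ) × ℝ → Fin 3 → ℂ}
    (hΨ : Continuous Ψ) (hV : ContDiff ℝ ∞ V) (t : ℝ) :
    HasDerivAt (G.pair Ψ V) (G.pair Ψ (pd 2 V) t) t := by
  have hV' := (contDiff_pd hV 2).continuous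
  have hc : Continuous fun y : ℝ × (ℝ × ℝ) => Ψ y.2 ⬝ᵥ pd 2 V (y.2, y.1) := by
    unfold dotProduct; fun_prop
  obtain ⟨C, hC⟩ := ((isCompact_closedBall t 1).prod
    (isCompact_Icc.prod isCompact_Icc : IsCompact (Icc 0 G.L₁ ×ˢ Icc 0 G.L₂))
      ).exists_bound_of_continuousOn hc.continuousOn
  refine (hasDerivAt_integral_of_dominated_loc_of_deriv_le (bound := fun _ => C)
    (F' := fun s x => Ψ x ⬝ᵥ pd 2 V (x, s)) (Metric.closedBall_mem_nhds t one_pos) ?_ ?_ ?_ ?_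
    (integrable_const C) ?_).2
  · exact Eventually.of_forall fun s =>
      (G.integrableOn_dotProduct hΨ hV.continuous s).aestronglyMeasurable
  · exact G.integrableOn_dotProduct hΨ hV.continuous t
  · exact (G.integrableOn_dotProduct hΨ hV' t).aestronglyMeasurable
  · filter_upwards [ae_restrict_mem G.measurableSet_Ω] with x hx s hs
    exact hC (s, x) ⟨hs, prod_mono Ioo_subset_Icc_self Ioo_subset_Icc_self hx⟩
  · refine ae_of_all _ fun x s _ => ?_
    have := fun i => hasDerivAt_pi.1 (hasDerivAt_slice hV x s) i
    exact HasDerivAt.fun_sum fun i _ => (this i).const_mul (Ψ x i)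

/-- Differentiation in t replaces V by ∂₃V, which is again smooth, so the induction runs over all
smooth fields at once. -/
theorem contDiff_pair {Ψ : ℝ × ℝ → Fin 3 → ℂ} {V : (ℝ × ℝ) × ℝ → Fin 3 → ℂ}
    (hΨ : Continuous Ψ) (hV : ContDiff ℝ ∞ V) : ContDiff ℝ ∞ (G.pair Ψ V) := by
  rw [contDiff_infty]
  intro n
  induction n generalizing V with
  | zero => exact contDiff_zero.2 (G.continuous_pair hΨ hV.continuous)
  | succ n ih =>
    push_cast
    rw [contDiff_succ_iff_deriv]
    refine ⟨fun t => (G.hasDerivAt_pair hΨ hV t).differentiableAt, by simp, ?_⟩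
    rw [show deriv (G.pair Ψ V) = G.pair Ψ (pd 2 V) from
      funext fun t => (G.hasDerivAt_pair hΨ hV t).deriv]
    exact ih (contDiff_pd hV 2)

/-! ### Integration by parts on the cross-section -/

theorem integral_fderiv_fst {f : ℝ × ℝ → ℂ} (hf : ContDiff ℝ ∞ f)
    (h : ∀ x ∈ Icc 0 G.L₁ ×ˢ Icc 0 G.L₂, x.1 = 0 ∨ x.1 = G.L₁ → f x = 0) :
    ∫ x in G.Ω, fderiv ℝ f x (1, 0) = 0 := by
  have hc : Continuous fun x => fderiv ℝ f x (1, 0) :=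
    ((hf.fderiv_right (m := ∞) (by simp)).clm_apply contDiff_const).continuous
  have hint := G.integrableOn_Ω_of_continuous hc
  rw [Ω, Measure.volume_eq_prod, ← setIntegral_prod_swap, setIntegral_prod]
  · refine setIntegral_eq_zero_of_forall_eq_zero fun y hy => ?_
    simp only [Prod.swap_prod_mk]
    have hd : ∀ x, HasDerivAt (fun x => f (x, y)) (fderiv ℝ f (x, y) (1, 0)) x := fun x =>
      ((hf.differentiable (by simp) (x, y)).hasFDerivAt).comp_hasDerivAt x
        ((hasDerivAt_id x).prodMk (hasDerivAt_const x y))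
    rw [← integral_Ioc_eq_integral_Ioo, ← intervalIntegral.integral_of_le G.L₁_pos.le,
      intervalIntegral.integral_eq_sub_of_hasDerivAt (fun x _ => hd x)
        (Continuous.intervalIntegrable (by fun_prop) _ _),
      h (G.L₁, y) ⟨right_mem_Icc.2 G.L₁_pos.le, Ioo_subset_Icc_self hy⟩ (Or.inr rfl),
      h (0, y) ⟨left_mem_Icc.2 G.L₁_pos.le, Ioo_subset_Icc_self hy⟩ (Or.inl rfl), sub_zero]
  · have := IntegrableOn.swap (μ := volume) (ν := volume) (s := Ioo 0 G.L₁) (t := Ioo 0 G.L₂) hint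
    exact this

theorem integral_fderiv_snd {f : ℝ × ℝ → ℂ} (hf : ContDiff ℝ ∞ f)
    (h : ∀ x ∈ Icc 0 G.L₁ ×ˢ Icc 0 G.L₂, x.2 = 0 ∨ x.2 = G.L₂ → f x = 0) :
    ∫ x in G.Ω, fderiv ℝ f x (0, 1) = 0 := by
  have hc : Continuous fun x => fderiv ℝ f x (0, 1) :=
    ((hf.fderiv_right (m := ∞) (by simp)).clm_apply contDiff_const).continuous
  have hint := G.integrableOn_Ω_of_continuous hc
  rw [Ω, Measure.volume_eq_prod, setIntegral_prod _ hint]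
  refine setIntegral_eq_zero_of_forall_eq_zero fun x hx => ?_
  have hd : ∀ y, HasDerivAt (fun y => f (x, y)) (fderiv ℝ f (x, y) (0, 1)) y := fun y =>
    ((hf.differentiable (by simp) (x, y)).hasFDerivAt).comp_hasDerivAt y
      ((hasDerivAt_const y x).prodMk (hasDerivAt_id y))
  rw [← integral_Ioc_eq_integral_Ioo, ← intervalIntegral.integral_of_le G.L₂_pos.le,
    intervalIntegral.integral_eq_sub_of_hasDerivAt (fun y _ => hd y)
      (Continuous.intervalIntegrable (by fun_prop) _ _),
    h (x, G.L₂) ⟨Ioo_subset_Icc_self hx, right_mem_Icc.2 G.L₂_pos.le⟩ (Or.inr rfl),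
    h (x, 0) ⟨Ioo_subset_Icc_self hx, left_mem_Icc.2 G.L₂_pos.le⟩ (Or.inl rfl), sub_zero]

theorem contDiff_pd2 {u : ℝ × ℝ → Fin 3 → ℂ} (hu : ContDiff ℝ ∞ u) (e : ℝ × ℝ) :
    ContDiff ℝ ∞ (pd2 e u) :=
  (hu.fderiv_right (m := ∞) (by simp)).clm_apply contDiff_const

theorem contDiff_rot {u : ℝ × ℝ → Fin 3 → ℂ} (hu : ContDiff ℝ ∞ u) : ContDiff ℝ ∞ (rot u) := by
  have hc : ∀ e i, ContDiff ℝ ∞ fun x => pd2 e u x i := fun e i =>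
    contDiff_pi.1 (contDiff_pd2 hu e) i
  refine contDiff_pi.2 fun i => ?_
  fin_cases i
  · exact hc _ 2
  · exact (hc _ 2).neg
  · exact (hc _ 1).sub (hc _ 0)

theorem contDiff_crossAxis {u : ℝ × ℝ → Fin 3 → ℂ} (hu : ContDiff ℝ ∞ u) :
    ContDiff ℝ ∞ (crossAxis u) := by
  have hc : ∀ i, ContDiff ℝ ∞ fun x => u x i := fun i => contDiff_pi.1 hu i
  refine contDiff_pi.2 fun i => ?_
  fin_cases i
  · exact hc 1
  · exact (hc 0).neg
  · exact contDiff_const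

theorem fderiv_slice {U : (ℝ × ℝ) × ℝ → Fin 3 → ℂ} (hU : ContDiff ℝ ∞ U) (t : ℝ) (x e : ℝ × ℝ)
    (i : Fin 3) :
    fderiv ℝ (fun x => U (x, t) i) x e = fderiv ℝ U (x, t) (e, 0) i := by
  have h1 : HasFDerivAt (fun x : ℝ × ℝ => (x, t)) (ContinuousLinearMap.inl ℝ (ℝ × ℝ) ℝ) x :=
    hasFDerivAt_prodMk_left x t
  have h2 := ((hU.differentiable (by simp) (x, t)).hasFDerivAt).comp x h1
  have h3 := (hasFDerivAt_pi'.1 h2) i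
  have h4 : (fun x => U (x, t) i) = fun x => (U ∘ fun x : ℝ × ℝ => (x, t)) x i := rfl
  rw [h4, h3.fderiv]
  simp

/-- Integration by parts for the curl on a cross-section. -/
theorem pair_curl {Ψ : ℝ × ℝ → Fin 3 → ℂ} {U : (ℝ × ℝ) × ℝ → Fin 3 → ℂ} (hΨ : ContDiff ℝ ∞ Ψ)
    (hU : ContDiff ℝ ∞ U) (t : ℝ)
    (h1 : ∀ x ∈ Icc 0 G.L₁ ×ˢ Icc 0 G.L₂, x.1 = 0 ∨ x.1 = G.L₁ →
      Ψ x 2 * U (x, t) 1 = 0 ∧ Ψ x 1 * U (x, t) 2 = 0)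
    (h2 : ∀ x ∈ Icc 0 G.L₁ ×ˢ Icc 0 G.L₂, x.2 = 0 ∨ x.2 = G.L₂ →
      Ψ x 0 * U (x, t) 2 = 0 ∧ Ψ x 2 * U (x, t) 0 = 0) :
    G.pair Ψ (curl U) t = G.pair (rot Ψ) U t + G.pair (crossAxis Ψ) (pd 2 U) t := by
  have hΨi : ∀ i, ContDiff ℝ ∞ fun x => Ψ x i := fun i => contDiff_pi.1 hΨ i
  have hUi : ∀ i, ContDiff ℝ ∞ fun x => U (x, t) i := fun i =>
    (contDiff_pi.1 hU i).comp (contDiff_id.prodMk contDiff_const)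
  have hm : ∀ i j (x e : ℝ × ℝ), fderiv ℝ (fun x => Ψ x i * U (x, t) j) x e =
      Ψ x i * fderiv ℝ U (x, t) (e, 0) j + U (x, t) j * pd2 e Ψ x i := fun i j x e => by
    rw [fderiv_fun_mul ((hΨi i).differentiable (by simp) x) ((hUi j).differentiable (by simp) x),
      pd2_apply (hΨ.differentiable (by simp) x)]
    simp [fderiv_slice hU]
  have hs : ∀ i j k l (x e : ℝ × ℝ), fderiv ℝ (fun x => Ψ x i * U (x, t) j - Ψ x k * U (x, t) l) x e
      = fderiv ℝ (fun x => Ψ x i * U (x, t) j) x e - fderiv ℝ (fun x => Ψ x k * U (x, t) l) x e :=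
    fun i j k l x e => by
      rw [fderiv_fun_sub (((hΨi i).mul (hUi j)).differentiable (by simp) x)
        (((hΨi k).mul (hUi l)).differentiable (by simp) x)]
      rfl
  have i1 := G.integral_fderiv_fst (f := fun x => Ψ x 2 * U (x, t) 1 - Ψ x 1 * U (x, t) 2)
    (((hΨi 2).mul (hUi 1)).sub ((hΨi 1).mul (hUi 2))) fun x hx hx' => by
      rw [(h1 x hx hx').1, (h1 x hx hx').2, sub_zero]
  have i2 := G.integral_fderiv_snd (f := fun x => Ψ x 0 * U (x, t) 2 - Ψ x 2 * U (x, t) 0)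
    (((hΨi 0).mul (hUi 2)).sub ((hΨi 2).mul (hUi 0))) fun x hx hx' => by
      rw [(h2 x hx hx').1, (h2 x hx hx').2, sub_zero]
  have hcont : ∀ {f : ℝ × ℝ → ℂ} (e : ℝ × ℝ), ContDiff ℝ ∞ f →
      IntegrableOn (fun x => fderiv ℝ f x e) G.Ω := fun e hf =>
    G.integrableOn_Ω_of_continuous
      ((hf.fderiv_right (m := ∞) (by simp)).clm_apply contDiff_const).continuous
  -- Pointwise, Ψ · curl U - U · curl Ψ = div(U × Ψ). The two integrals on the right are the
  -- transverse part of this divergence, and the x₃-part supplies the pairing of `crossAxis Ψ` with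
  -- ∂₃U.
  have key : G.pair Ψ (curl U) t - (G.pair (rot Ψ) U t + G.pair (crossAxis Ψ) (pd 2 U) t) =
      (∫ x in G.Ω, fderiv ℝ (fun x => Ψ x 2 * U (x, t) 1 - Ψ x 1 * U (x, t) 2) x (1, 0)) +
      ∫ x in G.Ω, fderiv ℝ (fun x => Ψ x 0 * U (x, t) 2 - Ψ x 2 * U (x, t) 0) x (0, 1) := by
    simp only [pair]
    have j1 := G.integrableOn_dotProduct hΨ.continuous (contDiff_curl hU).continuous t
    have j2 := G.integrableOn_dotProduct (contDiff_rot hΨ).continuous hU.continuous t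
    have j3 := G.integrableOn_dotProduct (contDiff_crossAxis hΨ).continuous
      (contDiff_pd hU 2).continuous t
    have j4 : IntegrableOn (fun x => rot Ψ x ⬝ᵥ U (x, t) + crossAxis Ψ x ⬝ᵥ pd 2 U (x, t)) G.Ω :=
      j2.add j3
    rw [← integral_add j2 j3, ← integral_sub j1 j4, ← integral_add
      (hcont _ (((hΨi 2).mul (hUi 1)).sub ((hΨi 1).mul (hUi 2))))
      (hcont _ (((hΨi 0).mul (hUi 2)).sub ((hΨi 2).mul (hUi 0))))]
    congr 1; funext x
    simp only [hs, hm, dotProduct, Fin.sum_univ_three, curl, rot, crossAxis, pd, dir,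
      Matrix.cons_val]
    ring
  rw [i1, i2, add_zero] at key
  exact sub_eq_zero.1 key

theorem closure_W : closure G.W = (Icc 0 G.L₁ ×ˢ Icc 0 G.L₂) ×ˢ Iic 0 := by
  rw [W, Ω, closure_prod_eq, closure_prod_eq, closure_Ioo G.L₁_pos.ne, closure_Ioo G.L₂_pos.ne,
    closure_Iio]

theorem TangentialZero.fst {V : (ℝ × ℝ) × ℝ → Fin 3 → ℂ} (h : G.TangentialZero V) {x : ℝ × ℝ}
    (hx : x ∈ Icc 0 G.L₁ ×ˢ Icc 0 G.L₂) {t : ℝ} (ht : t ≤ 0) (hw : x.1 = 0 ∨ x.1 = G.L₁) :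
    V (x, t) 1 = 0 ∧ V (x, t) 2 = 0 := by
  have hc : ((x, t) : (ℝ × ℝ) × ℝ) ∈ closure G.W := by rw [closure_W]; exact ⟨hx, ht⟩
  rcases hw with hw | hw
  · have := h (x, t) _ ⟨hc, Or.inl ⟨hw, rfl⟩⟩
    constructor
    · simpa [crossProduct] using congrFun this 2
    · simpa [crossProduct] using congrFun this 1
  · have := h (x, t) _ ⟨hc, Or.inr (Or.inl ⟨hw, rfl⟩)⟩
    constructor
    · simpa [crossProduct] using congrFun this 2
    · simpa [crossProduct] using congrFun this 1

theorem TangentialZero.snd {V : (ℝ × ℝ) × ℝ → Fin 3 → ℂ} (h : G.TangentialZero V) {x : ℝ × ℝ}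
    (hx : x ∈ Icc 0 G.L₁ ×ˢ Icc 0 G.L₂) {t : ℝ} (ht : t ≤ 0) (hw : x.2 = 0 ∨ x.2 = G.L₂) :
    V (x, t) 0 = 0 ∧ V (x, t) 2 = 0 := by
  have hc : ((x, t) : (ℝ × ℝ) × ℝ) ∈ closure G.W := by rw [closure_W]; exact ⟨hx, ht⟩
  rcases hw with hw | hw
  · have := h (x, t) _ ⟨hc, Or.inr (Or.inr (Or.inl ⟨hw, rfl⟩))⟩
    constructor
    · simpa [crossProduct] using congrFun this 2
    · simpa [crossProduct] using congrFun this 0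
  · have := h (x, t) _ ⟨hc, Or.inr (Or.inr (Or.inr (Or.inl ⟨hw, rfl⟩)))⟩
    constructor
    · simpa [crossProduct] using congrFun this 2
    · simpa [crossProduct] using congrFun this 0

theorem TangentialZero.endWall {V : (ℝ × ℝ) × ℝ → Fin 3 → ℂ} (h : G.TangentialZero V) {x : ℝ × ℝ}
    (hx : x ∈ Icc 0 G.L₁ ×ˢ Icc 0 G.L₂) : V (x, 0) 0 = 0 ∧ V (x, 0) 1 = 0 := by
  have hc : ((x, 0) : (ℝ × ℝ) × ℝ) ∈ closure G.W := by
    rw [closure_W]; exact ⟨hx, self_mem_Iic⟩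
  have := h (x, 0) _ ⟨hc, Or.inr (Or.inr (Or.inr (Or.inr ⟨rfl, rfl⟩)))⟩
  constructor
  · simpa [crossProduct] using congrFun this 1
  · simpa [crossProduct] using congrFun this 0

/-- All boundary conditions are carried by V, so Ψ may be any smooth field, such as `rot` or
`crossAxis` of a mode. -/
theorem pair_curl_of_tangentialZero {Ψ : ℝ × ℝ → Fin 3 → ℂ} {V : (ℝ × ℝ) × ℝ → Fin 3 → ℂ}
    (hΨ : ContDiff ℝ ∞ Ψ) (hV : ContDiff ℝ ∞ V) (h : G.TangentialZero V) {t : ℝ} (ht : t ≤ 0) :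
    G.pair Ψ (curl V) t = G.pair (rot Ψ) V t + G.pair (crossAxis Ψ) (pd 2 V) t :=
  G.pair_curl hΨ hV t
    (fun x hx hw => by rw [(h.fst G hx ht hw).1, (h.fst G hx ht hw).2]; simp)
    (fun x hx hw => by rw [(h.snd G hx ht hw).1, (h.snd G hx ht hw).2]; simp)

/-- The pairing of `curl curl V` with a field that satisfies the wall conditions. -/
theorem pair_curl_curl {Ψ : ℝ × ℝ → Fin 3 → ℂ} {V : (ℝ × ℝ) × ℝ → Fin 3 → ℂ}
    (hΨ : ContDiff ℝ ∞ Ψ) (hw : G.WallZero Ψ) (hV : ContDiff ℝ ∞ V) (h : G.TangentialZero V)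
    {t : ℝ} (ht : t < 0) :
    G.pair Ψ (curl (curl V)) t = G.pair (rot (rot Ψ)) V t + G.pair (crossAxis (rot Ψ)) (pd 2 V) t +
      (G.pair (rot (crossAxis Ψ)) (pd 2 V) t +
        G.pair (crossAxis (crossAxis Ψ)) (pd 2 (pd 2 V)) t) := by
  -- In the first integration by parts the boundary terms are killed by Ψ, since curl V is
  -- unrestricted on the walls; in the second they are killed by V.
  rw [G.pair_curl hΨ (contDiff_curl hV) t
    (fun x _ hx => by rw [(hw.fst x hx).1, (hw.fst x hx).2]; simp)
    (fun x _ hx => by rw [(hw.snd x hx).1, (hw.snd x hx).2]; simp),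
    G.pair_curl_of_tangentialZero (contDiff_rot hΨ) hV h ht.le]
  congr 1
  -- The pairing with ∂₃ curl V is the t-derivative of the pairing with curl V, to which integration
  -- by parts applies for all s near t. This is where t < 0 has to be strict.
  have hc := contDiff_crossAxis hΨ
  have d1 := G.hasDerivAt_pair hc.continuous (contDiff_curl hV) t
  have d2 := (G.hasDerivAt_pair (contDiff_rot hc).continuous hV t).add
    (G.hasDerivAt_pair (contDiff_crossAxis hc).continuous (contDiff_pd hV 2) t)
  refine d1.unique (d2.congr_of_eventuallyEq ?_)
  filter_upwards [Iio_mem_nhds ht] with s hs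
  exact G.pair_curl_of_tangentialZero hc hV h hs.le

/-! ### Normalized coefficients of test fields -/

/-- The coefficient of `V`, on the cross-section at `t`, with respect to a normalized mode. -/
def cf (p : ModeIdx) (V : (ℝ × ℝ) × ℝ → Fin 3 → ℂ) (t : ℝ) : ℂ :=
  G.pair (G.Φ p.1.1 p.2) V t / G.modeNorm p

theorem hat_slice (p : ModeIdx) (V : (ℝ × ℝ) × ℝ → Fin 3 → ℂ) (t : ℝ) :
    G.hat p (fun x => V (x, t)) = G.cf p V t := by
  simp only [hat, cf, innerΩ, pair, G.star_mode]

theorem memLp_slice {V : (ℝ × ℝ) × ℝ → Fin 3 → ℂ} (hV : Continuous V) (t : ℝ) :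
    MemLp (fun x => V (x, t)) 2 (volume.restrict G.Ω) :=
  G.memLp_of_continuous (by fun_prop)

theorem hasSum_norm_cf_sq {V : (ℝ × ℝ) × ℝ → Fin 3 → ℂ} (hV : Continuous V) (t : ℝ) :
    HasSum (fun p => ‖G.cf p V t‖ ^ 2) (∫ x in G.Ω, ∑ i, ‖V (x, t) i‖ ^ 2) := by
  simpa only [hat_slice] using G.hasSum_norm_hat_sq (G.memLp_slice hV t)

theorem continuous_cf (p : ModeIdx) {V : (ℝ × ℝ) × ℝ → Fin 3 → ℂ} (hV : Continuous V) :
    Continuous (G.cf p V) := (G.continuous_pair (G.continuous_mode p) hV).div_const _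

theorem hasDerivAt_cf (p : ModeIdx) {V : (ℝ × ℝ) × ℝ → Fin 3 → ℂ} (hV : ContDiff ℝ ∞ V) (t : ℝ) :
    HasDerivAt (G.cf p V) (G.cf p (pd 2 V) t) t :=
  (G.hasDerivAt_pair (G.continuous_mode p) hV t).div_const _

theorem pair_eq_zero (Ψ : ℝ × ℝ → Fin 3 → ℂ) {V : (ℝ × ℝ) × ℝ → Fin 3 → ℂ} {t : ℝ}
    (h : ∀ x, V (x, t) = 0) : G.pair Ψ V t = 0 := by
  simp [pair, h]

theorem cf_eq_zero (p : ModeIdx) {V : (ℝ × ℝ) × ℝ → Fin 3 → ℂ} {t : ℝ} (h : ∀ x, V (x, t) = 0) :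
    G.cf p V t = 0 := by
  simp [cf, G.pair_eq_zero _ h]

/-- A bound for the squared coefficients of `V` on the interval `[a, b]`. -/
def energy (a b : ℝ) (V : (ℝ × ℝ) × ℝ → Fin 3 → ℂ) (p : ModeIdx) : ℝ :=
  (b - a) * ∫ s in Ioo a b, ‖G.cf p (pd 2 V) s‖ ^ 2

theorem integrableOn_Ioo {E : Type*} [NormedAddCommGroup E] {f : ℝ → E} (hf : Continuous f)
    (a b : ℝ) : IntegrableOn f (Ioo a b) :=
  (hf.continuousOn.integrableOn_compact isCompact_Icc).mono_set Ioo_subset_Icc_self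

/-- Cauchy–Schwarz against the constant 1, obtained by expanding the integral of the square of f
minus its mean. -/
theorem sq_integral_le {f : ℝ → ℝ} (hf : Continuous f) {a b : ℝ} (hab : a ≤ b) :
    (∫ s in Ioo a b, f s) ^ 2 ≤ (b - a) * ∫ s in Ioo a b, f s ^ 2 := by
  rcases hab.eq_or_lt with rfl | hab
  · simp
  set B := ∫ s in Ioo a b, f s
  have h : 0 ≤ ∫ s in Ioo a b, (f s - B / (b - a)) ^ 2 := integral_nonneg fun s => sq_nonneg _
  have e : ∫ s in Ioo a b, (f s - B / (b - a)) ^ 2 =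
      (∫ s in Ioo a b, f s ^ 2) - 2 * (B / (b - a)) * B + (b - a) * (B / (b - a)) ^ 2 := by
    have : ∀ s, (f s - B / (b - a)) ^ 2 =
      (f s ^ 2 - 2 * (B / (b - a)) * f s) + (B / (b - a)) ^ 2 := fun s => by ring
    simp only [this]
    rw [integral_add, integral_sub, integral_const_mul]
    · simp [hab.le]
      exact Or.inl rfl
    · exact integrableOn_Ioo (by fun_prop) _ _
    · exact integrableOn_Ioo (by fun_prop) _ _
    · exact integrableOn_Ioo (by fun_prop) _ _
    · exact integrableOn_Ioo (by fun_prop) _ _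
  rw [e] at h
  have hl : 0 < b - a := sub_pos.2 hab
  have h2 : 0 ≤ (b - a) * ((∫ s in Ioo a b, f s ^ 2) - 2 * (B / (b - a)) * B +
    (b - a) * (B / (b - a)) ^ 2) := mul_nonneg hl.le h
  have h3 : (b - a) * ((∫ s in Ioo a b, f s ^ 2) - 2 * (B / (b - a)) * B +
    (b - a) * (B / (b - a)) ^ 2) = (b - a) * (∫ s in Ioo a b, f s ^ 2) - B ^ 2 := by
    field_simp
    ring
  linarith

theorem energy_nonneg {a b : ℝ} (hab : a ≤ b) (V : (ℝ × ℝ) × ℝ → Fin 3 → ℂ) (p : ModeIdx) :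
    0 ≤ G.energy a b V p :=
  mul_nonneg (sub_nonneg.2 hab) (integral_nonneg fun _ => sq_nonneg _)

/-- The coefficient vanishes at a, so it is the integral of its derivative. The bound does not
depend on t, so the suprema over t can be summed over the modes; this uniformity costs one
x₃-derivative. -/
theorem norm_cf_sq_le {V : (ℝ × ℝ) × ℝ → Fin 3 → ℂ} (hV : ContDiff ℝ ∞ V) {a b : ℝ}
    (hab : a ≤ b) (h0 : ∀ x t, t < a → V (x, t) = 0) (p : ModeIdx) {t : ℝ} (ht : t ≤ b) :
    ‖G.cf p V t‖ ^ 2 ≤ G.energy a b V p := by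
  rcases lt_or_ge t a with hta | hta
  · rw [G.cf_eq_zero p fun x => h0 x t hta]
    simpa using G.energy_nonneg hab V p
  have hc := G.continuous_cf p hV.continuous
  have hc' := G.continuous_cf p (contDiff_pd hV 2).continuous
  have ha : G.cf p V a = 0 := by
    -- The hypothesis gives zero only for t < a; continuity adds t = a.
    have h1 : EqOn (G.cf p V) 0 (closure (Iio a)) :=
      EqOn.closure (fun s hs => G.cf_eq_zero p fun x => h0 x s hs) hc continuous_const
    exact h1 (by rw [closure_Iio]; exact self_mem_Iic)
  have h1 : G.cf p V t = ∫ s in Ioc a t, G.cf p (pd 2 V) s := by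
    rw [← intervalIntegral.integral_of_le hta, intervalIntegral.integral_eq_sub_of_hasDerivAt
      (fun s _ => G.hasDerivAt_cf p hV s) (hc'.intervalIntegrable _ _), ha, sub_zero]
  have h2 : ‖G.cf p V t‖ ≤ ∫ s in Ioo a b, ‖G.cf p (pd 2 V) s‖ := by
    rw [h1, integral_Ioc_eq_integral_Ioo]
    refine (norm_integral_le_integral_norm _).trans ?_
    exact setIntegral_mono_set (integrableOn_Ioo hc'.norm _ _)
      (ae_of_all _ fun _ => norm_nonneg _) (Ioo_subset_Ioo_right ht).eventuallyLE
  refine (pow_le_pow_left₀ (norm_nonneg _) h2 2).trans ?_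
  exact sq_integral_le hc'.norm hab

/-- Bessel's inequality for ∂₃V on each cross-section, integrated over the interval. One factor b -
a is part of `energy`, the other is the length of the interval. -/
theorem sum_energy_le {V : (ℝ × ℝ) × ℝ → Fin 3 → ℂ} (hV : ContDiff ℝ ∞ V) {a b M : ℝ}
    (hab : a ≤ b) (hM : ∀ t ∈ Ioo a b, ∫ x in G.Ω, ∑ i, ‖pd 2 V (x, t) i‖ ^ 2 ≤ M ^ 2)
    (F : Finset ModeIdx) : ∑ p ∈ F, G.energy a b V p ≤ (b - a) ^ 2 * M ^ 2 := by
  have hc := fun p => G.continuous_cf p (contDiff_pd hV 2).continuous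
  simp only [energy]
  rw [← Finset.mul_sum, sq (b - a), mul_assoc]
  refine mul_le_mul_of_nonneg_left ?_ (sub_nonneg.2 hab)
  have hc2 : ∀ p ∈ F, IntegrableOn (fun s => ‖G.cf p (pd 2 V) s‖ ^ 2) (Ioo a b) := fun p _ =>
    integrableOn_Ioo ((hc p).norm.pow 2) a b
  rw [← integral_finsetSum _ hc2]
  have : (b - a) * M ^ 2 = ∫ _ in Ioo a b, M ^ 2 := by simp [hab]
  rw [this]
  refine setIntegral_mono_on (integrable_finsetSum _ hc2)
    (integrableOn_Ioo continuous_const a b) measurableSet_Ioo fun t ht => ?_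
  exact (sum_le_hasSum F (fun _ _ => sq_nonneg _)
    (G.hasSum_norm_cf_sq (contDiff_pd hV 2).continuous t)).trans (hM t ht)

theorem exists_bound_slice {V : (ℝ × ℝ) × ℝ → Fin 3 → ℂ} (hV : Continuous V) (a b : ℝ) :
    ∃ M : ℝ, ∀ t ∈ Ioo a b, ∫ x in G.Ω, ∑ i, ‖V (x, t) i‖ ^ 2 ≤ M ^ 2 := by
  obtain ⟨C, hC⟩ := ((isCompact_Icc.prod isCompact_Icc :
    IsCompact (Icc 0 G.L₁ ×ˢ Icc 0 G.L₂)).prod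
      (isCompact_Icc : IsCompact (Icc a b))).exists_bound_of_continuousOn hV.continuousOn
  refine ⟨√(∫ _ in G.Ω, 3 * C ^ 2), fun t ht => ?_⟩
  rw [Real.sq_sqrt (integral_nonneg fun _ => by positivity)]
  refine setIntegral_mono_on (G.integrableOn_Ω_of_continuous (by fun_prop))
    (G.integrableOn_Ω_of_continuous continuous_const) G.measurableSet_Ω fun x hx => ?_
  have h := hC (x, t) ⟨prod_mono Ioo_subset_Icc_self Ioo_subset_Icc_self hx,
    Ioo_subset_Icc_self ht⟩
  calc ∑ i, ‖V (x, t) i‖ ^ 2 ≤ ∑ _i : Fin 3, C ^ 2 :=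
        Finset.sum_le_sum fun i _ => pow_le_pow_left₀ (norm_nonneg _)
          ((norm_le_pi_norm _ i).trans h) 2
    _ = 3 * C ^ 2 := by simp

theorem summable_energy {V : (ℝ × ℝ) × ℝ → Fin 3 → ℂ} (hV : ContDiff ℝ ∞ V) {a b : ℝ}
    (hab : a ≤ b) : Summable (G.energy a b V) := by
  obtain ⟨M, hM⟩ := G.exists_bound_slice (contDiff_pd hV 2).continuous a b
  exact summable_of_sum_le (G.energy_nonneg hab V) (G.sum_energy_le hV hab hM)

/-! ### Test functions of one variable and the fields they generate -/

/-- Smooth functions of `x₃` that vanish for large `|x₃|`. -/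
def testFun : Submodule ℂ (ℝ → ℂ) where
  carrier := {h | ContDiff ℝ ∞ h ∧ ∃ R : ℝ, ∀ t, R < |t| → h t = 0}
  zero_mem' := ⟨contDiff_const, 0, fun _ _ => rfl⟩
  add_mem' := by
    rintro g h ⟨hg, R, hR⟩ ⟨hh, S, hS⟩
    refine ⟨hg.add hh, max R S, fun t ht => ?_⟩
    simp [hR t ((le_max_left _ _).trans_lt ht), hS t ((le_max_right _ _).trans_lt ht)]
  smul_mem' := by
    rintro c h ⟨hh, R, hR⟩
    refine ⟨contDiff_const.smul hh, R, fun t ht => ?_⟩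
    simp [hR t ht]

theorem contDiff_deriv {h : ℝ → ℂ} (hh : ContDiff ℝ ∞ h) : ContDiff ℝ ∞ (deriv h) :=
  (contDiff_infty_iff_deriv.1 hh).2

theorem deriv_mem_testFun {h : ℝ → ℂ} (hh : h ∈ testFun) : deriv h ∈ testFun := by
  obtain ⟨hh, R, hR⟩ := hh
  refine ⟨contDiff_deriv hh, R, fun t ht => ?_⟩
  have h0 : h =ᶠ[𝓝 t] fun _ => 0 := by
    have ho : IsOpen {s : ℝ | R < |s|} := isOpen_lt continuous_const (by fun_prop)
    filter_upwards [ho.mem_nhds ht] with s hs using hR s hs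
  simp [h0.deriv_eq]

/-- The derivative of a test function. -/
def testDeriv : testFun →ₗ[ℂ] testFun where
  toFun h := ⟨deriv h, deriv_mem_testFun h.2⟩
  map_add' g h := Subtype.ext <| funext fun t =>
    deriv_add (g.2.1.differentiable (by simp) t) (h.2.1.differentiable (by simp) t)
  map_smul' c h := Subtype.ext <| funext fun t =>
    deriv_const_smul c (h.2.1.differentiable (by simp) t)

/-- The translate of a test function by `τ` towards `-∞`. -/
def testShift (τ : ℝ) : testFun →ₗ[ℂ] testFun where
  toFun h := ⟨fun t => h.1 (t + τ), by
    obtain ⟨hh, R, hR⟩ := h.2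
    refine ⟨hh.comp (by fun_prop), R + |τ|, fun t ht => hR _ ?_⟩
    have := abs_sub_abs_le_abs_sub t (-τ)
    simp only [abs_neg, sub_neg_eq_add] at this
    linarith⟩
  map_add' _ _ := rfl
  map_smul' _ _ := rfl

/-- The test field `h(x₃) u(x)`. -/
def modeField {u : ℝ × ℝ → Fin 3 → ℂ} (hu : ContDiff ℝ ∞ u) : testFun →ₗ[ℂ] testFields where
  toFun h := ⟨fun x => h.1 x.2 • u x.1, by
    obtain ⟨hh, R, hR⟩ := h.2
    exact ⟨(hh.comp contDiff_snd).smul (hu.comp contDiff_fst), R,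
      fun x hx => by simp [hR x.2 hx]⟩⟩
  map_add' g h := Subtype.ext <| funext fun x => add_smul _ _ _
  map_smul' c h := Subtype.ext <| funext fun x => smul_assoc c (h.1 x.2) (u x.1)

theorem modeField_apply {u : ℝ × ℝ → Fin 3 → ℂ} (hu : ContDiff ℝ ∞ u) (h : testFun)
    (x : (ℝ × ℝ) × ℝ) : (modeField hu h).1 x = h.1 x.2 • u x.1 := rfl

/-- The longitudinal derivative as a linear map. -/
def dzL : testFields →ₗ[ℂ] testFields where
  toFun := dz
  map_add' U V := Subtype.ext <| funext fun x => by
    have hU := U.2.1.differentiable (by simp) x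
    have hV := V.2.1.differentiable (by simp) x
    change fderiv ℝ (U.1 + V.1) x (dir 2) = _
    rw [fderiv_add hU hV]; rfl
  map_smul' c V := Subtype.ext <| funext fun x => by
    have hV := V.2.1.differentiable (by simp) x
    change fderiv ℝ (c • V.1) x (dir 2) = _
    rw [fderiv_const_smul hV]; rfl

theorem pd_two_smul {h : ℝ → ℂ} {u : ℝ × ℝ → Fin 3 → ℂ} (hh : ContDiff ℝ ∞ h)
    (hu : ContDiff ℝ ∞ u) : pd 2 (fun x => h x.2 • u x.1) = fun x => deriv h x.2 • u x.1 := by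
  funext x
  have hc : ContDiff ℝ ∞ fun x : (ℝ × ℝ) × ℝ => h x.2 • u x.1 :=
    (hh.comp contDiff_snd).smul (hu.comp contDiff_fst)
  refine (hasDerivAt_slice hc x.1 x.2).unique ?_
  exact ((hh.differentiable (by simp) x.2).hasDerivAt).smul_const (u x.1)

theorem dzL_modeField {u : ℝ × ℝ → Fin 3 → ℂ} (hu : ContDiff ℝ ∞ u) (h : testFun) :
    dzL (modeField hu h) = modeField hu (testDeriv h) :=
  Subtype.ext (pd_two_smul h.2.1 hu)

/-! ### Mode expansion of test fields -/

/-- The coefficient of a test field with respect to a mode. -/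
def projCoef (p : ModeIdx) (V : testFields) : testFun :=
  ⟨fun t => G.pair (G.Φ p.1.1 p.2) V.1 t / (G.modeNorm p : ℂ) ^ 2, by
    obtain ⟨R, hR⟩ := V.2.2
    refine ⟨(G.contDiff_pair (G.continuous_mode p) V.2.1).div_const _, R, fun t ht => ?_⟩
    simp only [G.pair_eq_zero _ fun x => hR (x, t) ht, zero_div]⟩

/-- The partial sum of the mode expansion of a test field. -/
def proj (F : Finset ModeIdx) (V : testFields) : testFields :=
  ∑ p ∈ F, modeField (G.contDiff_mode p) (G.projCoef p V)

theorem testDeriv_projCoef (p : ModeIdx) (V : testFields) :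
    testDeriv (G.projCoef p V) = G.projCoef p (dzL V) :=
  Subtype.ext <| funext fun t =>
    ((G.hasDerivAt_pair (G.continuous_mode p) V.2.1 t).div_const _).deriv

theorem dzL_proj (F : Finset ModeIdx) (V : testFields) : dzL (G.proj F V) = G.proj F (dzL V) := by
  simp only [proj, map_sum, dzL_modeField, testDeriv_projCoef]

/-- Truncation commutes with ∂₃, so the remainder of the expansion is controlled together with all
its x₃-derivatives. -/
theorem iterate_dz_sub_proj (F : Finset ModeIdx) (V : testFields) (m : ℕ) :
    dz^[m] (V - G.proj F V) = dz^[m] V - G.proj F (dz^[m] V) := by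
  induction m generalizing V with
  | zero => rfl
  | succ m ih =>
    have h : dz (V - G.proj F V) = dz V - G.proj F (dz V) := by
      have := map_sub dzL V (G.proj F V)
      rw [dzL_proj] at this
      exact this
    rw [Function.iterate_succ_apply, Function.iterate_succ_apply, h, ih]

theorem pair_mode_modeField (p q : ModeIdx) (h : testFun) (t : ℝ) :
    G.pair (G.Φ p.1.1 p.2) (modeField (G.contDiff_mode q) h).1 t =
      h.1 t * G.innerΩ (G.Φ p.1.1 p.2) (G.Φ q.1.1 q.2) := by
  simp only [pair, modeField_apply, dotProduct_smul, smul_eq_mul, innerΩ,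
    G.star_mode]
  exact integral_const_mul _ _

theorem cf_proj [DecidableEq ModeIdx] (p : ModeIdx) (F : Finset ModeIdx) (V : testFields) (t : ℝ) :
    G.cf p (G.proj F V).1 t = if p ∈ F then G.cf p V.1 t else 0 := by
  have hsum : G.pair (G.Φ p.1.1 p.2) (G.proj F V).1 t =
      ∑ q ∈ F, G.pair (G.Φ p.1.1 p.2) (modeField (G.contDiff_mode q) (G.projCoef q V)).1 t := by
    simp only [pair, proj, AddSubmonoidClass.coe_finsetSum, Finset.sum_apply, dotProduct_sum]
    exact integral_finsetSum _ fun q _ => G.integrableOn_dotProduct (G.continuous_mode p)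
      (modeField (G.contDiff_mode q) (G.projCoef q V)).2.1.continuous t
  simp only [cf, hsum, pair_mode_modeField]
  have hν := G.modeNorm_ne_zero p
  split_ifs with h
  · rw [Finset.sum_eq_single_of_mem p h fun q _ hq => by
      rw [G.innerΩ_mode_eq_zero hq.symm, mul_zero], innerΩ_mode_self]
    simp only [projCoef]
    field_simp
  · rw [Finset.sum_eq_zero fun q hq => by
      rw [G.innerΩ_mode_eq_zero (fun e => h (by rw [e]; exact hq)), mul_zero], zero_div]

theorem hasSum_ite_notMem {ι : Type*} [DecidableEq ι] {f : ι → ℝ} {S : ℝ} (hf : HasSum f S)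
    (F : Finset ι) : HasSum (fun p => if p ∈ F then 0 else f p) (S - ∑ p ∈ F, f p) := by
  have h1 : HasSum (fun p => if p ∈ F then f p else 0) (∑ p ∈ F, f p) := by
    have := hasSum_sum_of_ne_finset_zero (L := SummationFilter.unconditional ι)
      (f := fun p => if p ∈ F then f p else 0) (s := F)
      fun p hp => if_neg hp
    rwa [Finset.sum_congr rfl fun p hp => if_pos hp] at this
  refine (hf.sub h1).congr_fun fun p => ?_
  split_ifs <;> simp

/-- By Parseval the remainder on a cross-section is the sum of the squared coefficients outside F.
Replacing them by energies gives a tail of a convergent series that is the same for all t. -/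
theorem integral_sub_proj_le (F : Finset ModeIdx) (V : testFields) {R : ℝ} (hR : 0 ≤ R)
    (h0 : ∀ x, x.2 < -R → V.1 x = 0) {t : ℝ} (ht : t ≤ 0) :
    ∫ x in G.Ω, ∑ i, ‖(V - G.proj F V).1 (x, t) i‖ ^ 2 ≤
      (∑' p, G.energy (-R) 0 V.1 p) - ∑ p ∈ F, G.energy (-R) 0 V.1 p := by
  classical
  have h1 := G.hasSum_norm_cf_sq (V - G.proj F V).2.1.continuous t
  have h2 := hasSum_ite_notMem (G.summable_energy V.2.1 (neg_nonpos.2 hR)).hasSum F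
  refine hasSum_le (fun p => ?_) h1 h2
  have h3 : G.cf p (V - G.proj F V).1 t = G.cf p V.1 t - G.cf p (G.proj F V).1 t := by
    have := G.pair_sub_right (G.continuous_mode p) V.2.1.continuous
      (G.proj F V).2.1.continuous t
    simp only [cf, ← sub_div]
    rw [← this]; rfl
  rw [h3, cf_proj]
  split_ifs with h
  · simp
  · rw [sub_zero]
    exact G.norm_cf_sq_le V.2.1 (neg_nonpos.2 hR) (fun x s hs => h0 (x, s) hs) p ht

theorem iterate_dz_eq_zero (V : testFields) {R : ℝ} (h0 : ∀ x, x.2 < -R → V.1 x = 0) (m : ℕ) :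
    ∀ x, x.2 < -R → (dz^[m] V).1 x = 0 := by
  induction m generalizing V with
  | zero => exact h0
  | succ m ih =>
    rw [Function.iterate_succ_apply]
    refine ih (dz V) fun x hx => ?_
    have h : V.1 =ᶠ[𝓝 x] fun _ => 0 := by
      have ho : IsOpen {y : (ℝ × ℝ) × ℝ | y.2 < -R} := isOpen_lt (by fun_prop) continuous_const
      filter_upwards [ho.mem_nhds hx] with y hy using h0 y hy
    simp [dz, pd, h.fderiv_eq]

/-- A generalized field is determined by its coefficients. -/
theorem tendsto_proj {T : testFields →ₗ[ℂ] ℂ} (hT : G.IsCrossSectionL2 T) (V : testFields) :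
    Tendsto (fun F => T (G.proj F V)) atTop (𝓝 (T V)) := by
  obtain ⟨R', hR'⟩ := V.2.2
  obtain ⟨R, hR0, hR⟩ : ∃ R : ℝ, 0 ≤ R ∧ ∀ x, x.2 < -R → V.1 x = 0 :=
    ⟨max R' 0, le_max_right _ _, fun x hx => hR' x (by
      have := le_max_left R' 0
      rw [abs_of_neg (by linarith [le_max_right R' 0])]
      linarith)⟩
  obtain ⟨N, C, hC⟩ := hT R
  -- The energy tail of the m-th x₃-derivative of V.
  let r : ℕ → Finset ModeIdx → ℝ := fun m F =>
    (∑' p, G.energy (-R) 0 (dz^[m] V).1 p) - ∑ p ∈ F, G.energy (-R) 0 (dz^[m] V).1 p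
  have hr0 : ∀ m F, 0 ≤ r m F := fun m F => sub_nonneg.2 <|
    (G.summable_energy (dz^[m] V).2.1 (neg_nonpos.2 hR0)).sum_le_tsum F
      fun p _ => G.energy_nonneg (neg_nonpos.2 hR0) _ p
  have hr : ∀ m, Tendsto (r m) atTop (𝓝 0) := fun m => by
    have := (G.summable_energy (dz^[m] V).2.1 (neg_nonpos.2 hR0)).hasSum
    have h2 := this.const_sub (∑' p, G.energy (-R) 0 (dz^[m] V).1 p)
    rwa [sub_self] at h2
  -- The continuity estimate of T is used with M² equal to the sum of the tails for m ≤ N, which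
  -- dominates each of them.
  have hbound : ∀ F, ‖T V - T (G.proj F V)‖ ≤ C * √(∑ m ∈ Finset.range (N + 1), r m F) := by
    intro F
    rw [← map_sub]
    refine hC _ (fun x hx => ?_) _ (Real.sqrt_nonneg _) fun m hm t ht => ?_
    · have : (G.proj F V).1 x = 0 := by
        simp only [proj, AddSubmonoidClass.coe_finsetSum, Finset.sum_apply]
        refine Finset.sum_eq_zero fun p _ => ?_
        have : (G.projCoef p V).1 x.2 = 0 := by
          simp only [projCoef]
          rw [G.pair_eq_zero _ fun y => hR (y, x.2) hx, zero_div]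
        rw [modeField_apply, this, zero_smul]
      change V.1 x - (G.proj F V).1 x = 0
      rw [hR x hx, this, sub_zero]
    · rw [Real.sq_sqrt (Finset.sum_nonneg fun m _ => hr0 m F), iterate_dz_sub_proj]
      refine (G.integral_sub_proj_le F _ hR0 (iterate_dz_eq_zero V hR m) ht.le).trans ?_
      exact Finset.single_le_sum (f := fun m => r m F) (fun m _ => hr0 m F)
        (Finset.mem_range.2 (Nat.lt_succ_of_le hm))
  have hlim : Tendsto (fun F => C * √(∑ m ∈ Finset.range (N + 1), r m F)) atTop (𝓝 0) := by
    have h1 : Tendsto (fun F => ∑ m ∈ Finset.range (N + 1), r m F) atTop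
      (𝓝 (∑ m ∈ Finset.range (N + 1), (0 : ℝ))) := tendsto_finsetSum _ fun m _ => hr m
    simp only [Finset.sum_const_zero] at h1
    have h2 := (h1.sqrt).const_mul C
    simpa using h2
  rw [tendsto_iff_norm_sub_tendsto_zero]
  refine squeeze_zero (fun _ => norm_nonneg _) (fun F => ?_) hlim
  rw [norm_sub_rev]
  exact hbound F

/-! ### Uniqueness for the ordinary differential equation of a mode -/

theorem setIntegral_Iio_eq {E : Type*} [NormedAddCommGroup E] [NormedSpace ℝ E] {f : ℝ → E}
    {a b : ℝ} (hab : a ≤ b) (h : ∀ t ≤ a, f t = 0) : ∫ t in Iio b, f t = ∫ t in a..b, f t := by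
  rw [intervalIntegral.integral_of_le hab, integral_Ioc_eq_integral_Ioo]
  refine setIntegral_eq_of_subset_of_forall_sdiff_eq_zero measurableSet_Iio Ioo_subset_Iio_self ?_
  intro t ht
  refine h t ?_
  by_contra hta
  exact ht.2 ⟨not_le.1 hta, ht.1⟩

theorem testFun_exists_bound (h : testFun) : ∃ a < 0, ∀ t ≤ a, h.1 t = 0 := by
  obtain ⟨R, hR⟩ := h.2.2
  refine ⟨-(|R| + 1), by have := abs_nonneg R; linarith, fun t ht => hR t ?_⟩
  have := le_abs_self R
  have := neg_le_abs t
  linarith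

theorem hasDerivAt_cexp_mul (c : ℂ) (t : ℝ) :
    HasDerivAt (fun t : ℝ => Complex.exp (c * t)) (c * Complex.exp (c * t)) t := by
  have h1 : HasDerivAt (fun t : ℝ => c * (t : ℂ)) c t := by
    simpa using (Complex.ofRealCLM.hasDerivAt (x := t)).const_mul c
  simpa [mul_comm] using h1.cexp

theorem contDiff_cexp_mul (c : ℂ) : ContDiff ℝ ∞ fun t : ℝ => Complex.exp (c * t) :=
  (contDiff_const.mul Complex.ofRealCLM.contDiff).cexp

theorem contDiff_primitive {f : ℝ → ℂ} (hf : ContDiff ℝ ∞ f) (a : ℝ) :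
    ContDiff ℝ ∞ fun t => ∫ s in a..t, f s := by
  have hd : ∀ t, HasDerivAt (fun t => ∫ s in a..t, f s) (f t) t := fun t =>
    intervalIntegral.integral_hasDerivAt_right (hf.continuous.intervalIntegrable _ _)
      hf.continuous.aestronglyMeasurable.stronglyMeasurableAtFilter hf.continuous.continuousAt
  rw [contDiff_infty_iff_deriv]
  refine ⟨fun t => (hd t).differentiableAt, ?_⟩
  rw [show deriv (fun t => ∫ s in a..t, f s) = f from funext fun t => (hd t).deriv]
  exact hf

/-- The solution of `h'' + β² h = f` that vanishes for `t ≤ a`. -/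
def duhamel (β : ℂ) (f : ℝ → ℂ) (a t : ℝ) : ℂ :=
  (2 * Complex.I * β)⁻¹ *
    (Complex.exp (Complex.I * β * t) * (∫ s in a..t, Complex.exp (-(Complex.I * β) * s) * f s) -
      Complex.exp (-(Complex.I * β) * t) * ∫ s in a..t, Complex.exp (Complex.I * β * s) * f s)

theorem contDiff_duhamel (β : ℂ) {f : ℝ → ℂ} (hf : ContDiff ℝ ∞ f) (a : ℝ) :
    ContDiff ℝ ∞ (duhamel β f a) := by
  have h1 := contDiff_primitive ((contDiff_cexp_mul (-(Complex.I * β))).mul hf) a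
  have h2 := contDiff_primitive ((contDiff_cexp_mul (Complex.I * β)).mul hf) a
  exact contDiff_const.mul (((contDiff_cexp_mul _).mul h1).sub ((contDiff_cexp_mul _).mul h2))

/-- Variation of constants: the first differentiation produces no term in f, since the two
exponentials are inverse to each other and their contributions cancel; the second produces f. -/
theorem deriv_deriv_duhamel {β : ℂ} (hβ : β ≠ 0) {f : ℝ → ℂ} (hf : ContDiff ℝ ∞ f) (a t : ℝ) :
    deriv (deriv (duhamel β f a)) t + β ^ 2 * duhamel β f a t = f t := by
  have hP : ∀ (c : ℂ) (t : ℝ), HasDerivAt (fun t => ∫ s in a..t, Complex.exp (c * s) * f s)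
      (Complex.exp (c * t) * f t) t := fun c t => by
    have hc : Continuous fun s : ℝ => Complex.exp (c * s) * f s :=
      (contDiff_cexp_mul c).continuous.mul hf.continuous
    exact intervalIntegral.integral_hasDerivAt_right (hc.intervalIntegrable _ _)
      hc.aestronglyMeasurable.stronglyMeasurableAtFilter hc.continuousAt
  have hexp : ∀ t : ℝ, Complex.exp (Complex.I * β * t) * Complex.exp (-(Complex.I * β) * t) = 1 :=
    fun t => by rw [← Complex.exp_add]; simp
  have hI := Complex.I_ne_zero
  have d1 : ∀ t : ℝ, HasDerivAt (duhamel β f a) ((2 : ℂ)⁻¹ *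
      (Complex.exp (Complex.I * β * t) * (∫ s in a..t, Complex.exp (-(Complex.I * β) * s) * f s) +
      Complex.exp (-(Complex.I * β) * t) *
        ∫ s in a..t, Complex.exp (Complex.I * β * s) * f s)) t := fun t => by
    have h := ((((hasDerivAt_cexp_mul (Complex.I * β) t).mul (hP (-(Complex.I * β)) t)).sub
      ((hasDerivAt_cexp_mul (-(Complex.I * β)) t).mul (hP (Complex.I * β) t))).const_mul
        (2 * Complex.I * β)⁻¹)
    refine h.congr_deriv ?_
    field_simp
    ring
  have d2 : deriv (duhamel β f a) = fun t : ℝ => (2 : ℂ)⁻¹ *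
      (Complex.exp (Complex.I * β * t) * (∫ s in a..t, Complex.exp (-(Complex.I * β) * s) * f s) +
      Complex.exp (-(Complex.I * β) * t) *
        ∫ s in a..t, Complex.exp (Complex.I * β * s) * f s) := funext fun t => (d1 t).deriv
  rw [d2]
  have h := ((((hasDerivAt_cexp_mul (Complex.I * β) t).mul (hP (-(Complex.I * β)) t)).add
      ((hasDerivAt_cexp_mul (-(Complex.I * β)) t).mul (hP (Complex.I * β) t))).const_mul (2 : ℂ)⁻¹)
  refine (congrArg (· + β ^ 2 * duhamel β f a t) h.deriv).trans ?_
  rw [duhamel]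
  have e := hexp t
  generalize Complex.exp (Complex.I * β * t) = X at e ⊢
  generalize Complex.exp (-(Complex.I * β) * t) = Y at e ⊢
  generalize (∫ s in a..t, Complex.exp (-(Complex.I * β) * s) * f s) = P
  generalize (∫ s in a..t, Complex.exp (Complex.I * β * s) * f s) = Q
  have hI2 : Complex.I ^ 2 = -1 := Complex.I_sq
  field_simp
  linear_combination (2 * Complex.I * f t) * e + (β * X * P - β * Y * Q) * hI2

theorem duhamel_eq_zero (β : ℂ) {f : ℝ → ℂ} {a t : ℝ} (h0 : ∀ s ≤ a, f s = 0) (ht : t ≤ a) :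
    duhamel β f a t = 0 := by
  have h : ∀ c : ℂ, ∫ s in a..t, Complex.exp (c * s) * f s = 0 := fun c => by
    rw [intervalIntegral.integral_symm, intervalIntegral.integral_of_le ht]
    rw [setIntegral_eq_zero_of_forall_eq_zero fun s hs => by rw [h0 s hs.2, mul_zero], neg_zero]
  rw [duhamel, h, h, mul_zero, mul_zero, sub_zero, mul_zero]

/-- The coefficient of the non-solvable part of `h'' + β² h = f`, `h(0) = 0`. -/
def defect (β : ℂ) (f : ℝ → ℂ) : ℂ :=
  ∫ s in Iio (0 : ℝ), (Complex.exp (-(Complex.I * β) * s) - Complex.exp (Complex.I * β * s)) * f s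

/-- The value at 0 of Duhamel's solution is the defect divided by 2iβ. If the defect is zero, this
solution is an admissible h, up to a cutoff at positive t that g does not see. -/
theorem functional_eq_zero_of_defect {g : testFun →ₗ[ℂ] ℂ} {β : ℂ} (hβ : β ≠ 0)
    (hloc : ∀ h : testFun, (∀ t < 0, h.1 t = 0) → g h = 0)
    (heq : ∀ h : testFun, h.1 0 = 0 → g (testDeriv (testDeriv h) + β ^ 2 • h) = 0)
    (f : testFun) (hf : defect β f.1 = 0) : g f = 0 := by
  obtain ⟨a, ha, h0⟩ := testFun_exists_bound f
  have hdc := contDiff_duhamel β f.2.1 a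
  -- The cutoff equals 1 for t ≤ 1 and 0 for t ≥ 2. Thus h satisfies the differential equation and
  -- has Duhamel's value at 0 on a full neighbourhood of t ≤ 0.
  let h : testFun := ⟨fun t => (Real.smoothTransition (2 - t) : ℂ) * duhamel β f.1 a t, by
    refine ⟨(Complex.ofRealCLM.contDiff.comp
      (Real.smoothTransition.contDiff.comp (contDiff_const.sub contDiff_id))).mul hdc,
      max 2 (-a), fun t ht => ?_⟩
    have h2 : 2 < |t| := (le_max_left _ _).trans_lt ht
    have h3 : -a < |t| := (le_max_right _ _).trans_lt ht
    change (Real.smoothTransition (2 - t) : ℂ) * duhamel β f.1 a t = 0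
    rcases le_total 0 t with hp | hn
    · rw [abs_of_nonneg hp] at h2
      rw [Real.smoothTransition.zero_of_nonpos (by linarith)]; simp
    · rw [abs_of_nonpos hn] at h3
      rw [duhamel_eq_zero β h0 (by linarith), mul_zero]⟩
  have hev : ∀ t < (1 : ℝ), h.1 =ᶠ[𝓝 t] duhamel β f.1 a := fun t ht => by
    filter_upwards [Iio_mem_nhds ht] with s hs
    have hs' : s < 1 := hs
    simp only [h]
    rw [Real.smoothTransition.one_of_one_le (by linarith)]
    simp
  have hh0 : h.1 0 = 0 := by
    rw [(hev 0 one_pos).eq_of_nhds]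
    have hi : ∀ c : ℂ, IntervalIntegrable (fun s : ℝ => Complex.exp (c * s) * f.1 s) volume a 0 :=
      fun c => ((contDiff_cexp_mul c).continuous.mul f.2.1.continuous).intervalIntegrable _ _
    rw [defect, setIntegral_Iio_eq ha.le fun s hs => by rw [h0 s hs, mul_zero]] at hf
    simp only [sub_mul] at hf
    rw [intervalIntegral.integral_sub (hi _) (hi _)] at hf
    rw [duhamel, Complex.ofReal_zero, mul_zero, mul_zero, Complex.exp_zero, one_mul, one_mul, hf,
      mul_zero]
  have h1 := heq h hh0
  have h2 : g (f - (testDeriv (testDeriv h) + β ^ 2 • h)) = 0 := by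
    refine hloc _ fun t ht => ?_
    have e1 : deriv (deriv h.1) t = deriv (deriv (duhamel β f.1 a)) t :=
      (hev t (by linarith)).deriv.deriv_eq
    have e2 : h.1 t = duhamel β f.1 a t := (hev t (by linarith)).eq_of_nhds
    change f.1 t - (deriv (deriv h.1) t + β ^ 2 * h.1 t) = 0
    rw [e1, e2, deriv_deriv_duhamel hβ f.2.1, sub_self]
  rw [map_sub, h1, sub_zero] at h2
  exact h2

/-! ### The radiation condition tested on a cut-off wave -/

/-- A smooth bump supported in `(-2, -1)`. -/
def leftBump : ContDiffBump (-3 / 2 : ℝ) := ⟨1 / 4, 1 / 2, by norm_num, by norm_num⟩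

theorem leftBump_eq_zero {s : ℝ} (h : s ≤ -2 ∨ -1 ≤ s) : leftBump s = 0 := by
  refine leftBump.zero_of_le_dist ?_
  change (1 / 2 : ℝ) ≤ _
  rw [Real.dist_eq]
  rcases h with h | h
  · rw [abs_of_nonpos (by linarith)]; linarith
  · rw [abs_of_nonneg (by linarith)]; linarith

/-- The incoming wave `exp(-iβs)`, cut off. -/
def cutWave (β : ℂ) : testFun :=
  ⟨fun s => Complex.exp (-(Complex.I * β) * s) * (leftBump s : ℂ), by
    refine ⟨(contDiff_cexp_mul _).mul (Complex.ofRealCLM.contDiff.comp leftBump.contDiff), 2,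
      fun s hs => ?_⟩
    change Complex.exp (-(Complex.I * β) * s) * (leftBump s : ℂ) = 0
    rw [leftBump_eq_zero]
    · simp
    · rcases lt_abs.1 hs with h | h
      · right; linarith
      · left; linarith⟩

theorem cutWave_eq_zero (β : ℂ) {s : ℝ} (h : s ≤ -2 ∨ -1 ≤ s) : (cutWave β).1 s = 0 := by
  change Complex.exp (-(Complex.I * β) * s) * (leftBump s : ℂ) = 0
  rw [leftBump_eq_zero h, Complex.ofReal_zero, mul_zero]

theorem integral_leftBump_pos : 0 < ∫ s, leftBump s := leftBump.integral_pos

/-- The operator h ↦ -h' + iβh is the transpose of g ↦ g' + iβg, which annihilates exp(-iβs) and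
maps exp(iβs) to 2iβ exp(iβs). Only the second half of the standing wave survives, and its product
with the translated cut-off wave is exp(-iβτ) times the translated bump. -/
theorem defect_testShift_cutWave (β : ℂ) {τ : ℝ} (hτ : 0 ≤ τ) :
    defect β (testShift τ (-testDeriv (cutWave β) + (Complex.I * β) • cutWave β)).1 =
      -(2 * Complex.I * β) * Complex.exp (-(Complex.I * β) * τ) * ((∫ s, leftBump s : ℝ) : ℂ) := by
  set H : testFun := testShift τ (cutWave β)
  have hH : ∀ s, s ≤ -2 - τ ∨ -1 - τ ≤ s → H.1 s = 0 := fun s hs =>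
    cutWave_eq_zero β (by rcases hs with h | h <;> [left; right] <;> linarith)
  have hHd : ∀ s, HasDerivAt H.1 (deriv H.1 s) s := fun s =>
    (H.2.1.differentiable (by simp) s).hasDerivAt
  have hH' : ∀ s, (testShift τ (-testDeriv (cutWave β) + (Complex.I * β) • cutWave β)).1 s =
      -deriv H.1 s + Complex.I * β * H.1 s := fun s => by
    have : deriv H.1 s = deriv (cutWave β).1 (s + τ) := by
      change deriv (fun s => (cutWave β).1 (s + τ)) s = _
      rw [deriv_comp_add_const]
    rw [this]; rfl
  -- The translated wave vanishes for s ≤ -2 - τ; one unit further down the vanishing of its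
  -- derivative is immediate as well.
  have ha : (-3 - τ : ℝ) ≤ 0 := by linarith
  have hH'0 : ∀ s ≤ -3 - τ, deriv H.1 s = 0 := fun s hs => by
    have : H.1 =ᶠ[𝓝 s] fun _ => 0 := by
      filter_upwards [Iio_mem_nhds (show s < -2 - τ by linarith)] with r hr
      exact hH r (Or.inl (le_of_lt hr))
    simp [this.deriv_eq]
  rw [defect, setIntegral_Iio_eq ha fun s hs => by
    rw [hH', hH'0 s hs, hH s (Or.inl (by linarith))]; simp]
  let E : ℝ → ℂ := fun s => Complex.exp (-(Complex.I * β) * s) - Complex.exp (Complex.I * β * s)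
  have hE : ∀ s : ℝ, HasDerivAt E (-(Complex.I * β) * Complex.exp (-(Complex.I * β) * s) -
      Complex.I * β * Complex.exp (Complex.I * β * s)) s := fun s =>
    (hasDerivAt_cexp_mul _ s).sub (hasDerivAt_cexp_mul _ s)
  -- Integration by parts with E' + iβE = -2iβ exp(iβs).
  have hd : ∀ s : ℝ, HasDerivAt (fun s => -(E s * H.1 s)) (E s * (-deriv H.1 s + Complex.I * β * H.1 s) -
      -(2 * Complex.I * β) * (Complex.exp (Complex.I * β * s) * H.1 s)) s := fun s => by
    refine (((hE s).mul (hHd s)).neg).congr_deriv ?_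
    simp only [E]
    ring
  have hcE : Continuous E := ((contDiff_cexp_mul _).sub (contDiff_cexp_mul _)).continuous
  have hcH := H.2.1.continuous
  have hcH' := (contDiff_deriv H.2.1).continuous
  have hcX := (contDiff_cexp_mul (Complex.I * β)).continuous
  have c1 : Continuous fun s => E s * (-deriv H.1 s + Complex.I * β * H.1 s) := by fun_prop
  have c2 : Continuous fun s : ℝ => -(2 * Complex.I * β) * (Complex.exp (Complex.I * β * s) * H.1 s)
    := continuous_const.mul (hcX.mul hcH)
  have h1 := intervalIntegral.integral_eq_sub_of_hasDerivAt (a := -3 - τ) (b := 0)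
    (fun s _ => hd s) ((c1.sub c2).intervalIntegrable _ _)
  rw [intervalIntegral.integral_sub (c1.intervalIntegrable _ _) (c2.intervalIntegrable _ _),
    hH 0 (Or.inr (by linarith)), hH (-3 - τ) (Or.inl (by linarith)), mul_zero, mul_zero, sub_self,
    intervalIntegral.integral_const_mul] at h1
  have h2 : ∫ s in (-3 - τ)..0, Complex.exp (Complex.I * β * s) * H.1 s =
      Complex.exp (-(Complex.I * β) * τ) * ((∫ s, leftBump s : ℝ) : ℂ) := by
    have e : ∀ s : ℝ, Complex.exp (Complex.I * β * s) * H.1 s =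
        Complex.exp (-(Complex.I * β) * τ) * ((leftBump (s + τ) : ℝ) : ℂ) := fun s => by
      have : H.1 s = Complex.exp (-(Complex.I * β) * (s + τ : ℝ)) * ((leftBump (s + τ) : ℝ) : ℂ) :=
        rfl
      rw [this, ← mul_assoc, ← Complex.exp_add]
      congr 2
      push_cast
      ring
    simp only [e]
    rw [intervalIntegral.integral_const_mul, intervalIntegral.integral_ofReal]
    congr 2
    rw [intervalIntegral.integral_comp_add_right fun s => leftBump s,
      intervalIntegral.integral_of_le (by linarith)]
    refine setIntegral_eq_integral_of_forall_compl_eq_zero fun s hs => leftBump_eq_zero ?_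
    by_contra! hc
    exact hs ⟨by linarith [hc.1], by linarith [hc.2]⟩
  simp only [hH']
  rw [sub_eq_zero.1 (h1.trans (by simp)), h2]
  ring

theorem defect_add_smul (β c : ℂ) (f g : testFun) :
    defect β (f + c • g).1 = defect β f.1 + c * defect β g.1 := by
  obtain ⟨a, ha, h0⟩ := testFun_exists_bound f
  obtain ⟨b, hb, h1⟩ := testFun_exists_bound g
  have hm : min a b ≤ 0 := (min_le_left _ _).trans ha.le
  have f0 : ∀ t ≤ min a b, f.1 t = 0 := fun t ht => h0 t (ht.trans (min_le_left _ _))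
  have g0 : ∀ t ≤ min a b, g.1 t = 0 := fun t ht => h1 t (ht.trans (min_le_right _ _))
  have e : ∀ t, (f + c • g).1 t = f.1 t + c * g.1 t := fun t => rfl
  have hE : Continuous fun s : ℝ => Complex.exp (-(Complex.I * β) * s) -
    Complex.exp (Complex.I * β * s) := ((contDiff_cexp_mul _).sub (contDiff_cexp_mul _)).continuous
  rw [defect, defect, defect, setIntegral_Iio_eq hm fun t ht => by rw [e, f0 t ht, g0 t ht]; simp,
    setIntegral_Iio_eq hm fun t ht => by rw [f0 t ht]; simp,
    setIntegral_Iio_eq hm fun t ht => by rw [g0 t ht]; simp,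
    ← intervalIntegral.integral_const_mul, ← intervalIntegral.integral_add]
  · congr 1; funext t
    rw [e]; ring
  · exact (hE.mul f.2.1.continuous).intervalIntegrable _ _
  · exact (continuous_const.mul (hE.mul g.2.1.continuous)).intervalIntegrable _ _

/-- A functional on test functions that satisfies the homogeneous equation, the Dirichlet condition
and the radiation condition vanishes. -/
theorem functional_eq_zero {g : testFun →ₗ[ℂ] ℂ} {β : ℂ} (hβ : β ≠ 0)
    (hloc : ∀ h : testFun, (∀ t < 0, h.1 t = 0) → g h = 0)
    (heq : ∀ h : testFun, h.1 0 = 0 → g (testDeriv (testDeriv h) + β ^ 2 • h) = 0)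
    (hlim : ∀ h : testFun, Tendsto (fun τ : ℝ => Complex.exp (Complex.I * β * τ) *
      g (testShift τ (-testDeriv h + (Complex.I * β) • h))) atTop (𝓝 0)) (f : testFun) :
    g f = 0 := by
  set B : ℂ := ((∫ s, leftBump s : ℝ) : ℂ)
  have hB : B ≠ 0 := by
    have := integral_leftBump_pos.ne'
    simp only [B]
    exact_mod_cast this
  set f0 : testFun := -testDeriv (cutWave β) + (Complex.I * β) • cutWave β
  have h2 : 2 * Complex.I * β ≠ 0 := mul_ne_zero (mul_ne_zero two_ne_zero Complex.I_ne_zero) hβ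
  -- With this c, adding c exp(iβτ) times the translate of f0 by τ to f gives defect zero for every
  -- τ ≥ 0, because the factor exp(-iβτ) in the defect of the translate cancels. So g f is expressed
  -- by g on arbitrarily distant translates.
  set c : ℂ := defect β f.1 / (2 * Complex.I * β * B)
  have hg : ∀ τ : ℝ, 0 ≤ τ →
      g f = -c * (Complex.exp (Complex.I * β * τ) * g (testShift τ f0)) := fun τ hτ => by
    have hd : defect β (f + (c * Complex.exp (Complex.I * β * τ)) • testShift τ f0).1 = 0 := by
      rw [defect_add_smul, defect_testShift_cutWave β hτ]
      have hexp : Complex.exp (Complex.I * β * τ) * Complex.exp (-(Complex.I * β) * τ) = 1 := by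
        rw [← Complex.exp_add]; simp
      have hc : c * (2 * Complex.I * β * B) = defect β f.1 :=
        div_mul_cancel₀ _ (mul_ne_zero h2 hB)
      linear_combination (-(2 * Complex.I * β * B) * c) * hexp - hc
    have h3 := functional_eq_zero_of_defect hβ hloc heq _ hd
    rw [map_add, map_smul, smul_eq_mul] at h3
    linear_combination h3
  have hl := (hlim (cutWave β)).const_mul (-c)
  rw [mul_zero] at hl
  refine tendsto_nhds_unique (tendsto_const_nhds.congr' ?_) hl
  filter_upwards [eventually_ge_atTop 0] with τ hτ using hg τ hτ

/-! ### The longitudinal wavenumbers -/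

theorem k_pos : 0 < G.k := by
  have := G.freq_pos; have := G.eps_pos; have := G.mu_pos
  unfold k; positivity

theorem β_sq (n : ℕ × ℕ) : G.β n ^ 2 = (G.k : ℂ) ^ 2 - G.eig n := by
  unfold β
  split_ifs with h
  · have := Real.sq_sqrt (sub_nonneg.2 h)
    rw [← Complex.ofReal_pow, this]; push_cast; ring
  · have := Real.sq_sqrt (sub_nonneg.2 (le_of_not_ge h))
    rw [mul_pow, Complex.I_sq, ← Complex.ofReal_pow, this]; push_cast; ring

theorem β_of_lt {n : ℕ × ℕ} (h : G.eig n < G.k ^ 2) : (G.β n).im = 0 ∧ 0 < (G.β n).re := by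
  rw [β, if_pos h.le]
  exact ⟨Complex.ofReal_im _, by simpa using h⟩

theorem β_of_gt {n : ℕ × ℕ} (h : G.k ^ 2 < G.eig n) : (G.β n).re = 0 ∧ 0 < (G.β n).im := by
  rw [β, if_neg h.not_ge]
  simpa using h

theorem β_im_nonneg (n : ℕ × ℕ) : 0 ≤ (G.β n).im := by
  unfold β
  split_ifs <;> simp

theorem β_ne_zero {n : ℕ × ℕ} (h : G.eig n ≠ G.k ^ 2) : G.β n ≠ 0 := by
  intro h0
  have := G.β_sq n
  rw [h0] at this
  refine h ?_
  have h2 : ((G.k ^ 2 - G.eig n : ℝ) : ℂ) = 0 := by push_cast; rw [← this]; simp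
  linarith [Complex.ofReal_eq_zero.1 h2]

theorem norm_cexp_I_β (n : ℕ × ℕ) (t : ℝ) :
    ‖Complex.exp (Complex.I * G.β n * t)‖ = Real.exp (-((G.β n).im * t)) := by
  rw [Complex.norm_exp]
  congr 1
  simp

/-! ### The curl of test fields with separated variables -/

theorem pd_transverse_smul {h : ℝ → ℂ} {u : ℝ × ℝ → Fin 3 → ℂ} (hh : ContDiff ℝ ∞ h)
    (hu : ContDiff ℝ ∞ u) (e : ℝ × ℝ) (x : (ℝ × ℝ) × ℝ) (i : Fin 3) :
    fderiv ℝ (fun x : (ℝ × ℝ) × ℝ => h x.2 • u x.1) x (e, 0) i = h x.2 * pd2 e u x.1 i := by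
  have hc : ContDiff ℝ ∞ fun x : (ℝ × ℝ) × ℝ => h x.2 • u x.1 :=
    (hh.comp contDiff_snd).smul (hu.comp contDiff_fst)
  have h1 := fderiv_slice hc x.2 x.1 e i
  have hd := hu.differentiable (by simp) x.1
  have hi : DifferentiableAt ℝ (fun y => u y i) x.1 := by fun_prop
  simp only [Pi.smul_apply, smul_eq_mul, fderiv_const_mul hi] at h1
  rw [← h1, pd2_apply hd]
  rfl

/-- The gradient splits into its transverse part and e₃∂₃; the sign of the second term comes from e₃
× u = -u × e₃. -/
theorem curl_smul {h : ℝ → ℂ} {u : ℝ × ℝ → Fin 3 → ℂ} (hh : ContDiff ℝ ∞ h)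
    (hu : ContDiff ℝ ∞ u) : curl (fun x => h x.2 • u x.1) =
      fun x => h x.2 • rot u x.1 - deriv h x.2 • crossAxis u x.1 := by
  have h0 : ∀ x i, pd 0 (fun x : (ℝ × ℝ) × ℝ => h x.2 • u x.1) x i =
      h x.2 * pd2 (1, 0) u x.1 i := pd_transverse_smul hh hu (1, 0)
  have h1 : ∀ x i, pd 1 (fun x : (ℝ × ℝ) × ℝ => h x.2 • u x.1) x i =
      h x.2 * pd2 (0, 1) u x.1 i := pd_transverse_smul hh hu (0, 1)
  funext x i
  fin_cases i <;> simp [curl, h0, h1, pd_two_smul hh hu, rot, crossAxis]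
  · ring
  · ring

/-- The curl as a linear map. -/
def curlL : testFields →ₗ[ℂ] testFields where
  toFun := curlT
  map_add' U V := Subtype.ext <| funext fun x => by
    have hp : ∀ j, pd j (U.1 + V.1) x = pd j U.1 x + pd j V.1 x := fun j => by
      simp only [pd]
      rw [fderiv_add (U.2.1.differentiable (by simp) x) (V.2.1.differentiable (by simp) x)]; rfl
    change curl (U.1 + V.1) x = curl U.1 x + curl V.1 x
    funext i
    fin_cases i <;> simp [curl, hp] <;> ring
  map_smul' c V := Subtype.ext <| funext fun x => by
    have hp : ∀ j, pd j (c • V.1) x = c • pd j V.1 x := fun j => by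
      simp only [pd]
      rw [fderiv_const_smul (V.2.1.differentiable (by simp) x)]; rfl
    change curl (c • V.1) x = c • curl V.1 x
    funext i
    fin_cases i <;> simp [curl, hp] <;> ring

theorem curlL_modeField {u : ℝ × ℝ → Fin 3 → ℂ} (hu : ContDiff ℝ ∞ u) (h : testFun) :
    curlL (modeField hu h) =
      modeField (contDiff_rot hu) h - modeField (contDiff_crossAxis hu) (testDeriv h) :=
  Subtype.ext (curl_smul h.2.1 hu)

theorem curlL_curlL_modeField {u : ℝ × ℝ → Fin 3 → ℂ} (hu : ContDiff ℝ ∞ u) (h : testFun) :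
    curlL (curlL (modeField hu h)) =
      modeField (contDiff_rot (contDiff_rot hu)) h -
        modeField (contDiff_crossAxis (contDiff_rot hu)) (testDeriv h) -
      (modeField (contDiff_rot (contDiff_crossAxis hu)) (testDeriv h) -
        modeField (contDiff_crossAxis (contDiff_crossAxis hu)) (testDeriv (testDeriv h))) := by
  rw [curlL_modeField, map_sub, curlL_modeField, curlL_modeField]

theorem modeField_eq_of_smul {u v : ℝ × ℝ → Fin 3 → ℂ} (hu : ContDiff ℝ ∞ u)
    (hv : ContDiff ℝ ∞ v) {c : ℂ} (h : u = c • v) (f : testFun) :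
    modeField hu f = c • modeField hv f := by
  subst h
  refine Subtype.ext (funext fun x => ?_)
  change f.1 x.2 • c • v x.1 = c • f.1 x.2 • v x.1
  rw [smul_comm]

theorem modeField_eq_zero {u : ℝ × ℝ → Fin 3 → ℂ} (hu : ContDiff ℝ ∞ u) (h : u = 0) (f : testFun) :
    modeField hu f = 0 := by
  subst h
  exact Subtype.ext (funext fun x => smul_zero _)

theorem modeField_eq_neg {u v : ℝ × ℝ → Fin 3 → ℂ} (hu : ContDiff ℝ ∞ u)
    (hv : ContDiff ℝ ∞ v) (h : u = -v) (f : testFun) :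
    modeField hu f = -modeField hv f := by
  subst h
  exact Subtype.ext (funext fun x => smul_neg _ _)

/-- te is divergence free, so it is mapped to itself and its coefficient obeys a scalar equation.
The analogous formulas for tm and lo involve both families and give a 2 × 2 system. -/
theorem curlL_curlL_te (p q : ℝ) (h : testFun) :
    curlL (curlL (modeField (contDiff_te p q) h)) =
      modeField (contDiff_te p q) ((p ^ 2 + q ^ 2 : ℂ) • h - testDeriv (testDeriv h)) := by
  rw [curlL_curlL_modeField, modeField_eq_of_smul _ (contDiff_te p q) (rot_rot_te p q),
    modeField_eq_zero _ (crossAxis_rot_te p q), modeField_eq_zero _ (rot_crossAxis_te p q),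
    modeField_eq_neg _ (contDiff_te p q) (crossAxis_crossAxis_te p q), map_sub, map_smul]
  abel

theorem curlL_curlL_tm (p q : ℝ) (h : testFun) :
    curlL (curlL (modeField (contDiff_tm p q) h)) =
      -modeField (contDiff_tm p q) (testDeriv (testDeriv h)) -
        (p ^ 2 + q ^ 2 : ℂ) • modeField (contDiff_lo p q) (testDeriv h) := by
  have h0 : rot (rot (tm p q)) = 0 := by
    rw [rot_tm]; funext x i; fin_cases i <;> simp [rot, pd2]
  have h1 : crossAxis (rot (tm p q)) = 0 := by
    rw [rot_tm]; funext x i; fin_cases i <;> simp [crossAxis]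
  rw [curlL_curlL_modeField, modeField_eq_zero _ h0, modeField_eq_zero _ h1,
    modeField_eq_of_smul _ (contDiff_lo p q) (rot_crossAxis_tm p q),
    modeField_eq_neg _ (contDiff_tm p q) (crossAxis_crossAxis_tm p q)]
  abel

theorem rot_rot_lo (p q : ℝ) : rot (rot (lo p q)) = (p ^ 2 + q ^ 2 : ℂ) • lo p q := by
  rw [rot_lo, rot_crossAxis_tm]

theorem crossAxis_rot_lo (p q : ℝ) : crossAxis (rot (lo p q)) = -tm p q := by
  rw [rot_lo, crossAxis_crossAxis_tm]

theorem rot_crossAxis_lo (p q : ℝ) : rot (crossAxis (lo p q)) = 0 := by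
  rw [crossAxis_lo]; funext x i; fin_cases i <;> simp [rot, pd2]

theorem crossAxis_crossAxis_lo (p q : ℝ) : crossAxis (crossAxis (lo p q)) = 0 := by
  rw [crossAxis_lo]; funext x i; fin_cases i <;> simp [crossAxis]

theorem curlL_curlL_lo (p q : ℝ) (h : testFun) :
    curlL (curlL (modeField (contDiff_lo p q) h)) =
      (p ^ 2 + q ^ 2 : ℂ) • modeField (contDiff_lo p q) h +
        modeField (contDiff_tm p q) (testDeriv h) := by
  rw [curlL_curlL_modeField, modeField_eq_of_smul _ (contDiff_lo p q) (rot_rot_lo p q),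
    modeField_eq_neg _ (contDiff_tm p q) (crossAxis_rot_lo p q),
    modeField_eq_zero _ (rot_crossAxis_lo p q), modeField_eq_zero _ (crossAxis_crossAxis_lo p q)]
  abel

/-- At the end wall only the transverse components matter. Longitudinal test fields are therefore
admissible for every h, without h(0) = 0, and this freedom allows the elimination of the
longitudinal coefficient. -/
theorem tangentialZero_modeField {u : ℝ × ℝ → Fin 3 → ℂ} (hu : ContDiff ℝ ∞ u)
    (hw : G.WallZero u) {h : testFun} (h0 : h.1 0 = 0 ∨ ∀ x, u x 0 = 0 ∧ u x 1 = 0) :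
    G.TangentialZero (modeField hu h).1 := by
  rintro x ν ⟨-, hx⟩
  rw [modeField_apply]
  rcases hx with ⟨hx, rfl⟩ | ⟨hx, rfl⟩ | ⟨hx, rfl⟩ | ⟨hx, rfl⟩ | ⟨hx, rfl⟩
  · obtain ⟨h1, h2⟩ := hw.fst x.1 (Or.inl hx)
    simp [crossProduct, h1, h2]
  · obtain ⟨h1, h2⟩ := hw.fst x.1 (Or.inr hx)
    simp [crossProduct, h1, h2]
  · obtain ⟨h1, h2⟩ := hw.snd x.1 (Or.inl hx)
    simp [crossProduct, h1, h2]
  · obtain ⟨h1, h2⟩ := hw.snd x.1 (Or.inr hx)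
    simp [crossProduct, h1, h2]
  · rcases h0 with h0 | h0
    · simp [hx, h0]
    · simp [crossProduct, h0 x.1]

/-! ### Uniqueness -/

/-- The continuity estimate with R = 0 and M = 0: such a functional does not see x₃ ≥ 0. -/
theorem eq_zero_of_crossSectionL2 {T : testFields →ₗ[ℂ] ℂ} (hT : G.IsCrossSectionL2 T)
    {V : testFields} (h : ∀ x, x.2 < 0 → V.1 x = 0) : T V = 0 := by
  obtain ⟨N, C, hC⟩ := hT 0
  have h0 : ∀ x, x.2 < -(0 : ℝ) → V.1 x = 0 := by simpa using h
  have := hC V h0 0 le_rfl fun m _ t ht => by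
    simp [iterate_dz_eq_zero V h0 m (_, t) (by simpa using ht)]
  rw [mul_zero] at this
  exact norm_le_zero_iff.1 this

/-- A single statement for both kinds of modes. If β is real, the factor has modulus one and the
claim is the radiation condition. If β is imaginary, the factor decays and boundedness of the field
suffices. -/
theorem tendsto_cexp_mul {T : testFields →ₗ[ℂ] ℂ} (hb : IsBoundedAtInfinity T)
    (ho : G.IsOutgoing T) (p : ModeIdx) (hp : G.eig p.1.1 ≠ G.k ^ 2) (h : testFun) :
    Tendsto (fun τ : ℝ => Complex.exp (Complex.I * G.β p.1.1 * τ) *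
      T (modeField (G.contDiff_mode p)
        (testShift τ (-testDeriv h + (Complex.I * G.β p.1.1) • h)))) atTop (𝓝 0) := by
  rw [tendsto_zero_iff_norm_tendsto_zero]
  simp only [norm_mul, norm_cexp_I_β]
  rcases hp.lt_or_gt with hp | hp
  · rw [(G.β_of_lt hp).1]
    simp only [zero_mul, neg_zero, Real.exp_zero, one_mul]
    have := (ho p hp (modeField (G.contDiff_mode p) h) h.1 fun x => rfl).norm
    rw [norm_zero] at this
    refine this.congr fun τ => ?_
    congr 2
    have e : -dz (modeField (G.contDiff_mode p) h) +
        (Complex.I * G.β p.1.1) • modeField (G.contDiff_mode p) h =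
        modeField (G.contDiff_mode p) (-testDeriv h + (Complex.I * G.β p.1.1) • h) := by
      rw [map_add, map_neg, map_smul]
      congr 2
      exact dzL_modeField (G.contDiff_mode p) h
    rw [e]
    rfl
  · have hκ := (G.β_of_gt hp).2
    obtain ⟨C, hC⟩ := hb (modeField (G.contDiff_mode p)
      (-testDeriv h + (Complex.I * G.β p.1.1) • h))
    have hlim : Tendsto (fun τ : ℝ => Real.exp (-((G.β p.1.1).im * τ)) * C) atTop (𝓝 0) := by
      have h1 : Tendsto (fun τ : ℝ => Real.exp (-((G.β p.1.1).im * τ))) atTop (𝓝 0) :=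
        Real.tendsto_exp_neg_atTop_nhds_zero.comp (tendsto_id.const_mul_atTop hκ)
      simpa using h1.mul_const C
    refine squeeze_zero' (Eventually.of_forall fun τ => by positivity) ?_ hlim
    filter_upwards [eventually_ge_atTop 0] with τ hτ
    exact mul_le_mul_of_nonneg_left (hC τ hτ) (Real.exp_pos _).le

section Uniqueness

variable {J : ℝ × ℝ → Fin 3 → ℂ} {T S : testFields →ₗ[ℂ] ℂ}

theorem sub_homogeneous (hT : G.IsSolution J T) (hS : G.IsSolution J S) {V : testFields}
    (hV : G.TangentialZero V.1) : (T - S) (curlL (curlL V)) = (G.k : ℂ) ^ 2 * (T - S) V := by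
  have h1 := hT.maxwell V hV
  have h2 := hS.maxwell V hV
  have h3 : (T - S) (curlL (curlL V) - ((G.k : ℂ) ^ 2) • V) = 0 := by
    rw [LinearMap.sub_apply]
    exact sub_eq_zero.2 (h1.trans h2.symm)
  rw [map_sub, map_smul, smul_eq_mul] at h3
  exact sub_eq_zero.1 h3

theorem sub_eq_zero_of_equation (hT : G.IsSolution J T) (hS : G.IsSolution J S) (p : ModeIdx)
    (hp : G.eig p.1.1 ≠ G.k ^ 2)
    (heq : ∀ h : testFun, h.1 0 = 0 → (T - S) (modeField (G.contDiff_mode p)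
      (testDeriv (testDeriv h) + G.β p.1.1 ^ 2 • h)) = 0) (h : testFun) :
    (T - S) (modeField (G.contDiff_mode p) h) = 0 := by
  refine functional_eq_zero (g := (T - S) ∘ₗ modeField (G.contDiff_mode p)) (G.β_ne_zero hp)
    (fun h hh => ?_) heq (fun h => ?_) h
  · have h0 : ∀ x : (ℝ × ℝ) × ℝ, x.2 < 0 → (modeField (G.contDiff_mode p) h).1 x = 0 :=
      fun x hx => by rw [modeField_apply, hh _ hx, zero_smul]
    rw [LinearMap.comp_apply, LinearMap.sub_apply, G.eq_zero_of_crossSectionL2 hT.crossSectionL2 h0,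
      G.eq_zero_of_crossSectionL2 hS.crossSectionL2 h0, sub_zero]
  · have h1 := G.tendsto_cexp_mul hT.bounded hT.outgoing p hp h
    have h2 := G.tendsto_cexp_mul hS.bounded hS.outgoing p hp h
    have h3 := h1.sub h2
    rw [sub_zero] at h3
    refine h3.congr fun τ => ?_
    rw [LinearMap.comp_apply, LinearMap.sub_apply, mul_sub]

theorem sub_mode_te (hT : G.IsSolution J T) (hS : G.IsSolution J S) (p : ModeIdx)
    (hp : G.eig p.1.1 ≠ G.k ^ 2) (hs : (p.2 : ℕ) = 0) (h : testFun) :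
    (T - S) (modeField (G.contDiff_mode p) h) = 0 := by
  refine G.sub_eq_zero_of_equation hT hS p hp (fun h h0 => ?_) h
  obtain ⟨r, hr, hΦ⟩ := G.exists_Φ_eq_smul_te p.1
  have hm : ∀ f, modeField (G.contDiff_mode p) f =
      (r : ℂ) • modeField (contDiff_te (G.kx p.1.1) (G.ky p.1.1)) f :=
    modeField_eq_of_smul _ _ (by rw [hs, hΦ])
  have h1 := G.sub_homogeneous hT hS (G.tangentialZero_modeField (G.contDiff_mode p)
    (G.wallZero_mode p) (h := h) (Or.inl h0))
  rw [hm, map_smul, map_smul, curlL_curlL_te] at h1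
  rw [hm, G.β_sq, eig_eq]
  simp only [map_add, map_sub, map_smul, smul_eq_mul] at h1 ⊢
  push_cast
  linear_combination -h1

theorem sub_mode_tm_lo (hT : G.IsSolution J T) (hS : G.IsSolution J S) (n : Idx)
    (hp : G.eig n.1 ≠ G.k ^ 2) (hn : n.1.1 * n.1.2 ≠ 0) (h : testFun) :
    (T - S) (modeField (contDiff_tm (G.kx n.1) (G.ky n.1)) h) = 0 ∧
    (T - S) (modeField (contDiff_lo (G.kx n.1) (G.ky n.1)) h) = 0 := by
  let p : ModeIdx := ⟨n, ⟨1, by simp [mult, hn]⟩⟩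
  let q : ModeIdx := ⟨n, ⟨2, by simp [mult, hn]⟩⟩
  have hΦp : G.Φ p.1.1 p.2 = tm (G.kx n.1) (G.ky n.1) := G.Φ_one hn
  have hΦq : G.Φ q.1.1 q.2 = lo (G.kx n.1) (G.ky n.1) := G.Φ_two hn
  have hk : (G.k : ℂ) ≠ 0 := by exact_mod_cast G.k_pos.ne'
  have hβ := G.β_ne_zero hp
  have hβ2 := G.β_sq n.1
  rw [eig_eq] at hβ2
  push_cast at hβ2
  -- Longitudinal test fields give the longitudinal functional in terms of the transverse one, for
  -- every h.
  have hlo : ∀ h, G.β n.1 ^ 2 * (T - S) (modeField (contDiff_lo (G.kx n.1) (G.ky n.1)) h) =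
      (T - S) (modeField (contDiff_tm (G.kx n.1) (G.ky n.1)) (testDeriv h)) := fun h => by
    have h1 := G.sub_homogeneous hT hS (G.tangentialZero_modeField (contDiff_lo _ _)
      (hΦq ▸ G.wallZero_mode q) (h := h) (Or.inr fun x => by simp [lo, sepField]))
    rw [curlL_curlL_lo] at h1
    simp only [map_add, map_smul, smul_eq_mul] at h1
    rw [hβ2]
    linear_combination -h1
  have htm : ∀ h, (T - S) (modeField (contDiff_tm (G.kx n.1) (G.ky n.1)) h) = 0 := by
    have hm : ∀ f, modeField (contDiff_tm (G.kx n.1) (G.ky n.1)) f =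
        modeField (G.contDiff_mode p) f := fun f => by simp only [hΦp]
    intro h
    rw [hm]
    refine G.sub_eq_zero_of_equation hT hS p hp (fun h h0 => ?_) h
    rw [← hm]
    have h1 := G.sub_homogeneous hT hS (G.tangentialZero_modeField (contDiff_tm _ _)
      (hΦp ▸ G.wallZero_mode p) (h := h) (Or.inl h0))
    rw [curlL_curlL_tm] at h1
    have h2 := hlo (testDeriv h)
    change (T - S) (modeField _ (testDeriv (testDeriv h) + G.β n.1 ^ 2 • h)) = 0
    simp only [map_add, map_sub, map_neg, map_smul, smul_eq_mul] at h1 ⊢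
    refine (mul_eq_zero.1 ?_).resolve_left (pow_ne_zero 2 hk)
    -- The tm equation times β², with the longitudinal term eliminated, contains h'' with the factor
    -- β² + λ = k². So k² can be divided out, which leaves h'' + β²h.
    linear_combination (-G.β n.1 ^ 2) * h1 - (G.kx n.1 ^ 2 + G.ky n.1 ^ 2 : ℂ) * h2 -
      (T - S) (modeField (contDiff_tm (G.kx n.1) (G.ky n.1)) (testDeriv (testDeriv h))) * hβ2
  refine ⟨htm h, (mul_eq_zero.1 ?_).resolve_left (pow_ne_zero 2 hβ)⟩
  rw [hlo, htm]

theorem sub_mode (hcut : ∀ n : Idx, G.eig n.1 ≠ G.k ^ 2) (hT : G.IsSolution J T)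
    (hS : G.IsSolution J S) (p : ModeIdx) (h : testFun) :
    (T - S) (modeField (G.contDiff_mode p) h) = 0 := by
  rcases modeIdx_cases p with hs | ⟨hn, hs | hs⟩
  · exact G.sub_mode_te hT hS p (hcut _) hs h
  · have := (G.sub_mode_tm_lo hT hS p.1 (hcut _) hn h).1
    simpa only [hs, G.Φ_one hn] using this
  · have := (G.sub_mode_tm_lo hT hS p.1 (hcut _) hn h).2
    simpa only [hs, G.Φ_two hn] using this

/-- The boundary value problem has at most one solution. -/
theorem IsSolution.unique (hcut : ∀ n : Idx, G.eig n.1 ≠ G.k ^ 2) (hT : G.IsSolution J T)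
    (hS : G.IsSolution J S) : T = S := by
  refine LinearMap.ext fun V => ?_
  refine tendsto_nhds_unique (G.tendsto_proj hT.crossSectionL2 V)
    ((G.tendsto_proj hS.crossSectionL2 V).congr fun F => ?_)
  simp only [proj, map_sum]
  refine Finset.sum_congr rfl fun p _ => ?_
  have := G.sub_mode hcut hT hS p (G.projCoef p V)
  rw [LinearMap.sub_apply] at this
  exact (sub_eq_zero.1 this).symm

end Uniqueness

/-! ### Piecewise exponential profiles -/

/-- The profile `a exp(iβt) + b exp(-iβt)` for `t > -l`, `c exp(-iβt)` for `t ≤ -l`. -/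
def pw (β : ℂ) (l : ℝ) (a b c : ℂ) (t : ℝ) : ℂ :=
  if -l < t then a * Complex.exp (Complex.I * β * t) + b * Complex.exp (-(Complex.I * β * t))
  else c * Complex.exp (-(Complex.I * β * t))

/-- The functional on functions of `x₃ < 0` given by a profile. -/
def pwInt (β : ℂ) (l : ℝ) (a b c : ℂ) (w : ℝ → ℂ) : ℂ := ∫ t in Iio 0, pw β l a b c t * w t

section Profile

variable {β : ℂ} {l : ℝ} {a b c : ℂ} {w : ℝ → ℂ}

theorem measurable_pw : Measurable (pw β l a b c) := by
  refine Measurable.ite measurableSet_Ioi ?_ ?_ <;> fun_prop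

theorem exp_neg_I_mul (β : ℂ) (t : ℝ) : Complex.exp (-(Complex.I * β * t)) =
    Complex.exp (-(Complex.I * β) * t) := by rw [neg_mul]

theorem continuous_cexp_mul (c : ℂ) : Continuous fun t : ℝ => Complex.exp (c * t) :=
  (contDiff_cexp_mul c).continuous

/-- The half-line is split at the source, and the vanishing of w below α makes both pieces integrals
over bounded intervals. -/
theorem integrableOn_pw_mul (hl : 0 < l) (hw : Continuous w) {α : ℝ} (hα : α ≤ -l)
    (h0 : ∀ t ≤ α, w t = 0) :
    IntegrableOn (fun t => pw β l a b c t * w t) (Iio 0) ∧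
    pwInt β l a b c w = (∫ t in α..(-l), c * Complex.exp (-(Complex.I * β) * t) * w t) +
      ∫ t in (-l)..0, (a * Complex.exp (Complex.I * β * t) +
        b * Complex.exp (-(Complex.I * β) * t)) * w t := by
  have c1 : Continuous fun t : ℝ => c * Complex.exp (-(Complex.I * β) * t) * w t :=
    (continuous_const.mul (continuous_cexp_mul _)).mul hw
  have c2 : Continuous fun t : ℝ => (a * Complex.exp (Complex.I * β * t) +
        b * Complex.exp (-(Complex.I * β) * t)) * w t :=
    ((continuous_const.mul (continuous_cexp_mul _)).add
      (continuous_const.mul (continuous_cexp_mul _))).mul hw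
  have e1 : ∀ t ∈ Iic (-l), pw β l a b c t * w t =
      c * Complex.exp (-(Complex.I * β) * t) * w t := fun t ht => by
    rw [pw, if_neg (not_lt.2 ht), exp_neg_I_mul]
  have e2 : ∀ t ∈ Ioo (-l) 0, pw β l a b c t * w t = (a * Complex.exp (Complex.I * β * t) +
      b * Complex.exp (-(Complex.I * β) * t)) * w t := fun t ht => by
    rw [pw, if_pos ht.1, exp_neg_I_mul]
  have i1 : IntegrableOn (fun t : ℝ => c * Complex.exp (-(Complex.I * β) * t) * w t)
      (Iic (-l)) := by
    refine (c1.continuousOn.integrableOn_compact (isCompact_Icc (a := α) (b := -l))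
      ).of_forall_sdiff_eq_zero measurableSet_Iic fun t ht => ?_
    rw [h0 t, mul_zero]
    by_contra h
    exact ht.2 ⟨(not_le.1 h).le, ht.1⟩
  have hu : Iio (0 : ℝ) = Iic (-l) ∪ Ioo (-l) 0 := by
    ext t
    simp only [mem_Iio, mem_union, mem_Iic, mem_Ioo]
    constructor
    · intro h
      rcases le_or_gt t (-l) with h' | h'
      · exact Or.inl h'
      · exact Or.inr ⟨h', h⟩
    · rintro (h | h)
      · linarith
      · exact h.2
  have j1 : IntegrableOn (fun t => pw β l a b c t * w t) (Iic (-l)) :=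
    i1.congr_fun (fun t ht => (e1 t ht).symm) measurableSet_Iic
  have j2 : IntegrableOn (fun t => pw β l a b c t * w t) (Ioo (-l) 0) :=
    (integrableOn_Ioo c2 (-l) 0).congr_fun (fun t ht => (e2 t ht).symm) measurableSet_Ioo
  refine ⟨hu ▸ j1.union j2, ?_⟩
  rw [pwInt, hu, setIntegral_union ?_ measurableSet_Ioo j1 j2, setIntegral_congr_fun
    measurableSet_Iic e1, setIntegral_congr_fun measurableSet_Ioo e2,
    intervalIntegral.integral_of_le (by linarith : -l ≤ 0), integral_Ioc_eq_integral_Ioo,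
    integral_Iic_eq_integral_Iio, setIntegral_Iio_eq hα fun t ht => by rw [h0 t ht, mul_zero]]
  exact Set.disjoint_left.2 fun t ht ht' => not_lt.2 ht ht'.1

theorem exists_lt_of_testLike (hsupp : ∃ α : ℝ, ∀ t ≤ α, w t = 0) (l : ℝ) :
    ∃ α ≤ -l, ∀ t ≤ α, w t = 0 := by
  obtain ⟨α, h⟩ := hsupp
  exact ⟨min α (-l), min_le_right _ _, fun t ht => h t (ht.trans (min_le_left _ _))⟩

/-- Integration by parts against a profile. -/
theorem pwInt_deriv (hl : 0 < l) {w' : ℝ → ℂ} (hw : ∀ t, HasDerivAt w (w' t) t)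
    (hw' : Continuous w') (hs : ∃ α : ℝ, ∀ t ≤ α, w t = 0) (hs' : ∃ α : ℝ, ∀ t ≤ α, w' t = 0) :
    pwInt β l a b c w' = (a + b) * w 0 - (a * Complex.exp (-(Complex.I * β * l)) +
      (b - c) * Complex.exp (Complex.I * β * l)) * w (-l) -
      pwInt β l (Complex.I * β * a) (-(Complex.I * β * b)) (-(Complex.I * β * c)) w := by
  have hcw : Continuous w := continuous_iff_continuousAt.2 fun t => (hw t).continuousAt
  obtain ⟨α, hα, h0⟩ := exists_lt_of_testLike hs l
  obtain ⟨α', hα', h0'⟩ := exists_lt_of_testLike hs' l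
  have hm : min α α' ≤ -l := (min_le_left _ _).trans hα
  have z : ∀ t ≤ min α α', w t = 0 := fun t ht => h0 t (ht.trans (min_le_left _ _))
  have z' : ∀ t ≤ min α α', w' t = 0 := fun t ht => h0' t (ht.trans (min_le_right _ _))
  rw [(integrableOn_pw_mul hl hw' hm z').2, (integrableOn_pw_mul hl hcw hm z).2]
  -- On each side of the source the product of wave and w is an antiderivative. Its values at -l
  -- combine into the jump of the profile there; its value at 0 gives a + b.
  have d1 : ∀ t : ℝ, HasDerivAt (fun t : ℝ => c * Complex.exp (-(Complex.I * β) * t) * w t)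
      (c * Complex.exp (-(Complex.I * β) * t) * w' t +
        -(Complex.I * β * c) * Complex.exp (-(Complex.I * β) * t) * w t) t := fun t => by
    refine (((hasDerivAt_cexp_mul (-(Complex.I * β)) t).const_mul c).mul (hw t)).congr_deriv ?_
    ring
  have d2 : ∀ t : ℝ, HasDerivAt (fun t : ℝ => (a * Complex.exp (Complex.I * β * t) +
        b * Complex.exp (-(Complex.I * β) * t)) * w t)
      ((a * Complex.exp (Complex.I * β * t) + b * Complex.exp (-(Complex.I * β) * t)) * w' t +
        ((Complex.I * β * a) * Complex.exp (Complex.I * β * t) +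
          -(Complex.I * β * b) * Complex.exp (-(Complex.I * β) * t)) * w t) t := fun t => by
    refine ((((hasDerivAt_cexp_mul (Complex.I * β) t).const_mul a).add
      ((hasDerivAt_cexp_mul (-(Complex.I * β)) t).const_mul b)).mul (hw t)).congr_deriv ?_
    simp only [Pi.add_apply]
    ring
  have E1 := continuous_cexp_mul (Complex.I * β)
  have E2 := continuous_cexp_mul (-(Complex.I * β))
  have c1 : Continuous fun t : ℝ => c * Complex.exp (-(Complex.I * β) * t) * w' t :=
    (continuous_const.mul E2).mul hw'
  have c2 : Continuous fun t : ℝ =>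
      -(Complex.I * β * c) * Complex.exp (-(Complex.I * β) * t) * w t :=
    (continuous_const.mul E2).mul hcw
  have c3 : Continuous fun t : ℝ =>
      (a * Complex.exp (Complex.I * β * t) + b * Complex.exp (-(Complex.I * β) * t)) * w' t :=
    ((continuous_const.mul E1).add (continuous_const.mul E2)).mul hw'
  have c4 : Continuous fun t : ℝ => ((Complex.I * β * a) * Complex.exp (Complex.I * β * t) +
          -(Complex.I * β * b) * Complex.exp (-(Complex.I * β) * t)) * w t :=
    ((continuous_const.mul E1).add (continuous_const.mul E2)).mul hcw
  have f1 := intervalIntegral.integral_eq_sub_of_hasDerivAt (a := min α α') (b := -l)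
    (fun t _ => d1 t) ((c1.add c2).intervalIntegrable _ _)
  have f2 := intervalIntegral.integral_eq_sub_of_hasDerivAt (a := -l) (b := 0)
    (fun t _ => d2 t) ((c3.add c4).intervalIntegrable _ _)
  rw [intervalIntegral.integral_add (c1.intervalIntegrable _ _) (c2.intervalIntegrable _ _),
    z _ le_rfl] at f1
  rw [intervalIntegral.integral_add (c3.intervalIntegrable _ _) (c4.intervalIntegrable _ _)] at f2
  have g1 : Complex.exp (-(Complex.I * β) * ((-l : ℝ) : ℂ)) = Complex.exp (Complex.I * β * l) := by
    congr 1; push_cast; ring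
  have g2 : Complex.exp (Complex.I * β * ((-l : ℝ) : ℂ)) = Complex.exp (-(Complex.I * β * l)) := by
    congr 1; push_cast; ring
  rw [g1] at f1
  rw [g1, g2] at f2
  simp only [Complex.ofReal_zero, mul_zero, Complex.exp_zero, mul_one] at f1 f2
  linear_combination f1 + f2

theorem pwInt_coeff_smul (r : ℂ) :
    pwInt β l (r * a) (r * b) (r * c) w = r * pwInt β l a b c w := by
  rw [pwInt, pwInt, ← integral_const_mul]
  congr 1; funext t
  simp only [pw]
  split_ifs <;> ring

theorem pwInt_add (hl : 0 < l) {v : ℝ → ℂ} (hw : Continuous w) (hv : Continuous v)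
    (hs : ∃ α : ℝ, ∀ t ≤ α, w t = 0) (hs' : ∃ α : ℝ, ∀ t ≤ α, v t = 0) :
    pwInt β l a b c (fun t => w t + v t) = pwInt β l a b c w + pwInt β l a b c v := by
  obtain ⟨α, hα, h0⟩ := exists_lt_of_testLike hs l
  obtain ⟨α', hα', h0'⟩ := exists_lt_of_testLike hs' l
  rw [pwInt, pwInt, pwInt, ← integral_add (integrableOn_pw_mul hl hw hα h0).1
    (integrableOn_pw_mul hl hv hα' h0').1]
  congr 1; funext t; ring

theorem pwInt_const_mul (r : ℂ) : pwInt β l a b c (fun t => r * w t) = r * pwInt β l a b c w := by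
  rw [pwInt, pwInt, ← integral_const_mul]
  congr 1; funext t; ring

theorem norm_cexp_I_mul (β : ℂ) (t : ℝ) :
    ‖Complex.exp (Complex.I * β * t)‖ = Real.exp (-(β.im * t)) := by
  rw [Complex.norm_exp]
  congr 1
  simp

/-- The waves emitted by a source at `-l` and reflected at `0` decay away from the source. -/
theorem norm_pw_le (hβ : 0 ≤ β.im) {σ A B : ℂ} (hσ : ‖σ‖ = 1) {t : ℝ} (ht : t < 0) (hl : 0 < l) :
    ‖pw β l (σ * ((A + B) * Complex.exp (Complex.I * β * l)))
      ((A + B) * Complex.exp (Complex.I * β * l))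
      (A * (Complex.exp (Complex.I * β * l) - Complex.exp (-(Complex.I * β * l))) +
        B * (Complex.exp (Complex.I * β * l) + Complex.exp (-(Complex.I * β * l)))) t‖ ≤
      2 * (‖A‖ + ‖B‖) * Real.exp (-(β.im * |t + l|)) := by
  have hAB := norm_add_le A B
  -- The reflected wave has travelled the distance l - t, which is at least |t + l| because l > 0 >
  -- t.
  have hE : ‖Complex.exp (Complex.I * β * l) * Complex.exp (-(Complex.I * β * t))‖ ≤
      Real.exp (-(β.im * |t + l|)) := by
    have : Complex.exp (Complex.I * β * l) * Complex.exp (-(Complex.I * β * t)) =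
        Complex.exp (Complex.I * β * ((l - t : ℝ) : ℂ)) := by
      rw [← Complex.exp_add]; congr 1; push_cast; ring
    rw [this, norm_cexp_I_mul, Real.exp_le_exp, neg_le_neg_iff]
    refine mul_le_mul_of_nonneg_left ?_ hβ
    rw [abs_le]; constructor <;> linarith
  have hP : (0 : ℝ) < Real.exp (-(β.im * |t + l|)) := Real.exp_pos _
  rw [pw]
  split_ifs with h
  · have hF : ‖Complex.exp (Complex.I * β * l) * Complex.exp (Complex.I * β * t)‖ ≤
        Real.exp (-(β.im * |t + l|)) := by
      have : Complex.exp (Complex.I * β * l) * Complex.exp (Complex.I * β * t) =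
          Complex.exp (Complex.I * β * ((t + l : ℝ) : ℂ)) := by
        rw [← Complex.exp_add]; congr 1; push_cast; ring
      rw [this, norm_cexp_I_mul, abs_of_pos (by linarith)]
    have e : σ * ((A + B) * Complex.exp (Complex.I * β * l)) * Complex.exp (Complex.I * β * t) +
        (A + B) * Complex.exp (Complex.I * β * l) * Complex.exp (-(Complex.I * β * t)) =
        (A + B) * (σ * (Complex.exp (Complex.I * β * l) * Complex.exp (Complex.I * β * t)) +
          Complex.exp (Complex.I * β * l) * Complex.exp (-(Complex.I * β * t))) := by ring
    rw [e, norm_mul]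
    have h2 : ‖σ * (Complex.exp (Complex.I * β * l) * Complex.exp (Complex.I * β * t)) +
          Complex.exp (Complex.I * β * l) * Complex.exp (-(Complex.I * β * t))‖ ≤
        2 * Real.exp (-(β.im * |t + l|)) := by
      refine (norm_add_le _ _).trans ?_
      rw [norm_mul, hσ, one_mul]
      linarith
    calc _ ≤ (‖A‖ + ‖B‖) * (2 * Real.exp (-(β.im * |t + l|))) :=
          mul_le_mul hAB h2 (norm_nonneg _) (by positivity)
      _ = _ := by ring
  · have hF : ‖Complex.exp (-(Complex.I * β * l)) * Complex.exp (-(Complex.I * β * t))‖ ≤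
        Real.exp (-(β.im * |t + l|)) := by
      have : Complex.exp (-(Complex.I * β * l)) * Complex.exp (-(Complex.I * β * t)) =
          Complex.exp (Complex.I * β * ((-(t + l) : ℝ) : ℂ)) := by
        rw [← Complex.exp_add]; congr 1; push_cast; ring
      rw [this, norm_cexp_I_mul, abs_of_nonpos (by linarith)]
    -- Below the source: the reflected wave with amplitude A + B and the direct one with amplitude B
    -- - A, so that no growing exponential remains.
    have e : (A * (Complex.exp (Complex.I * β * l) - Complex.exp (-(Complex.I * β * l))) +
        B * (Complex.exp (Complex.I * β * l) + Complex.exp (-(Complex.I * β * l)))) *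
          Complex.exp (-(Complex.I * β * t)) =
        (A + B) * (Complex.exp (Complex.I * β * l) * Complex.exp (-(Complex.I * β * t))) +
        (B - A) * (Complex.exp (-(Complex.I * β * l)) * Complex.exp (-(Complex.I * β * t))) := by
      ring
    rw [e]
    refine (norm_add_le _ _).trans ?_
    rw [norm_mul (A + B), norm_mul (B - A)]
    have hBA := norm_sub_le B A
    calc _ ≤ (‖A‖ + ‖B‖) * Real.exp (-(β.im * |t + l|)) +
          (‖B‖ + ‖A‖) * Real.exp (-(β.im * |t + l|)) :=
          add_le_add (mul_le_mul hAB hE (norm_nonneg _) (by positivity))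
            (mul_le_mul hBA hF (norm_nonneg _) (by positivity))
      _ = _ := by ring

end Profile

/-- The integral over the whole line is 2 for every κ. This uniformity pays for the factor |β| in
the bound for the profiles of the evanescent modes. -/
theorem integral_exp_abs_le {κ : ℝ} (hκ : 0 < κ) (l a b : ℝ) :
    ∫ t in Ioo a b, κ * Real.exp (-(κ * |t + l|)) ≤ 2 := by
  have e1 : EqOn (fun t => κ * Real.exp (-(κ * |t + l|)))
      (fun t => κ * Real.exp (κ * l) * Real.exp (κ * t)) (Iic (-l)) := fun t ht => by
    have ht : t ≤ -l := ht
    simp only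
    rw [abs_of_nonpos (by linarith), mul_assoc, ← Real.exp_add]
    congr 2; ring
  have e2 : EqOn (fun t => κ * Real.exp (-(κ * |t + l|)))
      (fun t => κ * Real.exp (-(κ * l)) * Real.exp (-κ * t)) (Ioi (-l)) := fun t ht => by
    have ht : -l < t := ht
    simp only
    rw [abs_of_pos (by linarith), mul_assoc, ← Real.exp_add]
    congr 2; ring
  have i1 : IntegrableOn (fun t => κ * Real.exp (-(κ * |t + l|))) (Iic (-l)) := by
    have h : IntegrableOn (fun t => κ * Real.exp (κ * l) * Real.exp (κ * t)) (Iic (-l)) :=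
      (integrableOn_exp_mul_Iic hκ (-l)).const_mul _
    exact h.congr_fun e1.symm measurableSet_Iic
  have i2 : IntegrableOn (fun t => κ * Real.exp (-(κ * |t + l|))) (Ioi (-l)) := by
    have h : IntegrableOn (fun t => κ * Real.exp (-(κ * l)) * Real.exp (-κ * t)) (Ioi (-l)) :=
      (integrableOn_exp_mul_Ioi (neg_neg_of_pos hκ) (-l)).const_mul _
    exact h.congr_fun e2.symm measurableSet_Ioi
  have i : Integrable fun t => κ * Real.exp (-(κ * |t + l|)) := by
    rw [← integrableOn_univ, ← Iic_union_Ioi (a := -l)]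
    exact i1.union i2
  calc ∫ t in Ioo a b, κ * Real.exp (-(κ * |t + l|))
      ≤ ∫ t, κ * Real.exp (-(κ * |t + l|)) :=
        setIntegral_le_integral i (ae_of_all _ fun t => by positivity)
    _ = 2 := by
      rw [← intervalIntegral.integral_Iic_add_Ioi i1 i2, setIntegral_congr_fun measurableSet_Iic e1,
        setIntegral_congr_fun measurableSet_Ioi e2, integral_const_mul, integral_const_mul,
        integral_exp_mul_Iic hκ, integral_exp_mul_Ioi (neg_neg_of_pos hκ)]
      have h1 : Real.exp (κ * l) * Real.exp (κ * -l) = 1 := by rw [← Real.exp_add]; simp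
      have h2 : Real.exp (-(κ * l)) * Real.exp (-κ * -l) = 1 := by rw [← Real.exp_add]; simp
      rw [mul_div_assoc', mul_div_assoc', mul_assoc, h1, mul_neg, mul_assoc, h2, mul_one,
        neg_div_neg_eq, div_self hκ.ne']
      norm_num

/-! ### Bounds for the mode amplitudes -/

theorem finite_eig_le (R : ℝ) : {n : ℕ × ℕ | G.eig n ≤ R}.Finite := by
  have h1 := G.L₁_pos
  have h2 := G.L₂_pos
  have hπ := Real.pi_pos
  refine (Set.finite_Iic ((⌊√R * G.L₁ / Real.pi⌋₊, ⌊√R * G.L₂ / Real.pi⌋₊) : ℕ × ℕ)).subset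
    fun n hn => ?_
  have hn : (Real.pi * n.1 / G.L₁) ^ 2 + (Real.pi * n.2 / G.L₂) ^ 2 ≤ R := hn
  have e1 : Real.pi * n.1 / G.L₁ ≤ √R :=
    Real.le_sqrt_of_sq_le (by nlinarith [sq_nonneg (Real.pi * n.2 / G.L₂)])
  have e2 : Real.pi * n.2 / G.L₂ ≤ √R :=
    Real.le_sqrt_of_sq_le (by nlinarith [sq_nonneg (Real.pi * n.1 / G.L₁)])
  rw [div_le_iff₀ h1] at e1
  rw [div_le_iff₀ h2] at e2
  refine ⟨Nat.le_floor ?_, Nat.le_floor ?_⟩ <;> rw [le_div_iff₀ hπ] <;> linarith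

theorem norm_β_sq (n : ℕ × ℕ) : ‖G.β n‖ ^ 2 = |G.k ^ 2 - G.eig n| := by
  rw [← norm_pow, β_sq, ← Complex.ofReal_pow, ← Complex.ofReal_sub, Complex.norm_real,
    Real.norm_eq_abs]

/-- If λ > k² + 1 then |β| > 1, and only finitely many n remain; for these β ≠ 0 since k is not a
cut-off wavenumber. -/
theorem exists_le_norm_β (hcut : ∀ n : Idx, G.eig n.1 ≠ G.k ^ 2) :
    ∃ m > 0, ∀ n : Idx, m ≤ ‖G.β n.1‖ := by
  have hf : {n : Idx | G.eig n.1 ≤ G.k ^ 2 + 1}.Finite :=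
    (G.finite_eig_le _).preimage Subtype.val_injective.injOn
  obtain ⟨m, hm, h⟩ : ∃ m > 0, ∀ n ∈ hf.toFinset, m ≤ ‖G.β n.1‖ := by
    induction hf.toFinset using Finset.induction_on with
    | empty => exact ⟨1, one_pos, by simp⟩
    | insert a s _ ih =>
      obtain ⟨m, hm, h⟩ := ih
      refine ⟨min m ‖G.β a.1‖, lt_min hm (norm_pos_iff.2 (G.β_ne_zero (hcut a))), fun n hn => ?_⟩
      rcases Finset.mem_insert.1 hn with rfl | hn
      · exact min_le_right _ _
      · exact (min_le_left _ _).trans (h n hn)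
  refine ⟨min m 1, lt_min hm one_pos, fun n => ?_⟩
  by_cases hn : G.eig n.1 ≤ G.k ^ 2 + 1
  · exact (min_le_left _ _).trans (h n (by simpa using hn))
  · refine (min_le_right _ _).trans ?_
    have h1 := G.norm_β_sq n.1
    rw [abs_of_neg (by linarith)] at h1
    nlinarith [norm_nonneg (G.β n.1)]

theorem norm_β_le_of_lt {n : ℕ × ℕ} (h : G.eig n < G.k ^ 2) : ‖G.β n‖ ≤ G.k := by
  have h1 := G.norm_β_sq n
  rw [abs_of_pos (by linarith)] at h1
  have h2 : 0 ≤ G.eig n := by rw [eig_eq]; positivity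
  exact (sq_le_sq₀ (norm_nonneg _) G.k_pos.le).1 (by linarith)

theorem norm_β_of_gt {n : ℕ × ℕ} (h : G.k ^ 2 < G.eig n) : ‖G.β n‖ = (G.β n).im := by
  rw [β, if_neg h.not_ge]
  simp [abs_of_nonneg (Real.sqrt_nonneg _)]

theorem integral_norm_β_exp_le {n : ℕ × ℕ} (h : G.eig n ≠ G.k ^ 2) {a b : ℝ} (hab : a ≤ b) :
    ∫ t in Ioo a b, ‖G.β n‖ * Real.exp (-((G.β n).im * |t + G.L|)) ≤ G.k * (b - a) + 2 := by
  have hk := G.k_pos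
  rcases h.lt_or_gt with h | h
  · rw [(G.β_of_lt h).1]
    have := mul_le_mul_of_nonneg_right (G.norm_β_le_of_lt h) (sub_nonneg.2 hab)
    simp [hab]
    linarith
  · rw [G.norm_β_of_gt h]
    have := integral_exp_abs_le (G.β_of_gt h).2 G.L a b
    have := mul_nonneg hk.le (sub_nonneg.2 hab)
    linarith

/-- The waveguide profile of a mode. -/
def profile (J : ℝ × ℝ → Fin 3 → ℂ) (n : ℕ × ℕ) (s : ℕ) : ℝ → ℂ :=
  pw (G.β n) G.L (G.aPlus J n s) (G.bPlus J n s) (G.bMinus J n s)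

theorem coef_mul_modeNorm (J : ℝ × ℝ → Fin 3 → ℂ) (p : ModeIdx) :
    G.coef J p.1.1 p.2 * G.modeNorm p = G.hat p J := by
  have := G.modeNorm_ne_zero p
  rw [coef, innerΩ_mode_self, hat]
  field_simp

theorem norm_coef_mul_modeNorm (J : ℝ × ℝ → Fin 3 → ℂ) (p : ModeIdx) :
    ‖G.coef J p.1.1 p.2‖ * G.modeNorm p = ‖G.hat p J‖ := by
  rw [← coef_mul_modeNorm, norm_mul, Complex.norm_real, Real.norm_of_nonneg (G.modeNorm_pos p).le]

/-- The size of the coefficients of the current with index pair `n`. -/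
def sourceNorm (J : ℝ × ℝ → Fin 3 → ℂ) (n : Idx) : ℝ :=
  √(∑ s : Fin (mult n.1), ‖G.hat ⟨n, s⟩ J‖ ^ 2)

theorem sourceNorm_nonneg (J : ℝ × ℝ → Fin 3 → ℂ) (n : Idx) : 0 ≤ G.sourceNorm J n :=
  Real.sqrt_nonneg _

theorem norm_hat_le_sourceNorm (J : ℝ × ℝ → Fin 3 → ℂ) (p : ModeIdx) :
    ‖G.hat p J‖ ≤ G.sourceNorm J p.1 := by
  refine Real.le_sqrt_of_sq_le ?_
  exact Finset.single_le_sum (f := fun s => ‖G.hat ⟨p.1, s⟩ J‖ ^ 2) (fun _ _ => sq_nonneg _)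
    (Finset.mem_univ p.2)

theorem mult_le (n : ℕ × ℕ) : mult n ≤ 3 := by
  unfold mult; split_ifs <;> norm_num

/-- The sum runs over modes rather than index pairs, so each index pair is counted at most three
times. -/
theorem summable_sourceNorm_sq {J : ℝ × ℝ → Fin 3 → ℂ} (hJ : MemLp J 2 (volume.restrict G.Ω)) :
    Summable fun p : ModeIdx => G.sourceNorm J p.1 ^ 2 := by
  have h := (G.hasSum_norm_hat_sq hJ).summable.sigma
  have e : ∀ n : Idx, ∑' s : Fin (mult n.1), ‖G.hat ⟨n, s⟩ J‖ ^ 2 = G.sourceNorm J n ^ 2 :=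
    fun n => by
      rw [tsum_fintype, sourceNorm, Real.sq_sqrt (Finset.sum_nonneg fun _ _ => sq_nonneg _)]
  simp only [e] at h
  refine (summable_sigma_of_nonneg fun _ => sq_nonneg _).2 ⟨fun n => (hasSum_fintype _).summable, ?_⟩
  simp only [tsum_fintype, Finset.sum_const, Finset.card_univ, Fintype.card_fin, nsmul_eq_mul]
  refine Summable.of_nonneg_of_le (fun n => by positivity) (fun n => ?_) (h.mul_left 3)
  refine mul_le_mul_of_nonneg_right ?_ (sq_nonneg _)
  exact_mod_cast mult_le n.1

/-- The index of the transverse magnetic mode. -/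
def tmIdx {n : Idx} (hn : n.1.1 * n.1.2 ≠ 0) : ModeIdx := ⟨n, ⟨1, by simp [mult, hn]⟩⟩

/-- The index of the longitudinal mode. -/
def loIdx {n : Idx} (hn : n.1.1 * n.1.2 ≠ 0) : ModeIdx := ⟨n, ⟨2, by simp [mult, hn]⟩⟩

theorem modeNorm_tmIdx {n : Idx} (hn : n.1.1 * n.1.2 ≠ 0) :
    G.modeNorm (tmIdx hn) = √(G.eig n.1) * G.modeNorm (loIdx hn) := by
  have h1 : G.modeNorm (tmIdx hn) ^ 2 = G.eig n.1 * (G.L₁ * G.L₂ / 4) := by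
    have : G.innerΩ (G.Φ n.1 1) (G.Φ n.1 1) = _ := G.innerΩ_mode_self (tmIdx hn)
    rw [G.Φ_one hn, G.innerΩ_tm_self hn] at this
    exact_mod_cast this.symm
  have h2 : G.modeNorm (loIdx hn) ^ 2 = G.L₁ * G.L₂ / 4 := by
    have : G.innerΩ (G.Φ n.1 2) (G.Φ n.1 2) = _ := G.innerΩ_mode_self (loIdx hn)
    rw [G.Φ_two hn, G.innerΩ_lo_self hn] at this
    exact_mod_cast this.symm
  have h3 := G.modeNorm_pos (tmIdx hn)
  have h4 := G.modeNorm_pos (loIdx hn)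
  refine (pow_left_inj₀ h3.le (by positivity) two_ne_zero).1 ?_
  rw [mul_pow, Real.sq_sqrt (G.eig_pos n).le, h1, h2]

/-- A normal form common to the three families: B belongs to the sum of the exponentials in b⁻, A to
their difference, and σ = ±1 is the sign of the reflection. The tm and longitudinal amplitudes each
contain both source coefficients, so the bound uses the joint size `sourceNorm` of the index pair.
-/
theorem exists_amplitudes (hcut : ∀ n : Idx, G.eig n.1 ≠ G.k ^ 2) (J : ℝ × ℝ → Fin 3 → ℂ) :
    ∃ K : ℝ, 0 ≤ K ∧ ∀ p : ModeIdx, ∃ σ A B : ℂ, ‖σ‖ = 1 ∧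
      G.aPlus J p.1.1 p.2 = σ * ((A + B) * Complex.exp (Complex.I * G.β p.1.1 * G.L)) ∧
      G.bPlus J p.1.1 p.2 = (A + B) * Complex.exp (Complex.I * G.β p.1.1 * G.L) ∧
      G.bMinus J p.1.1 p.2 =
        A * (Complex.exp (Complex.I * G.β p.1.1 * G.L) -
          Complex.exp (-(Complex.I * G.β p.1.1 * G.L))) +
        B * (Complex.exp (Complex.I * G.β p.1.1 * G.L) +
          Complex.exp (-(Complex.I * G.β p.1.1 * G.L))) ∧
      (‖A‖ + ‖B‖) * G.modeNorm p ≤ K * (G.sourceNorm J p.1 * ‖G.β p.1.1‖) := by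
  obtain ⟨m, hm, hβm⟩ := G.exists_le_norm_β hcut
  have hk := G.k_pos
  have hω := G.freq_pos
  have hμ := G.mu_pos
  set c : ℝ := G.freq * G.mu with hc
  have hc0 : 0 < c := by positivity
  -- Chosen so that λ ≤ k² + |β|² ≤ Q|β|², and hence √λ ≤ Q|β|.
  set Q : ℝ := 1 + G.k ^ 2 / m ^ 2 with hQ
  have hQ1 : 1 ≤ Q := by rw [hQ]; linarith [show 0 ≤ G.k ^ 2 / m ^ 2 by positivity]
  have hQ0 : 0 < Q := by linarith
  -- The first summand serves the te modes, the second the other two families, where A and B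
  -- contribute Q each.
  refine ⟨c / (2 * m ^ 2) + c / (2 * G.k ^ 2) * (2 * Q), by positivity, fun p => ?_⟩
  have hb := hβm p.1
  have hb0 : 0 < ‖G.β p.1.1‖ := hm.trans_le hb
  -- The te amplitude carries 1/|β|; it is enlarged to the factor |β| shared by all families.
  have hinv : c / (2 * ‖G.β p.1.1‖) ≤ c / (2 * m ^ 2) * ‖G.β p.1.1‖ := by
    rw [div_mul_eq_mul_div, div_le_div_iff₀ (by positivity) (by positivity)]
    have : m ^ 2 ≤ ‖G.β p.1.1‖ ^ 2 := by gcongr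
    nlinarith
  have hlam : G.eig p.1.1 ≤ Q * ‖G.β p.1.1‖ ^ 2 := by
    have h1 : m ^ 2 ≤ ‖G.β p.1.1‖ ^ 2 := by gcongr
    have h2 : G.eig p.1.1 ≤ G.k ^ 2 + ‖G.β p.1.1‖ ^ 2 := by
      rw [norm_β_sq]; linarith [neg_abs_le (G.k ^ 2 - G.eig p.1.1)]
    have h3 : G.k ^ 2 ≤ G.k ^ 2 / m ^ 2 * ‖G.β p.1.1‖ ^ 2 := by
      rw [div_mul_eq_mul_div, le_div_iff₀ (by positivity)]
      gcongr
    rw [hQ]; linarith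
  have hsq : √(G.eig p.1.1) ≤ Q * ‖G.β p.1.1‖ := by
    refine Real.sqrt_le_iff.2 ⟨by positivity, hlam.trans ?_⟩
    rw [mul_pow]
    gcongr
    nlinarith
  have hd0 := G.sourceNorm_nonneg J p.1
  have hI : ‖Complex.I‖ = 1 := Complex.norm_I
  have ncoe : ∀ r : ℝ, 0 ≤ r → ‖(r : ℂ)‖ = r := fun r hr => by
    rw [Complex.norm_real, Real.norm_of_nonneg hr]
  have nk : ‖(G.k : ℂ)‖ = G.k := ncoe _ hk.le
  have nω : ‖(G.freq : ℂ)‖ = G.freq := ncoe _ hω.le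
  have nμ : ‖(G.mu : ℂ)‖ = G.mu := ncoe _ hμ.le
  rcases modeIdx_cases p with hs | ⟨hn, hs⟩
  · refine ⟨-1, G.freq * G.mu / (2 * G.β p.1.1) * G.coef J p.1.1 0, 0, by simp, ?_, ?_, ?_, ?_⟩
    · rw [hs]; simp only [aPlus, bPlus]; ring
    · rw [hs]; simp only [bPlus]; ring
    · rw [hs]; simp only [bMinus]; ring
    · have h1 := G.norm_coef_mul_modeNorm J p
      rw [hs] at h1
      have h2 := G.norm_hat_le_sourceNorm J p
      have e : (‖G.freq * G.mu / (2 * G.β p.1.1) * G.coef J p.1.1 0‖ + ‖(0 : ℂ)‖) *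
          G.modeNorm p = c / (2 * ‖G.β p.1.1‖) * ‖G.hat p J‖ := by
        rw [← h1, norm_zero, add_zero, norm_mul, norm_div, norm_mul, norm_mul, nω, nμ,
          Complex.norm_two]
        ring
      rw [e]
      calc _ ≤ c / (2 * m ^ 2) * ‖G.β p.1.1‖ * G.sourceNorm J p.1 := by gcongr
        _ ≤ _ := by
          have : 0 ≤ c / (2 * G.k ^ 2) * (2 * Q) * (G.sourceNorm J p.1 * ‖G.β p.1.1‖) := by
            positivity
          linarith
  · set A₀ : ℂ := G.freq * G.mu * G.β p.1.1 / (2 * G.k ^ 2) * G.coef J p.1.1 1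
    set B₀ : ℂ := Complex.I * G.freq * G.mu / (2 * G.k ^ 2) * G.coef J p.1.1 2
    let p1 : ModeIdx := tmIdx hn
    let p2 : ModeIdx := loIdx hn
    have hν : G.modeNorm p1 = √(G.eig p.1.1) * G.modeNorm p2 := G.modeNorm_tmIdx hn
    have h1 : ‖G.coef J p.1.1 1‖ * G.modeNorm p1 ≤ G.sourceNorm J p.1 :=
      (G.norm_coef_mul_modeNorm J p1).trans_le (G.norm_hat_le_sourceNorm J p1)
    have h2 : ‖G.coef J p.1.1 2‖ * G.modeNorm p2 ≤ G.sourceNorm J p.1 :=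
      (G.norm_coef_mul_modeNorm J p2).trans_le (G.norm_hat_le_sourceNorm J p2)
    have nA : ‖A₀‖ = c / (2 * G.k ^ 2) * (‖G.β p.1.1‖ * ‖G.coef J p.1.1 1‖) := by
      simp only [A₀, norm_mul, norm_div, norm_pow, nω, nμ, nk, Complex.norm_two]
      ring
    have nB : ‖B₀‖ = c / (2 * G.k ^ 2) * ‖G.coef J p.1.1 2‖ := by
      simp only [B₀, norm_mul, norm_div, norm_pow, nω, nμ, nk, Complex.norm_two, hI]
      ring
    have hg : 0 ≤ c / (2 * m ^ 2) * (G.sourceNorm J p.1 * ‖G.β p.1.1‖) := by positivity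
    have hc2 : 0 ≤ c / (2 * G.k ^ 2) := by positivity
    have hs0 := Real.sqrt_nonneg (G.eig p.1.1)
    have hss := Real.mul_self_sqrt (G.eig_pos p.1).le
    have hν1 := G.modeNorm_pos p1
    have hν2 := G.modeNorm_pos p2
    have hA1 : ‖A₀‖ * G.modeNorm p1 ≤
        c / (2 * G.k ^ 2) * (Q * (G.sourceNorm J p.1 * ‖G.β p.1.1‖)) := by
      rw [nA]
      calc _ = c / (2 * G.k ^ 2) * (‖G.β p.1.1‖ * (‖G.coef J p.1.1 1‖ * G.modeNorm p1)) := by ring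
        _ ≤ c / (2 * G.k ^ 2) * (‖G.β p.1.1‖ * G.sourceNorm J p.1) := by gcongr
        _ = c / (2 * G.k ^ 2) * (1 * (G.sourceNorm J p.1 * ‖G.β p.1.1‖)) := by ring
        _ ≤ _ := by gcongr
    have hB1 : ‖B₀‖ * G.modeNorm p1 ≤
        c / (2 * G.k ^ 2) * (Q * (G.sourceNorm J p.1 * ‖G.β p.1.1‖)) := by
      rw [nB, hν]
      calc _ = c / (2 * G.k ^ 2) * (√(G.eig p.1.1) * (‖G.coef J p.1.1 2‖ * G.modeNorm p2)) := by
            ring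
        _ ≤ c / (2 * G.k ^ 2) * (Q * ‖G.β p.1.1‖ * G.sourceNorm J p.1) := by gcongr
        _ = _ := by ring
    rcases hs with hs | hs
    · refine ⟨-1, A₀, B₀, by simp, ?_, ?_, ?_, ?_⟩
      · rw [hs]; simp only [aPlus, bPlus]; ring
      · rw [hs]; simp only [bPlus]; rfl
      · rw [hs]; simp only [bMinus]; rfl
      · have hp : G.modeNorm p = G.modeNorm p1 := by
          congr 1; exact Sigma.ext rfl (heq_of_eq (Fin.ext hs))
        rw [hp, add_mul]
        linarith
    · refine ⟨1, Complex.I * G.eig p.1.1 / G.β p.1.1 * A₀, Complex.I * G.eig p.1.1 / G.β p.1.1 * B₀,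
        by simp, ?_, ?_, ?_, ?_⟩
      · rw [hs]; simp only [aPlus, bPlus]; ring
      · rw [hs]; simp only [bPlus]; ring
      · rw [hs]; simp only [bMinus]; ring
      · have hp : G.modeNorm p = G.modeNorm p2 := by
          congr 1; exact Sigma.ext rfl (heq_of_eq (Fin.ext hs))
        have nF : ‖Complex.I * G.eig p.1.1 / G.β p.1.1‖ = G.eig p.1.1 / ‖G.β p.1.1‖ := by
          rw [norm_div, norm_mul, hI, one_mul, ncoe _ (G.eig_pos p.1).le]
        have hF : √(G.eig p.1.1) / ‖G.β p.1.1‖ ≤ Q := by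
          rw [div_le_iff₀ hb0]; exact hsq
        rw [hp, norm_mul _ A₀, norm_mul _ B₀, nF, add_mul]
        -- The factor λ/|β| is compensated by the |β| in the tm amplitude and by the ratio √λ
        -- between the norms of tm and lo, so that a single √λ is left.
        have hA2 : G.eig p.1.1 / ‖G.β p.1.1‖ * ‖A₀‖ * G.modeNorm p2 ≤
            c / (2 * G.k ^ 2) * (Q * (G.sourceNorm J p.1 * ‖G.β p.1.1‖)) := by
          have : G.eig p.1.1 / ‖G.β p.1.1‖ * ‖A₀‖ * G.modeNorm p2 = c / (2 * G.k ^ 2) *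
              (√(G.eig p.1.1) * (‖G.coef J p.1.1 1‖ * G.modeNorm p1)) := by
            rw [nA, hν]; field_simp
            rw [sq, hss]; ring
          rw [this]
          calc _ ≤ c / (2 * G.k ^ 2) * (Q * ‖G.β p.1.1‖ * G.sourceNorm J p.1) := by gcongr
            _ = _ := by ring
        have hB2 : G.eig p.1.1 / ‖G.β p.1.1‖ * ‖B₀‖ * G.modeNorm p2 ≤
            c / (2 * G.k ^ 2) * (Q * (G.sourceNorm J p.1 * ‖G.β p.1.1‖)) := by
          rw [nB]
          calc _ = c / (2 * G.k ^ 2) * (G.eig p.1.1 / ‖G.β p.1.1‖ *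
                (‖G.coef J p.1.1 2‖ * G.modeNorm p2)) := by ring
            _ ≤ c / (2 * G.k ^ 2) * (Q * ‖G.β p.1.1‖ * G.sourceNorm J p.1) := by
                gcongr
                rw [div_le_iff₀ hb0]
                linarith
            _ = _ := by ring
        linarith

theorem exists_norm_profile_le (hcut : ∀ n : Idx, G.eig n.1 ≠ G.k ^ 2) (J : ℝ × ℝ → Fin 3 → ℂ) :
    ∃ K : ℝ, 0 ≤ K ∧ ∀ (p : ModeIdx), ∀ t < 0, ‖G.profile J p.1.1 p.2 t‖ * G.modeNorm p ≤
      K * G.sourceNorm J p.1 *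
        (‖G.β p.1.1‖ * Real.exp (-((G.β p.1.1).im * |t + G.L|))) := by
  obtain ⟨K, hK, h⟩ := G.exists_amplitudes hcut J
  refine ⟨2 * K, by positivity, fun p t ht => ?_⟩
  obtain ⟨σ, A, B, hσ, ha, hb, hc, hAB⟩ := h p
  have h1 := norm_pw_le (A := A) (B := B) (G.β_im_nonneg p.1.1) hσ ht G.L_pos
  rw [← ha, ← hb, ← hc] at h1
  have hν := G.modeNorm_pos p
  calc _ ≤ 2 * (‖A‖ + ‖B‖) * Real.exp (-((G.β p.1.1).im * |t + G.L|)) * G.modeNorm p :=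
        mul_le_mul_of_nonneg_right h1 hν.le
    _ = 2 * Real.exp (-((G.β p.1.1).im * |t + G.L|)) * ((‖A‖ + ‖B‖) * G.modeNorm p) := by ring
    _ ≤ 2 * Real.exp (-((G.β p.1.1).im * |t + G.L|)) *
        (K * (G.sourceNorm J p.1 * ‖G.β p.1.1‖)) := by gcongr
    _ = _ := by ring

/-! ### The functional generated by a mode -/

section Profile

variable {β : ℂ} {l : ℝ} {a b c : ℂ} {w : ℝ → ℂ}

theorem pwInt_congr {v : ℝ → ℂ} (h : ∀ t < 0, w t = v t) :
    pwInt β l a b c w = pwInt β l a b c v :=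
  setIntegral_congr_fun measurableSet_Iio fun t ht => by rw [h t ht]

theorem pwInt_linear (hl : 0 < l) {v : ℝ → ℂ} (hw : Continuous w) (hv : Continuous v)
    (hs : ∃ α : ℝ, ∀ t ≤ α, w t = 0) (hs' : ∃ α : ℝ, ∀ t ≤ α, v t = 0) (r s : ℂ) :
    pwInt β l a b c (fun t => r * w t + s * v t) =
      r * pwInt β l a b c w + s * pwInt β l a b c v := by
  obtain ⟨α, hα⟩ := hs
  obtain ⟨α', hα'⟩ := hs'
  rw [pwInt_add (w := fun t => r * w t) (v := fun t => s * v t) hl (by fun_prop) (by fun_prop)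
    ⟨α, fun t ht => by simp only [hα t ht, mul_zero]⟩
    ⟨α', fun t ht => by simp only [hα' t ht, mul_zero]⟩, pwInt_const_mul, pwInt_const_mul]

theorem pwInt_deriv_deriv (hl : 0 < l) {w' w'' : ℝ → ℂ} (hw : ∀ t, HasDerivAt w (w' t) t)
    (hw' : ∀ t, HasDerivAt w' (w'' t) t) (hw'' : Continuous w'')
    (hs : ∃ α : ℝ, ∀ t ≤ α, w t = 0) (hs' : ∃ α : ℝ, ∀ t ≤ α, w' t = 0)
    (hs'' : ∃ α : ℝ, ∀ t ≤ α, w'' t = 0) :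
    pwInt β l a b c w'' = (a + b) * w' 0 - (a * Complex.exp (-(Complex.I * β * l)) +
      (b - c) * Complex.exp (Complex.I * β * l)) * w' (-l) -
      (Complex.I * β * (a - b) * w 0 - Complex.I * β * (a * Complex.exp (-(Complex.I * β * l)) -
      (b - c) * Complex.exp (Complex.I * β * l)) * w (-l)) - β ^ 2 * pwInt β l a b c w := by
  have hc : Continuous w' := continuous_iff_continuousAt.2 fun t => (hw' t).continuousAt
  have e : pwInt β l (Complex.I * β * (Complex.I * β * a)) (-(Complex.I * β * -(Complex.I * β * b)))
      (-(Complex.I * β * -(Complex.I * β * c))) w = -β ^ 2 * pwInt β l a b c w := by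
    rw [← pwInt_coeff_smul]
    congr 1
    · linear_combination β ^ 2 * a * Complex.I_sq
    · linear_combination β ^ 2 * b * Complex.I_sq
    · linear_combination β ^ 2 * c * Complex.I_sq
  rw [pwInt_deriv hl hw' hw'' hs' hs'', pwInt_deriv hl hw hc hs hs', e]
  ring

end Profile

theorem exists_bound_testFields (V : testFields) : ∃ R > 0, ∀ x, R ≤ |x.2| → V.1 x = 0 := by
  obtain ⟨R, hR⟩ := V.2.2
  refine ⟨|R| + 1, by positivity, fun x hx => hR x ?_⟩
  linarith [le_abs_self R]

theorem pair_vanishes (Ψ : ℝ × ℝ → Fin 3 → ℂ) (V : testFields) :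
    ∃ α : ℝ, ∀ t ≤ α, G.pair Ψ V.1 t = 0 := by
  obtain ⟨R, hR, h⟩ := exists_bound_testFields V
  refine ⟨-R, fun t ht => G.pair_eq_zero Ψ fun x => h (x, t) ?_⟩
  rw [abs_of_nonpos (show t ≤ 0 by linarith)]
  show R ≤ -t
  linarith

/-- The contribution of a mode to the solution: the integral against the profile and the
longitudinal source term concentrated at `-L`. -/
def modeSol (J : ℝ × ℝ → Fin 3 → ℂ) (n : ℕ × ℕ) (s : ℕ) (V : (ℝ × ℝ) × ℝ → Fin 3 → ℂ) : ℂ :=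
  pwInt (G.β n) G.L (G.aPlus J n s) (G.bPlus J n s) (G.bMinus J n s) (G.pair (G.Φ n s) V) -
    (if s = 2 then Complex.I * G.freq * G.mu / (G.k : ℂ) ^ 2 * G.coef J n s else 0) *
      G.pair (G.Φ n s) V (-G.L)

section ModeSol

variable {J : ℝ × ℝ → Fin 3 → ℂ}

theorem modeSol_add (p : ModeIdx) (U V : testFields) : G.modeSol J p.1.1 p.2 (U + V).1 =
    G.modeSol J p.1.1 p.2 U.1 + G.modeSol J p.1.1 p.2 V.1 := by
  have hΦ := G.continuous_mode p
  have e : G.pair (G.Φ p.1.1 p.2) (U + V).1 =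
      fun t => G.pair (G.Φ p.1.1 p.2) U.1 t + G.pair (G.Φ p.1.1 p.2) V.1 t :=
    funext fun t => G.pair_add_right hΦ U.2.1.continuous V.2.1.continuous t
  rw [modeSol, modeSol, modeSol, e, pwInt_add G.L_pos (G.continuous_pair hΦ U.2.1.continuous)
    (G.continuous_pair hΦ V.2.1.continuous) (G.pair_vanishes _ U) (G.pair_vanishes _ V)]
  ring

theorem modeSol_smul (n : ℕ × ℕ) (s : ℕ) (r : ℂ) (V : testFields) :
    G.modeSol J n s (r • V).1 = r * G.modeSol J n s V.1 := by
  have e : G.pair (G.Φ n s) (r • V).1 = fun t => r * G.pair (G.Φ n s) V.1 t :=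
    funext fun t => G.pair_smul_right r _ _ t
  rw [modeSol, modeSol, e, pwInt_const_mul]
  ring

theorem modeSol_eq_zero (n : ℕ × ℕ) (s : ℕ) {V : (ℝ × ℝ) × ℝ → Fin 3 → ℂ}
    (h : ∀ t, G.pair (G.Φ n s) V t = 0) : G.modeSol J n s V = 0 := by
  rw [modeSol, h]
  simp [pwInt, h]

theorem pair_eq_modeNorm_mul_cf (p : ModeIdx) (V : (ℝ × ℝ) × ℝ → Fin 3 → ℂ) (t : ℝ) :
    G.pair (G.Φ p.1.1 p.2) V t = G.modeNorm p * G.cf p V t := by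
  rw [cf, mul_div_cancel₀ _ (G.modeNorm_ne_zero p)]

/-- A bound uniform in the modes that depends on the interval (a, b) only through its length. Of the
summand 3, the evanescent profiles take 2 and the term on the source plane takes 1. -/
theorem exists_norm_modeSol_le (hcut : ∀ n : Idx, G.eig n.1 ≠ G.k ^ 2) (J : ℝ × ℝ → Fin 3 → ℂ) :
    ∃ K : ℝ, 0 ≤ K ∧ ∀ (p : ModeIdx) (V : (ℝ × ℝ) × ℝ → Fin 3 → ℂ) (a b s : ℝ), a ≤ b → 0 ≤ s →
      (∀ t < 0, ‖G.cf p V t‖ ≤ s) → (∀ t < 0, t ∉ Ioo a b → G.cf p V t = 0) →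
      ‖G.modeSol J p.1.1 p.2 V‖ ≤ K * (G.k * (b - a) + 3) * (G.sourceNorm J p.1 * s) := by
  obtain ⟨K, hK, hprof⟩ := G.exists_norm_profile_le hcut J
  have hk := G.k_pos
  have hω := G.freq_pos
  have hμ := G.mu_pos
  refine ⟨K + G.freq * G.mu / G.k ^ 2, by positivity, fun p V a b s hab hs hcf hout => ?_⟩
  have hd := G.sourceNorm_nonneg J p.1
  have hν := G.modeNorm_pos p
  have hβi := G.β_im_nonneg p.1.1
  let g : ℝ → ℝ := (Ioo a b).indicator fun t => K * G.sourceNorm J p.1 * s *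
    (‖G.β p.1.1‖ * Real.exp (-((G.β p.1.1).im * |t + G.L|)))
  have hgc : Continuous fun t : ℝ => K * G.sourceNorm J p.1 * s *
    (‖G.β p.1.1‖ * Real.exp (-((G.β p.1.1).im * |t + G.L|))) := by fun_prop
  have hg0 : ∀ t, 0 ≤ g t := fun t => Set.indicator_nonneg (fun _ _ => by positivity) t
  have hgi : Integrable g := (integrable_indicator_iff measurableSet_Ioo).2
    (integrableOn_Ioo hgc a b)
  have h1 : ‖pwInt (G.β p.1.1) G.L (G.aPlus J p.1.1 p.2) (G.bPlus J p.1.1 p.2)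
      (G.bMinus J p.1.1 p.2) (G.pair (G.Φ p.1.1 p.2) V)‖ ≤
      K * G.sourceNorm J p.1 * s * (G.k * (b - a) + 2) := by
    have hle : ∀ t < 0, ‖G.profile J p.1.1 p.2 t * G.pair (G.Φ p.1.1 p.2) V t‖ ≤ g t :=
      fun t ht => by
        by_cases hm : t ∈ Ioo a b
        · simp only [g, Set.indicator_of_mem hm]
          rw [pair_eq_modeNorm_mul_cf, norm_mul, norm_mul, Complex.norm_real,
            Real.norm_of_nonneg hν.le, ← mul_assoc]
          calc _ ≤ K * G.sourceNorm J p.1 *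
                (‖G.β p.1.1‖ * Real.exp (-((G.β p.1.1).im * |t + G.L|))) * s :=
                mul_le_mul (hprof p t ht) (hcf t ht) (norm_nonneg _) (by positivity)
            _ = _ := by ring
        · rw [pair_eq_modeNorm_mul_cf, hout t ht hm, mul_zero, mul_zero, norm_zero]
          exact hg0 t
    calc _ ≤ ∫ t in Iio 0, g t := norm_integral_le_of_norm_le hgi.integrableOn
          ((ae_restrict_iff' measurableSet_Iio).2 (ae_of_all _ hle))
      _ ≤ ∫ t, g t := setIntegral_le_integral hgi (ae_of_all _ hg0)
      _ = K * G.sourceNorm J p.1 * s * ∫ t in Ioo a b, ‖G.β p.1.1‖ *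
          Real.exp (-((G.β p.1.1).im * |t + G.L|)) := by
        rw [integral_indicator measurableSet_Ioo, integral_const_mul]
      _ ≤ _ := mul_le_mul_of_nonneg_left (G.integral_norm_β_exp_le (hcut p.1) hab) (by positivity)
  have h2 : ‖(if (p.2 : ℕ) = 2 then Complex.I * G.freq * G.mu / (G.k : ℂ) ^ 2 *
      G.coef J p.1.1 p.2 else 0) * G.pair (G.Φ p.1.1 p.2) V (-G.L)‖ ≤
      G.freq * G.mu / G.k ^ 2 * (G.sourceNorm J p.1 * s) := by
    have hc1 : ‖(if (p.2 : ℕ) = 2 then Complex.I * G.freq * G.mu / (G.k : ℂ) ^ 2 *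
      G.coef J p.1.1 p.2 else 0)‖ ≤ G.freq * G.mu / G.k ^ 2 * ‖G.coef J p.1.1 p.2‖ := by
      split_ifs
      · rw [norm_mul, norm_div, norm_mul, norm_mul, norm_pow, Complex.norm_I, Complex.norm_real,
          Complex.norm_real, Complex.norm_real, Real.norm_of_nonneg hω.le, Real.norm_of_nonneg hμ.le,
          Real.norm_of_nonneg hk.le, one_mul]
      · rw [norm_zero]; positivity
    rw [pair_eq_modeNorm_mul_cf, norm_mul, norm_mul, Complex.norm_real, Real.norm_of_nonneg hν.le]
    calc _ ≤ G.freq * G.mu / G.k ^ 2 * ‖G.coef J p.1.1 p.2‖ * (G.modeNorm p * s) := by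
          gcongr
          exact hcf _ (neg_neg_of_pos G.L_pos)
      _ = G.freq * G.mu / G.k ^ 2 * ((‖G.coef J p.1.1 p.2‖ * G.modeNorm p) * s) := by ring
      _ ≤ _ := by
          rw [norm_coef_mul_modeNorm]
          gcongr
          exact G.norm_hat_le_sourceNorm J p
  rw [modeSol]
  refine (norm_sub_le _ _).trans ((add_le_add h1 h2).trans ?_)
  have h3 : 0 ≤ G.k * (b - a) := mul_nonneg hk.le (sub_nonneg.2 hab)
  have h4 : 0 ≤ G.sourceNorm J p.1 * s := by positivity
  have h5 : 0 ≤ G.freq * G.mu / G.k ^ 2 := by positivity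
  nlinarith [mul_nonneg hK h4, mul_nonneg (mul_nonneg h5 h4) h3, mul_nonneg h5 h4]

/-- The bound for the contributions of the modes in terms of the energies of a test field. -/
theorem norm_modeSol_le_energy {K : ℝ} (hK : ∀ (p : ModeIdx) (V : (ℝ × ℝ) × ℝ → Fin 3 → ℂ)
      (a b s : ℝ), a ≤ b → 0 ≤ s →
      (∀ t < 0, ‖G.cf p V t‖ ≤ s) → (∀ t < 0, t ∉ Ioo a b → G.cf p V t = 0) →
      ‖G.modeSol J p.1.1 p.2 V‖ ≤ K * (G.k * (b - a) + 3) * (G.sourceNorm J p.1 * s))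
    {V : (ℝ × ℝ) × ℝ → Fin 3 → ℂ} (hV : ContDiff ℝ ∞ V) {R : ℝ} (hR : 0 ≤ R)
    (h0 : ∀ x, x.2 ≤ -R → V x = 0) (p : ModeIdx) :
    ‖G.modeSol J p.1.1 p.2 V‖ ≤
      K * (G.k * R + 3) * (G.sourceNorm J p.1 * √(G.energy (-R) 0 V p)) := by
  have h := hK p V (-R) 0 _ (neg_nonpos.2 hR) (Real.sqrt_nonneg (G.energy (-R) 0 V p))
    (fun t ht => Real.le_sqrt_of_sq_le
      (G.norm_cf_sq_le hV (neg_nonpos.2 hR) (fun x s hs => h0 (x, s) hs.le) p ht.le))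
    (fun t ht hm => G.cf_eq_zero p fun x => h0 (x, t) (by
      by_contra hc
      exact hm ⟨not_le.1 hc, ht⟩))
  rwa [zero_sub, neg_neg] at h

theorem summable_sourceNorm_mul_sqrt (hJ : MemLp J 2 (volume.restrict G.Ω)) {f : ModeIdx → ℝ}
    (h0 : ∀ p, 0 ≤ f p) (hf : Summable f) : Summable fun p => G.sourceNorm J p.1 * √(f p) := by
  refine Summable.of_nonneg_of_le
    (fun p => mul_nonneg (G.sourceNorm_nonneg J p.1) (Real.sqrt_nonneg _)) (fun p => ?_)
    ((G.summable_sourceNorm_sq hJ).add hf)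
  have h1 := Real.sq_sqrt (h0 p)
  nlinarith [sq_nonneg (G.sourceNorm J p.1 - √(f p)), G.sourceNorm_nonneg J p.1,
    Real.sqrt_nonneg (f p), sq_nonneg (G.sourceNorm J p.1), h0 p]

theorem summable_norm_modeSol (hcut : ∀ n : Idx, G.eig n.1 ≠ G.k ^ 2)
    (hJ : MemLp J 2 (volume.restrict G.Ω)) (V : testFields) :
    Summable fun p : ModeIdx => ‖G.modeSol J p.1.1 p.2 V.1‖ := by
  obtain ⟨K, -, hK⟩ := G.exists_norm_modeSol_le hcut J
  obtain ⟨R, hR, hV⟩ := exists_bound_testFields V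
  have hV' : ∀ x, x.2 ≤ -R → V.1 x = 0 := fun x hx => hV x (by
    rw [abs_of_nonpos (by linarith)]; linarith)
  refine Summable.of_nonneg_of_le (fun _ => norm_nonneg _)
    (G.norm_modeSol_le_energy hK V.2.1 hR.le hV') (Summable.mul_left _ ?_)
  exact G.summable_sourceNorm_mul_sqrt hJ (G.energy_nonneg (neg_nonpos.2 hR.le) _)
    (G.summable_energy V.2.1 (neg_nonpos.2 hR.le))

/-! ### The sum of the mode contributions and its behaviour at infinity -/

/-- The solution of the boundary value problem. -/
def sol (hcut : ∀ n : Idx, G.eig n.1 ≠ G.k ^ 2) (hJ : MemLp J 2 (volume.restrict G.Ω)) :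
    testFields →ₗ[ℂ] ℂ where
  toFun V := ∑' p : ModeIdx, G.modeSol J p.1.1 p.2 V.1
  map_add' U V := by
    rw [← (G.summable_norm_modeSol hcut hJ U).of_norm.tsum_add
      (G.summable_norm_modeSol hcut hJ V).of_norm]
    exact tsum_congr fun p => G.modeSol_add p U V
  map_smul' r V := by
    rw [RingHom.id_apply, smul_eq_mul, ← tsum_mul_left]
    exact tsum_congr fun p => G.modeSol_smul _ _ r V

theorem sol_apply (hcut : ∀ n : Idx, G.eig n.1 ≠ G.k ^ 2) (hJ : MemLp J 2 (volume.restrict G.Ω))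
    (V : testFields) : G.sol hcut hJ V = ∑' p : ModeIdx, G.modeSol J p.1.1 p.2 V.1 := rfl

theorem sum_sourceNorm_mul_sqrt_le (hJ : MemLp J 2 (volume.restrict G.Ω)) {f : ModeIdx → ℝ}
    (h0 : ∀ p, 0 ≤ f p) {S : ℝ} (hf : ∀ F : Finset ModeIdx, ∑ p ∈ F, f p ≤ S)
    (F : Finset ModeIdx) : ∑ p ∈ F, G.sourceNorm J p.1 * √(f p) ≤
      √(∑' p : ModeIdx, G.sourceNorm J p.1 ^ 2) * √S := by
  refine (Real.sum_mul_le_sqrt_mul_sqrt F _ _).trans ?_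
  refine mul_le_mul (Real.sqrt_le_sqrt ?_) (Real.sqrt_le_sqrt ?_) (Real.sqrt_nonneg _)
    (Real.sqrt_nonneg _)
  · exact (G.summable_sourceNorm_sq hJ).sum_le_tsum F fun _ _ => sq_nonneg _
  · simp only [Real.sq_sqrt (h0 _)]
    exact hf F

theorem isCrossSectionL2_sol (hcut : ∀ n : Idx, G.eig n.1 ≠ G.k ^ 2)
    (hJ : MemLp J 2 (volume.restrict G.Ω)) : G.IsCrossSectionL2 (G.sol hcut hJ) := by
  intro R
  obtain ⟨K, hK0, hK⟩ := G.exists_norm_modeSol_le hcut J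
  have hk := G.k_pos
  set r : ℝ := |R| + 1
  have hr : 0 ≤ r := by positivity
  -- Order N = 1 suffices because the energies involve only ∂₃V; r exceeds R so that V vanishes also
  -- at x₃ = -r.
  refine ⟨1, K * (G.k * r + 3) * (√(∑' p : ModeIdx, G.sourceNorm J p.1 ^ 2) * r),
    fun V hV M hM hVM => ?_⟩
  have h0 : ∀ x, x.2 ≤ -r → V.1 x = 0 := fun x hx => hV x (by
    have := le_abs_self R
    linarith)
  have he : ∀ F : Finset ModeIdx, ∑ p ∈ F, G.energy (-r) 0 V.1 p ≤ (r * M) ^ 2 := fun F => by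
    have := G.sum_energy_le V.2.1 (neg_nonpos.2 hr) (M := M)
      (fun t ht => hVM 1 le_rfl t ht.2) F
    rwa [zero_sub, neg_neg, ← mul_pow] at this
  have hb := G.norm_modeSol_le_energy hK V.2.1 hr h0
  have hs := G.summable_norm_modeSol hcut hJ V
  rw [sol_apply]
  refine (norm_tsum_le_tsum_norm hs).trans (hs.tsum_le_of_sum_le fun F => ?_)
  calc ∑ p ∈ F, ‖G.modeSol J p.1.1 p.2 V.1‖
      ≤ ∑ p ∈ F, K * (G.k * r + 3) * (G.sourceNorm J p.1 * √(G.energy (-r) 0 V.1 p)) :=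
        Finset.sum_le_sum fun p _ => hb p
    _ = K * (G.k * r + 3) * ∑ p ∈ F, G.sourceNorm J p.1 * √(G.energy (-r) 0 V.1 p) := by
        rw [Finset.mul_sum]
    _ ≤ K * (G.k * r + 3) * (√(∑' p : ModeIdx, G.sourceNorm J p.1 ^ 2) * √((r * M) ^ 2)) := by
        gcongr
        exact G.sum_sourceNorm_mul_sqrt_le hJ (G.energy_nonneg (neg_nonpos.2 hr) _) he F
    _ = _ := by
        rw [Real.sqrt_sq (by positivity)]
        ring

theorem pair_shift (Ψ : ℝ × ℝ → Fin 3 → ℂ) (τ : ℝ) (V : testFields) (t : ℝ) :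
    G.pair Ψ (shift τ V).1 t = G.pair Ψ V.1 (t + τ) := rfl

theorem cf_shift (p : ModeIdx) (τ : ℝ) (V : testFields) (t : ℝ) :
    G.cf p (shift τ V).1 t = G.cf p V.1 (t + τ) := rfl

/-- Translation moves the support interval without changing its length, and the coefficients of the
translate are bounded by the energies of V itself on (-R, R). The resulting series does not involve
τ. -/
theorem isBoundedAtInfinity_sol (hcut : ∀ n : Idx, G.eig n.1 ≠ G.k ^ 2)
    (hJ : MemLp J 2 (volume.restrict G.Ω)) : IsBoundedAtInfinity (G.sol hcut hJ) := by
  intro V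
  obtain ⟨K, hK0, hK⟩ := G.exists_norm_modeSol_le hcut J
  obtain ⟨R, hR, hV⟩ := exists_bound_testFields V
  have hab : -R ≤ R := by linarith
  refine ⟨∑' p : ModeIdx, K * (G.k * (R - -R) + 3) *
    (G.sourceNorm J p.1 * √(G.energy (-R) R V.1 p)), fun τ _ => ?_⟩
  have hs := G.summable_norm_modeSol hcut hJ (shift τ V)
  have hs2 : Summable fun p : ModeIdx => K * (G.k * (R - -R) + 3) *
      (G.sourceNorm J p.1 * √(G.energy (-R) R V.1 p)) :=
    Summable.mul_left _ (G.summable_sourceNorm_mul_sqrt hJ (G.energy_nonneg hab _)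
      (G.summable_energy V.2.1 hab))
  rw [sol_apply]
  refine (norm_tsum_le_tsum_norm hs).trans (hs.tsum_le_tsum (fun p => ?_) hs2)
  have hout : ∀ t, t ∉ Ioo (-R) R → G.cf p V.1 t = 0 := fun t ht =>
    G.cf_eq_zero p fun x => hV (x, t) (by
      by_contra hc
      exact ht (abs_lt.1 (not_le.1 hc)))
  have h := hK p (shift τ V).1 (-R - τ) (R - τ) _ (by linarith)
    (Real.sqrt_nonneg (G.energy (-R) R V.1 p)) (fun t _ => ?_) (fun t _ ht => ?_)
  · rwa [show R - τ - (-R - τ) = R - -R by ring] at h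
  · rw [cf_shift]
    rcases le_or_gt (t + τ) R with ht | ht
    · refine Real.le_sqrt_of_sq_le (G.norm_cf_sq_le V.2.1 hab (fun x s hs => hV (x, s) ?_) p ht)
      rw [abs_of_neg (show s < 0 by linarith)]
      show R ≤ -s
      linarith
    · rw [hout _ fun hm => by linarith [hm.2], norm_zero]
      exact Real.sqrt_nonneg _
  · rw [cf_shift]
    refine hout _ fun hm => ht ⟨by linarith [hm.1], by linarith [hm.2]⟩

/-- The expression is not only small but eventually zero: once the test field lies below the source,
it sees only the wave exp(-iβt), which is annihilated by g ↦ g' + iβg. -/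
theorem isOutgoing_sol (hcut : ∀ n : Idx, G.eig n.1 ≠ G.k ^ 2)
    (hJ : MemLp J 2 (volume.restrict G.Ω)) : G.IsOutgoing (G.sol hcut hJ) := by
  intro p _ V h hVh
  obtain ⟨R, hR, hV⟩ := exists_bound_testFields V
  refine tendsto_const_nhds.congr' ?_
  filter_upwards [eventually_gt_atTop (R + G.L)] with τ hτ
  have hpair : ∀ q : ModeIdx, ∀ t, G.pair (G.Φ q.1.1 q.2) V.1 t =
      h t * G.innerΩ (G.Φ q.1.1 q.2) (G.Φ p.1.1 p.2) := fun q t => by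
    simp only [pair, hVh, dotProduct_smul, smul_eq_mul, innerΩ, G.star_mode]
    exact integral_const_mul _ _
  have hcomb : ∀ q : ModeIdx, ∀ t, G.pair (G.Φ q.1.1 q.2)
      (shift τ (-dz V + (Complex.I * G.β p.1.1) • V)).1 t =
      -G.pair (G.Φ q.1.1 q.2) (pd 2 V.1) (t + τ) +
        Complex.I * G.β p.1.1 * G.pair (G.Φ q.1.1 q.2) V.1 (t + τ) := fun q t => by
    have e : -dz V = (-1 : ℂ) • dz V :=
      Subtype.ext (funext fun x => (neg_one_smul ℂ ((dz V).1 x)).symm)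
    rw [pair_shift, e]
    refine (G.pair_add_right (G.continuous_mode q) ((-1 : ℂ) • dz V).2.1.continuous
      ((Complex.I * G.β p.1.1) • V).2.1.continuous (t + τ)).trans ?_
    refine congrArg₂ (· + ·) ((G.pair_smul_right _ _ _ _).trans ?_) (G.pair_smul_right _ _ _ _)
    rw [neg_one_mul]; rfl
  have hder : ∀ q : ModeIdx, ∀ t, HasDerivAt (fun t => G.pair (G.Φ q.1.1 q.2) V.1 (t + τ))
      (G.pair (G.Φ q.1.1 q.2) (pd 2 V.1) (t + τ)) t := fun q t =>
    (G.hasDerivAt_pair (G.continuous_mode q) V.2.1 (t + τ)).comp_add_const t τ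
  -- The test field is a multiple of mode p on every cross-section, so orthogonality removes all
  -- other contributions.
  rw [sol_apply, tsum_eq_single p]
  · set w : ℝ → ℂ := fun t => G.pair (G.Φ p.1.1 p.2) V.1 (t + τ) with hw
    set w' : ℝ → ℂ := fun t => G.pair (G.Φ p.1.1 p.2) (pd 2 V.1) (t + τ) with hw'
    have w0 : ∀ t, -G.L ≤ t → w t = 0 := fun t ht => G.pair_eq_zero _ fun x => hV (x, t + τ) (by
      rw [abs_of_pos (show 0 < t + τ by linarith)]
      show R ≤ t + τ
      linarith)
    have w0' : ∀ t, -G.L ≤ t → w' t = 0 := fun t ht => G.pair_eq_zero _ fun x => by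
      have hev : V.1 =ᶠ[𝓝 (x, t + τ)] fun _ => 0 := by
        have ho : IsOpen {y : (ℝ × ℝ) × ℝ | R < y.2} := isOpen_lt continuous_const (by fun_prop)
        filter_upwards [ho.mem_nhds (show R < t + τ by linarith)] with y hy
        exact hV y (hy.le.trans (le_abs_self _))
      simp [pd, hev.fderiv_eq]
    have hvan : ∀ U : testFields, ∃ α : ℝ, ∀ t ≤ α, G.pair (G.Φ p.1.1 p.2) U.1 (t + τ) = 0 :=
      fun U => by
        obtain ⟨α, hα⟩ := G.pair_vanishes (G.Φ p.1.1 p.2) U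
        exact ⟨α - τ, fun t ht => hα _ (by linarith)⟩
    have hcw : Continuous w :=
      (G.continuous_pair (G.continuous_mode p) V.2.1.continuous).comp (by fun_prop)
    have hcw' : Continuous w' :=
      (G.continuous_pair (G.continuous_mode p) (dz V).2.1.continuous).comp (by fun_prop)
    have e : G.pair (G.Φ p.1.1 p.2) (shift τ (-dz V + (Complex.I * G.β p.1.1) • V)).1 =
        fun t => (-1) * w' t + Complex.I * G.β p.1.1 * w t := funext fun t => by
      rw [hcomb, neg_one_mul]
    have hs := hvan V
    have hs' := hvan (dz V)
    have hD : G.pair (G.Φ p.1.1 p.2)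
        (shift τ (-dz V + (Complex.I * G.β p.1.1) • V)).1 (-G.L) = 0 := by
      rw [congrFun e, w0 _ le_rfl, w0' _ le_rfl]
      ring
    rw [modeSol, hD, e, pwInt_linear G.L_pos hcw' hcw hs' hs, pwInt_deriv (w := w) (w' := w') G.L_pos (hder p) hcw' hs hs',
      show w 0 = 0 from w0 0 (neg_nonpos.2 G.L_pos.le), w0 _ le_rfl,
      ← pwInt_coeff_smul (Complex.I * G.β p.1.1)]
    -- As w vanishes above the source, only the third coefficient of a profile matters, and the
    -- signs of the first two may be changed at will.
    have hz : pwInt (G.β p.1.1) G.L (Complex.I * G.β p.1.1 * G.aPlus J p.1.1 p.2)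
        (-(Complex.I * G.β p.1.1 * G.bPlus J p.1.1 p.2))
        (-(Complex.I * G.β p.1.1 * G.bMinus J p.1.1 p.2)) w =
        -pwInt (G.β p.1.1) G.L (Complex.I * G.β p.1.1 * G.aPlus J p.1.1 p.2)
        (Complex.I * G.β p.1.1 * G.bPlus J p.1.1 p.2)
        (Complex.I * G.β p.1.1 * G.bMinus J p.1.1 p.2) w := by
      rw [pwInt, pwInt, ← integral_neg]
      congr 1
      funext t
      simp only [pw]
      split_ifs with ht
      · rw [w0 t ht.le]; simp
      · ring
    rw [hz]
    ring
  · intro q hq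
    refine G.modeSol_eq_zero _ _ fun t => ?_
    have h1 : (fun t => G.pair (G.Φ q.1.1 q.2) V.1 (t + τ)) = fun _ => 0 := funext fun t => by
      rw [hpair, G.innerΩ_mode_eq_zero hq, mul_zero]
    have h2 : G.pair (G.Φ q.1.1 q.2) (pd 2 V.1) (t + τ) = 0 := by
      have := hder q t
      rw [h1] at this
      exact this.unique (hasDerivAt_const t 0)
    rw [hcomb, h2, congrFun h1 t]
    simp

end ModeSol

/-! ### Maxwell's equations -/

theorem mult_pos (n : ℕ × ℕ) : 0 < mult n := by
  unfold mult; split_ifs <;> norm_num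

/-- The index of the transverse electric mode. -/
def teIdx (n : Idx) : ModeIdx := ⟨n, ⟨0, mult_pos n.1⟩⟩

section Maxwell

variable {J : ℝ × ℝ → Fin 3 → ℂ} {V : testFields}

theorem pair_maxwell (hV : G.TangentialZero V.1) (p : ModeIdx) {t : ℝ} (ht : t < 0) :
    G.pair (G.Φ p.1.1 p.2) (curlT (curlT V) - ((G.k : ℂ) ^ 2) • V).1 t =
      G.pair (rot (rot (G.Φ p.1.1 p.2))) V.1 t +
      G.pair (crossAxis (rot (G.Φ p.1.1 p.2))) (pd 2 V.1) t +
      (G.pair (rot (crossAxis (G.Φ p.1.1 p.2))) (pd 2 V.1) t +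
        G.pair (crossAxis (crossAxis (G.Φ p.1.1 p.2))) (pd 2 (pd 2 V.1)) t) -
      (G.k : ℂ) ^ 2 * G.pair (G.Φ p.1.1 p.2) V.1 t := by
  rw [← G.pair_curl_curl (G.contDiff_mode p) (G.wallZero_mode p) V.2.1 hV ht,
    ← G.pair_smul_right]
  exact G.pair_sub_right (G.continuous_mode p) (curlT (curlT V)).2.1.continuous
    (((G.k : ℂ) ^ 2) • V).2.1.continuous t

theorem pair_endWall (hV : G.TangentialZero V.1) {Ψ : ℝ × ℝ → Fin 3 → ℂ} (hΨ : ∀ x, Ψ x 2 = 0) :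
    G.pair Ψ V.1 0 = 0 := by
  refine setIntegral_eq_zero_of_forall_eq_zero fun x hx => ?_
  obtain ⟨h0, h1⟩ := hV.endWall G (prod_mono Ioo_subset_Icc_self Ioo_subset_Icc_self hx)
  simp [dotProduct, Fin.sum_univ_three, h0, h1, hΨ x]

theorem eig_eq_complex (n : ℕ × ℕ) : (G.eig n : ℂ) = (G.kx n ^ 2 + G.ky n ^ 2 : ℂ) := by
  rw [eig_eq]; push_cast; rfl

theorem cexp_mul_cexp_neg (z : ℂ) : Complex.exp z * Complex.exp (-z) = 1 := by
  rw [← Complex.exp_add]; simp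

/-- The te profile solves g'' + β²g = 0 on both sides of the source, vanishes at 0 and is continuous
at -L, where its derivative jumps by -iωμ times the source coefficient. Two integrations by parts
leave only this jump. -/
theorem modeSol_te (hcut : ∀ n : Idx, G.eig n.1 ≠ G.k ^ 2) (hV : G.TangentialZero V.1) (n : Idx) :
    G.modeSol J n.1 0 (curlT (curlT V) - ((G.k : ℂ) ^ 2) • V).1 =
      Complex.I * G.freq * G.mu * (G.coef J n.1 0 * G.pair (G.Φ n.1 0) V.1 (-G.L)) := by
  obtain ⟨r, -, hr⟩ := G.exists_Φ_eq_smul_te n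
  have hβ := G.β_ne_zero (hcut n)
  have hΦ : ContDiff ℝ ∞ (G.Φ n.1 0) := G.contDiff_mode (teIdx n)
  have r1 : rot (rot (G.Φ n.1 0)) = (G.eig n.1 : ℂ) • G.Φ n.1 0 := by
    rw [hr, rot_const_smul, rot_const_smul, rot_rot_te, eig_eq_complex, smul_comm]
  have r2 : crossAxis (rot (G.Φ n.1 0)) = 0 := by
    rw [hr, rot_const_smul, crossAxis_const_smul, crossAxis_rot_te, smul_zero]
  have r3 : rot (crossAxis (G.Φ n.1 0)) = 0 := by
    rw [hr, crossAxis_const_smul, rot_const_smul, rot_crossAxis_te, smul_zero]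
  have r4 : crossAxis (crossAxis (G.Φ n.1 0)) = -G.Φ n.1 0 := by
    rw [hr, crossAxis_const_smul, crossAxis_const_smul, crossAxis_crossAxis_te, smul_neg]
  set w : ℝ → ℂ := G.pair (G.Φ n.1 0) V.1
  set w' : ℝ → ℂ := G.pair (G.Φ n.1 0) (dz V).1
  set w'' : ℝ → ℂ := G.pair (G.Φ n.1 0) (dz (dz V)).1
  have e : ∀ t < 0, G.pair (G.Φ n.1 0) (curlT (curlT V) - ((G.k : ℂ) ^ 2) • V).1 t =
      -G.β n.1 ^ 2 * w t + -1 * w'' t := fun t ht => by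
    have h : G.pair (G.Φ n.1 0) (curlT (curlT V) - ((G.k : ℂ) ^ 2) • V).1 t = _ :=
      G.pair_maxwell hV (teIdx n) ht
    change _ = G.pair (rot (rot (G.Φ n.1 0))) V.1 t +
      G.pair (crossAxis (rot (G.Φ n.1 0))) (pd 2 V.1) t +
      (G.pair (rot (crossAxis (G.Φ n.1 0))) (pd 2 V.1) t +
        G.pair (crossAxis (crossAxis (G.Φ n.1 0))) (pd 2 (pd 2 V.1)) t) -
      (G.k : ℂ) ^ 2 * G.pair (G.Φ n.1 0) V.1 t at h
    rw [h, r1, r2, r3, r4, pair_smul_left, pair_zero_left, pair_neg_left, β_sq]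
    change (G.eig n.1 : ℂ) * w t + 0 + (0 + -w'' t) - (G.k : ℂ) ^ 2 * w t = _
    ring
  have d : ∀ t, HasDerivAt w (w' t) t := G.hasDerivAt_pair hΦ.continuous V.2.1
  have d' : ∀ t, HasDerivAt w' (w'' t) t := G.hasDerivAt_pair hΦ.continuous (dz V).2.1
  have cw : Continuous w := G.continuous_pair hΦ.continuous V.2.1.continuous
  have cw'' : Continuous w'' := G.continuous_pair hΦ.continuous (dz (dz V)).2.1.continuous
  have w0 : w 0 = 0 := G.pair_endWall hV fun x => by rw [hr]; simp [te, sepField]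
  rw [modeSol, if_neg (by norm_num), zero_mul, sub_zero, pwInt_congr e,
    pwInt_linear G.L_pos cw cw'' (G.pair_vanishes _ V) (G.pair_vanishes _ (dz (dz V))),
    pwInt_deriv_deriv G.L_pos d d' cw'' (G.pair_vanishes _ V) (G.pair_vanishes _ (dz V))
      (G.pair_vanishes _ (dz (dz V))), w0]
  have hE := cexp_mul_cexp_neg (Complex.I * G.β n.1 * G.L)
  simp only [aPlus, bPlus, bMinus]
  generalize pwInt _ _ _ _ _ w = P
  generalize Complex.exp (Complex.I * G.β n.1 * G.L) = X at hE ⊢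
  generalize Complex.exp (-(Complex.I * G.β n.1 * G.L)) = Y at hE ⊢
  field_simp
  linear_combination ((2 : ℂ) * G.β n.1 * Complex.I * G.freq * G.mu * G.coef J n.1 0 * w (-G.L)) * hE

/-- The two contributions are not separately of the required form, since each equation contains both
coefficients. In the sum the cross terms cancel, provided the term on the source plane is included.
-/
theorem modeSol_tm_lo (hcut : ∀ n : Idx, G.eig n.1 ≠ G.k ^ 2) (hV : G.TangentialZero V.1) (n : Idx)
    (hn : n.1.1 * n.1.2 ≠ 0) :
    G.modeSol J n.1 1 (curlT (curlT V) - ((G.k : ℂ) ^ 2) • V).1 +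
      G.modeSol J n.1 2 (curlT (curlT V) - ((G.k : ℂ) ^ 2) • V).1 =
      Complex.I * G.freq * G.mu * (G.coef J n.1 1 * G.pair (G.Φ n.1 1) V.1 (-G.L)) +
      Complex.I * G.freq * G.mu * (G.coef J n.1 2 * G.pair (G.Φ n.1 2) V.1 (-G.L)) := by
  have hβ := G.β_ne_zero (hcut n)
  have hβ2 := G.β_sq n.1
  have hk : (G.k : ℂ) ≠ 0 := by exact_mod_cast G.k_pos.ne'
  have hΦ₁ : ContDiff ℝ ∞ (G.Φ n.1 1) := G.contDiff_mode (tmIdx hn)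
  have hΦ₂ : ContDiff ℝ ∞ (G.Φ n.1 2) := G.contDiff_mode (loIdx hn)
  have r1 : rot (rot (G.Φ n.1 1)) = 0 := by
    rw [G.Φ_one hn, rot_tm]; funext x i; fin_cases i <;> simp [rot, pd2]
  have r2 : crossAxis (rot (G.Φ n.1 1)) = 0 := by
    rw [G.Φ_one hn, rot_tm]; funext x i; fin_cases i <;> simp [crossAxis]
  have r3 : rot (crossAxis (G.Φ n.1 1)) = (G.eig n.1 : ℂ) • G.Φ n.1 2 := by
    rw [G.Φ_one hn, G.Φ_two hn, rot_crossAxis_tm, eig_eq_complex]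
  have r4 : crossAxis (crossAxis (G.Φ n.1 1)) = -G.Φ n.1 1 := by
    rw [G.Φ_one hn, crossAxis_crossAxis_tm]
  have s1 : rot (rot (G.Φ n.1 2)) = (G.eig n.1 : ℂ) • G.Φ n.1 2 := by
    rw [G.Φ_two hn, rot_rot_lo, eig_eq_complex]
  have s2 : crossAxis (rot (G.Φ n.1 2)) = -G.Φ n.1 1 := by
    rw [G.Φ_one hn, G.Φ_two hn, crossAxis_rot_lo]
  have s3 : rot (crossAxis (G.Φ n.1 2)) = 0 := by rw [G.Φ_two hn, rot_crossAxis_lo]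
  have s4 : crossAxis (crossAxis (G.Φ n.1 2)) = 0 := by rw [G.Φ_two hn, crossAxis_crossAxis_lo]
  set w : ℝ → ℂ := G.pair (G.Φ n.1 1) V.1
  set w' : ℝ → ℂ := G.pair (G.Φ n.1 1) (dz V).1
  set w'' : ℝ → ℂ := G.pair (G.Φ n.1 1) (dz (dz V)).1
  set v : ℝ → ℂ := G.pair (G.Φ n.1 2) V.1
  set v' : ℝ → ℂ := G.pair (G.Φ n.1 2) (dz V).1
  have e₁ : ∀ t < 0, G.pair (G.Φ n.1 1) (curlT (curlT V) - ((G.k : ℂ) ^ 2) • V).1 t =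
      1 * ((G.eig n.1 : ℂ) * v' t + -1 * w'' t) + -(G.k : ℂ) ^ 2 * w t := fun t ht => by
    have h : G.pair (G.Φ n.1 1) (curlT (curlT V) - ((G.k : ℂ) ^ 2) • V).1 t = _ :=
      G.pair_maxwell hV (tmIdx hn) ht
    change _ = G.pair (rot (rot (G.Φ n.1 1))) V.1 t +
      G.pair (crossAxis (rot (G.Φ n.1 1))) (pd 2 V.1) t +
      (G.pair (rot (crossAxis (G.Φ n.1 1))) (pd 2 V.1) t +
        G.pair (crossAxis (crossAxis (G.Φ n.1 1))) (pd 2 (pd 2 V.1)) t) -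
      (G.k : ℂ) ^ 2 * G.pair (G.Φ n.1 1) V.1 t at h
    rw [h, r1, r2, r3, r4, pair_smul_left, pair_zero_left, pair_zero_left, pair_neg_left]
    change 0 + 0 + ((G.eig n.1 : ℂ) * v' t + -w'' t) - (G.k : ℂ) ^ 2 * w t = _
    ring
  have e₂ : ∀ t < 0, G.pair (G.Φ n.1 2) (curlT (curlT V) - ((G.k : ℂ) ^ 2) • V).1 t =
      -G.β n.1 ^ 2 * v t + -1 * w' t := fun t ht => by
    have h : G.pair (G.Φ n.1 2) (curlT (curlT V) - ((G.k : ℂ) ^ 2) • V).1 t = _ :=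
      G.pair_maxwell hV (loIdx hn) ht
    change _ = G.pair (rot (rot (G.Φ n.1 2))) V.1 t +
      G.pair (crossAxis (rot (G.Φ n.1 2))) (pd 2 V.1) t +
      (G.pair (rot (crossAxis (G.Φ n.1 2))) (pd 2 V.1) t +
        G.pair (crossAxis (crossAxis (G.Φ n.1 2))) (pd 2 (pd 2 V.1)) t) -
      (G.k : ℂ) ^ 2 * G.pair (G.Φ n.1 2) V.1 t at h
    rw [h, s1, s2, s3, s4, pair_smul_left, pair_zero_left, pair_zero_left, pair_neg_left, β_sq]
    change (G.eig n.1 : ℂ) * v t + -w' t + (0 + 0) - (G.k : ℂ) ^ 2 * v t = _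
    ring
  have d : ∀ t, HasDerivAt w (w' t) t := G.hasDerivAt_pair hΦ₁.continuous V.2.1
  have d' : ∀ t, HasDerivAt w' (w'' t) t := G.hasDerivAt_pair hΦ₁.continuous (dz V).2.1
  have dv : ∀ t, HasDerivAt v (v' t) t := G.hasDerivAt_pair hΦ₂.continuous V.2.1
  have cw : Continuous w := G.continuous_pair hΦ₁.continuous V.2.1.continuous
  have cw' : Continuous w' := G.continuous_pair hΦ₁.continuous (dz V).2.1.continuous
  have cw'' : Continuous w'' := G.continuous_pair hΦ₁.continuous (dz (dz V)).2.1.continuous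
  have cv : Continuous v := G.continuous_pair hΦ₂.continuous V.2.1.continuous
  have cv' : Continuous v' := G.continuous_pair hΦ₂.continuous (dz V).2.1.continuous
  have vw : ∃ α : ℝ, ∀ t ≤ α, w t = 0 := G.pair_vanishes _ V
  have vw' : ∃ α : ℝ, ∀ t ≤ α, w' t = 0 := G.pair_vanishes _ (dz V)
  have vw'' : ∃ α : ℝ, ∀ t ≤ α, w'' t = 0 := G.pair_vanishes _ (dz (dz V))
  have vv : ∃ α : ℝ, ∀ t ≤ α, v t = 0 := G.pair_vanishes _ V
  have vv' : ∃ α : ℝ, ∀ t ≤ α, v' t = 0 := G.pair_vanishes _ (dz V)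
  have w0 : w 0 = 0 := G.pair_endWall hV fun x => by rw [G.Φ_one hn]; simp [tm, sepField]
  have hvw : ∃ α : ℝ, ∀ t ≤ α, (G.eig n.1 : ℂ) * v' t + -1 * w'' t = 0 := by
    obtain ⟨α, hα⟩ := vv'
    obtain ⟨α', hα'⟩ := vw''
    exact ⟨min α α', fun t ht => by
      rw [hα t (ht.trans (min_le_left _ _)), hα' t (ht.trans (min_le_right _ _))]; ring⟩
  have hL : -G.L < 0 := neg_neg_of_pos G.L_pos
  have ha : G.aPlus J n.1 1 = -G.bPlus J n.1 1 := rfl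
  set b := G.bPlus J n.1 1 with hb
  set c := G.bMinus J n.1 1 with hc
  -- The longitudinal profile is -λ/β² times the derivative of the tm profile on each side of the
  -- source, so integration by parts reduces it to tm quantities.
  have c1 : G.aPlus J n.1 2 =
      -(G.eig n.1 : ℂ) / G.β n.1 ^ 2 * (Complex.I * G.β n.1 * G.aPlus J n.1 1) := by
    rw [ha]
    change Complex.I * G.eig n.1 / G.β n.1 * b = _
    field_simp
  have c2 : G.bPlus J n.1 2 =
      -(G.eig n.1 : ℂ) / G.β n.1 ^ 2 * -(Complex.I * G.β n.1 * b) := by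
    change Complex.I * G.eig n.1 / G.β n.1 * b = _
    field_simp
  have c3 : G.bMinus J n.1 2 =
      -(G.eig n.1 : ℂ) / G.β n.1 ^ 2 * -(Complex.I * G.β n.1 * c) := by
    change Complex.I * G.eig n.1 / G.β n.1 * c = _
    field_simp
  rw [modeSol, modeSol, if_neg (by norm_num), if_pos rfl, zero_mul, sub_zero, pwInt_congr e₁,
    pwInt_congr e₂, e₂ _ hL, pwInt_linear (w := fun t => (G.eig n.1 : ℂ) * v' t + -1 * w'' t)
      G.L_pos (by fun_prop) cw hvw vw, pwInt_linear G.L_pos cv' cw'' vv' vw'',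
    pwInt_linear G.L_pos cv cw' vv vw', c1, c2, c3, pwInt_coeff_smul, pwInt_coeff_smul,
    pwInt_deriv_deriv G.L_pos d d' cw'' vw vw' vw'', pwInt_deriv G.L_pos dv cv' vv vv']
  -- Integrating w'' by parts once and twice gives two expressions for the same integral, hence the
  -- pairing of the differentiated profile with w'.
  have hP := pwInt_deriv_deriv (β := G.β n.1) (a := G.aPlus J n.1 1) (b := b) (c := c)
    G.L_pos d d' cw'' vw vw' vw''
  rw [pwInt_deriv G.L_pos d' cw'' vw' vw''] at hP
  rw [w0] at hP ⊢
  have hE := cexp_mul_cexp_neg (Complex.I * G.β n.1 * G.L)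
  have hb' : b = (G.freq * G.mu * G.β n.1 / (2 * G.k ^ 2) * G.coef J n.1 1 +
    Complex.I * G.freq * G.mu / (2 * G.k ^ 2) * G.coef J n.1 2) *
      Complex.exp (Complex.I * G.β n.1 * G.L) := rfl
  have hc' : c = G.freq * G.mu * G.β n.1 / (2 * G.k ^ 2) * G.coef J n.1 1 *
      (Complex.exp (Complex.I * G.β n.1 * G.L) - Complex.exp (-(Complex.I * G.β n.1 * G.L))) +
    Complex.I * G.freq * G.mu / (2 * G.k ^ 2) * G.coef J n.1 2 *
      (Complex.exp (Complex.I * G.β n.1 * G.L) + Complex.exp (-(Complex.I * G.β n.1 * G.L))) := rfl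
  rw [ha] at hP ⊢
  generalize Complex.exp (Complex.I * G.β n.1 * G.L) = X at *
  generalize Complex.exp (-(Complex.I * G.β n.1 * G.L)) = Y at *
  -- The jump of the tm profile at -L, produced by the longitudinal source. The next identity is the
  -- jump of its derivative divided by iβ, produced by the transverse source.
  have hJ₀ : -b * Y + (b - c) * X = -(Complex.I * G.freq * G.mu / G.k ^ 2 * G.coef J n.1 2) := by
    rw [hb', hc']
    linear_combination (-(Complex.I * G.freq * G.mu / G.k ^ 2 * G.coef J n.1 2)) * hE
  have hJ₁ : -b * Y - (b - c) * X = -(G.freq * G.mu * G.β n.1 / G.k ^ 2 * G.coef J n.1 1) := by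
    rw [hb', hc']
    linear_combination (-(G.freq * G.mu * G.β n.1 / G.k ^ 2 * G.coef J n.1 1)) * hE
  rw [hJ₀, hJ₁] at hP ⊢
  generalize pwInt (G.β n.1) G.L (-b) b c w = P at *
  generalize pwInt (G.β n.1) G.L (Complex.I * G.β n.1 * -b) (-(Complex.I * G.β n.1 * b))
    (-(Complex.I * G.β n.1 * c)) w' = P' at *
  generalize pwInt (G.β n.1) G.L (Complex.I * G.β n.1 * -b) (-(Complex.I * G.β n.1 * b))
    (-(Complex.I * G.β n.1 * c)) v = Q at *
  have hlam : (G.eig n.1 : ℂ) = (G.k : ℂ) ^ 2 - G.β n.1 ^ 2 := by rw [hβ2]; ring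
  have hP' : P' = Complex.I * G.β n.1 * (G.freq * G.mu * G.β n.1 / G.k ^ 2 * G.coef J n.1 1) *
      w (-G.L) + G.β n.1 ^ 2 * P := by
    linear_combination -hP
  rw [hP', hlam]
  field_simp
  ring

/-- The coefficients of the functional satisfy Maxwell's equations for each index pair. -/
theorem sum_modeSol (hcut : ∀ n : Idx, G.eig n.1 ≠ G.k ^ 2) (hV : G.TangentialZero V.1) (n : Idx) :
    ∑ s : Fin (mult n.1), G.modeSol J n.1 s (curlT (curlT V) - ((G.k : ℂ) ^ 2) • V).1 =
      ∑ s : Fin (mult n.1),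
        Complex.I * G.freq * G.mu * (G.coef J n.1 s * G.pair (G.Φ n.1 s) V.1 (-G.L)) := by
  rw [Fin.sum_univ_eq_sum_range (fun s => G.modeSol J n.1 s _),
    Fin.sum_univ_eq_sum_range (fun s => Complex.I * G.freq * G.mu *
      (G.coef J n.1 s * G.pair (G.Φ n.1 s) V.1 (-G.L)))]
  by_cases hn : n.1.1 * n.1.2 = 0
  · rw [mult, if_pos hn, Finset.sum_range_one, Finset.sum_range_one, G.modeSol_te hcut hV]
  · rw [mult, if_neg hn, Finset.sum_range_succ, Finset.sum_range_succ, Finset.sum_range_one,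
      Finset.sum_range_succ, Finset.sum_range_succ, Finset.sum_range_one, G.modeSol_te hcut hV,
      add_assoc, G.modeSol_tm_lo hcut hV n hn, add_assoc]

/-- Parseval on the source plane expands the right-hand side over the modes. Both series are grouped
by index pair, because the identity holds only after summation over s. -/
theorem solvesMaxwell_sol (hcut : ∀ n : Idx, G.eig n.1 ≠ G.k ^ 2)
    (hJ : MemLp J 2 (volume.restrict G.Ω)) : G.SolvesMaxwell J (G.sol hcut hJ) := by
  intro V hV
  have h := (G.hasSum_hat_mul_hat hJ (G.memLp_slice V.2.1.continuous (-G.L))).mul_left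
    (Complex.I * G.freq * G.mu)
  have e : ∀ p : ModeIdx, Complex.I * G.freq * G.mu *
      (G.hat p J * G.hat p fun x => V.1 (x, -G.L)) = Complex.I * G.freq * G.mu *
        (G.coef J p.1.1 p.2 * G.pair (G.Φ p.1.1 p.2) V.1 (-G.L)) := fun p => by
    rw [hat_slice, ← coef_mul_modeNorm, pair_eq_modeNorm_mul_cf]
    ring
  simp only [e] at h
  rw [← h.tsum_eq, sol_apply, (G.summable_norm_modeSol hcut hJ _).of_norm.tsum_sigma,
    h.summable.tsum_sigma]
  refine tsum_congr fun n => ?_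
  rw [tsum_fintype, tsum_fintype]
  exact G.sum_modeSol hcut hV n

theorem isSolution_sol (hcut : ∀ n : Idx, G.eig n.1 ≠ G.k ^ 2)
    (hJ : MemLp J 2 (volume.restrict G.Ω)) : G.IsSolution J (G.sol hcut hJ) where
  crossSectionL2 := G.isCrossSectionL2_sol hcut hJ
  maxwell := G.solvesMaxwell_sol hcut hJ
  bounded := G.isBoundedAtInfinity_sol hcut hJ
  outgoing := G.isOutgoing_sol hcut hJ

end Maxwell

/-! ### The field off the source plane -/

theorem norm_trigField_le {p q a b c s : ℝ} (ha : |a| ≤ s) (hb : |b| ≤ s) (hc : |c| ≤ s)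
    (x : ℝ × ℝ) : ‖trigField p q a b c x‖ ≤ s := by
  have hs : 0 ≤ s := (abs_nonneg a).trans ha
  have h : ∀ {r u v : ℝ}, |r| ≤ s → |u| ≤ 1 → |v| ≤ 1 → |r * u * v| ≤ s := fun hr hu hv => by
    rw [abs_mul, abs_mul]
    calc _ ≤ s * 1 * 1 := by gcongr
      _ = s := by ring
  rw [pi_norm_le_iff_of_nonneg hs]
  intro i
  fin_cases i <;>
    simp only [trigField, sepField, Complex.norm_real, Real.norm_eq_abs]
  · exact h ha (Real.abs_cos_le_one _) (Real.abs_sin_le_one _)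
  · exact h hb (Real.abs_sin_le_one _) (Real.abs_cos_le_one _)
  · exact h hc (Real.abs_sin_le_one _) (Real.abs_sin_le_one _)

/-- Normalized modes are uniformly bounded: for te and tm the squared amplitude is at most λ while
the squared norm is at least λL₁L₂/4, with the same rescaling on both sides; for lo the factor λ is
absent from both. -/
theorem norm_mode_sq_le (p : ModeIdx) (x : ℝ × ℝ) :
    G.L₁ * G.L₂ / 4 * ‖G.Φ p.1.1 p.2 x‖ ^ 2 ≤ G.modeNorm p ^ 2 := by
  have hL : 0 < G.L₁ * G.L₂ := mul_pos G.L₁_pos G.L₂_pos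
  have hm := G.innerΩ_mode_self p
  have hx : |G.kx p.1.1| ≤ √(G.eig p.1.1) :=
    Real.abs_le_sqrt (by rw [eig_eq]; linarith [sq_nonneg (G.ky p.1.1)])
  have hy : |G.ky p.1.1| ≤ √(G.eig p.1.1) :=
    Real.abs_le_sqrt (by rw [eig_eq]; linarith [sq_nonneg (G.kx p.1.1)])
  have h0 : |(0 : ℝ)| ≤ √(G.eig p.1.1) := by simp
  have hE := Real.sq_sqrt (G.eig_pos p.1).le
  rcases modeIdx_cases p with hs | ⟨hn, hs | hs⟩
  · obtain ⟨r, -, hr⟩ := G.exists_Φ_eq_smul_te p.1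
    obtain ⟨c, hc, h⟩ := G.innerΩ_te_self p.1
    rw [hs, hr, innerΩ_smul_left, innerΩ_smul_right, h] at hm
    have hm' : r ^ 2 * (G.eig p.1.1 * c) = G.modeNorm p ^ 2 := by
      have : ((r ^ 2 * (G.eig p.1.1 * c) : ℝ) : ℂ) = ((G.modeNorm p ^ 2 : ℝ) : ℂ) := by
        push_cast
        push_cast at hm
        rw [← hm]
        simp
        ring
      exact_mod_cast this
    have hte : ‖te (G.kx p.1.1) (G.ky p.1.1) x‖ ≤ √(G.eig p.1.1) := by
      rw [te_eq_trigField]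
      exact norm_trigField_le hy (by rwa [abs_neg]) h0 x
    rw [hs, hr, ← hm', Pi.smul_apply, norm_smul, mul_pow, Complex.norm_real, Real.norm_eq_abs,
      sq_abs]
    have h1 : ‖te (G.kx p.1.1) (G.ky p.1.1) x‖ ^ 2 ≤ G.eig p.1.1 := by
      rw [← hE]; gcongr
    calc _ = r ^ 2 * (‖te (G.kx p.1.1) (G.ky p.1.1) x‖ ^ 2 * (G.L₁ * G.L₂ / 4)) := by ring
      _ ≤ r ^ 2 * (G.eig p.1.1 * c) := by gcongr; exact (G.eig_pos p.1).le
  · rw [hs, G.Φ_one hn, G.innerΩ_tm_self hn] at hm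
    have hm' : G.eig p.1.1 * (G.L₁ * G.L₂ / 4) = G.modeNorm p ^ 2 := by exact_mod_cast hm
    have htm : ‖tm (G.kx p.1.1) (G.ky p.1.1) x‖ ≤ √(G.eig p.1.1) := by
      rw [tm_eq_trigField]
      exact norm_trigField_le hx hy h0 x
    rw [hs, G.Φ_one hn, ← hm']
    have h1 : ‖tm (G.kx p.1.1) (G.ky p.1.1) x‖ ^ 2 ≤ G.eig p.1.1 := by
      rw [← hE]; gcongr
    calc _ = ‖tm (G.kx p.1.1) (G.ky p.1.1) x‖ ^ 2 * (G.L₁ * G.L₂ / 4) := by ring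
      _ ≤ _ := by gcongr
  · rw [hs, G.Φ_two hn, G.innerΩ_lo_self hn] at hm
    have hm' : G.L₁ * G.L₂ / 4 = G.modeNorm p ^ 2 := by exact_mod_cast hm
    have hlo : ‖lo (G.kx p.1.1) (G.ky p.1.1) x‖ ≤ 1 := by
      rw [lo_eq_trigField]
      exact norm_trigField_le (by simp) (by simp) (by simp) x
    rw [hs, G.Φ_two hn, ← hm']
    have h1 : ‖lo (G.kx p.1.1) (G.ky p.1.1) x‖ ^ 2 ≤ 1 := pow_le_one₀ (norm_nonneg _) hlo
    calc _ ≤ G.L₁ * G.L₂ / 4 * 1 := by gcongr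
      _ = _ := by ring

theorem exists_norm_mode_le :
    ∃ C : ℝ, 0 ≤ C ∧ ∀ (p : ModeIdx) (x : ℝ × ℝ), ‖G.Φ p.1.1 p.2 x‖ ≤ C * G.modeNorm p := by
  have hL : 0 < G.L₁ * G.L₂ := mul_pos G.L₁_pos G.L₂_pos
  refine ⟨√(4 / (G.L₁ * G.L₂)), Real.sqrt_nonneg _, fun p x => ?_⟩
  have hν := G.modeNorm_pos p
  refine (sq_le_sq₀ (norm_nonneg _) (by positivity)).1 ?_
  rw [mul_pow, Real.sq_sqrt (by positivity), div_mul_eq_mul_div, le_div_iff₀ hL]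
  linarith [G.norm_mode_sq_le p x]

theorem summable_modeIdx {f : ℕ × ℕ → ℝ} (h0 : ∀ n, 0 ≤ f n) (hf : Summable f) :
    Summable fun p : ModeIdx => f p.1.1 := by
  refine (summable_sigma_of_nonneg fun _ => h0 _).2 ⟨fun n => (hasSum_fintype _).summable, ?_⟩
  simp only [tsum_fintype, Finset.sum_const, Finset.card_univ, Fintype.card_fin, nsmul_eq_mul]
  refine Summable.of_nonneg_of_le (fun n => mul_nonneg (Nat.cast_nonneg _) (h0 _)) (fun n => ?_)
    ((hf.comp_injective (Subtype.val_injective (p := fun n : ℕ × ℕ => n ≠ (0, 0)))).mul_left 3)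
  refine mul_le_mul_of_nonneg_right ?_ (h0 _)
  exact_mod_cast mult_le n.1

/-- For evanescent modes half of the decay absorbs |β|, by x ≤ exp x, and the other half is compared
with √λ through √λ ≤ k + |β|. The factor exp(kδ/2) accounts for the shift by k and also covers the
propagating modes, where √λ ≤ k. -/
theorem norm_β_mul_exp_le (n : Idx) (hn : G.eig n.1 ≠ G.k ^ 2) {δ : ℝ} (hδ : 0 < δ) :
    ‖G.β n.1‖ * Real.exp (-((G.β n.1).im * δ)) ≤
      (2 / δ + G.k) * Real.exp (G.k * δ / 2) * Real.exp (-(√(G.eig n.1) * δ / 2)) := by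
  have hk := G.k_pos
  have hE := Real.sq_sqrt (G.eig_pos n).le
  have hs := Real.sqrt_nonneg (G.eig n.1)
  rw [mul_assoc, ← Real.exp_add]
  rcases hn.lt_or_gt with h | h
  · rw [(G.β_of_lt h).1, zero_mul, neg_zero, Real.exp_zero, mul_one]
    have h1 : √(G.eig n.1) ≤ G.k := Real.sqrt_le_iff.2 ⟨hk.le, h.le⟩
    have h2 : (1 : ℝ) ≤ Real.exp (G.k * δ / 2 + -(√(G.eig n.1) * δ / 2)) := by
      rw [Real.one_le_exp_iff]
      nlinarith
    have h3 : 0 < 2 / δ := by positivity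
    calc ‖G.β n.1‖ ≤ G.k := G.norm_β_le_of_lt h
      _ ≤ (2 / δ + G.k) * 1 := by linarith
      _ ≤ _ := by gcongr
  · have hb := G.norm_β_sq n.1
    rw [abs_of_neg (by linarith)] at hb
    have hb0 := norm_nonneg (G.β n.1)
    have h1 : √(G.eig n.1) ≤ G.k + ‖G.β n.1‖ :=
      Real.sqrt_le_iff.2 ⟨by positivity, by nlinarith⟩
    rw [← G.norm_β_of_gt h]
    have h2 : ‖G.β n.1‖ ≤ 2 / δ * Real.exp (‖G.β n.1‖ * δ / 2) := by
      have := Real.add_one_le_exp (‖G.β n.1‖ * δ / 2)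
      rw [div_mul_eq_mul_div, le_div_iff₀ hδ]
      linarith
    calc _ ≤ 2 / δ * Real.exp (‖G.β n.1‖ * δ / 2) * Real.exp (-(‖G.β n.1‖ * δ)) := by gcongr
      _ = 2 / δ * Real.exp (-(‖G.β n.1‖ * δ / 2)) := by
        rw [mul_assoc, ← Real.exp_add]
        congr 2
        ring
      _ ≤ (2 / δ + G.k) * Real.exp (G.k * δ / 2 + -(√(G.eig n.1) * δ / 2)) := by
        gcongr
        · linarith
        · nlinarith

/-- Since √λ is at least (p + q)/2, the series is dominated by a product of two geometric series. -/
theorem summable_exp_sqrt_eig {δ : ℝ} (hδ : 0 < δ) :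
    Summable fun n : ℕ × ℕ => Real.exp (-(√(G.eig n) * δ / 2)) := by
  have hπ := Real.pi_pos
  have hL₁ := G.L₁_pos
  have hL₂ := G.L₂_pos
  have hgeo : ∀ l : ℝ, 0 < l → Summable fun n : ℕ => Real.exp (-(Real.pi / l * δ / 4)) ^ n :=
    fun l hl => summable_geometric_of_lt_one (Real.exp_pos _).le
      (Real.exp_lt_one_iff.2 (neg_neg_of_pos (by positivity)))
  refine Summable.of_nonneg_of_le (fun _ => (Real.exp_pos _).le) (fun n => ?_)
    ((hgeo _ hL₁).mul_of_nonneg (hgeo _ hL₂) (fun _ => by positivity) fun _ => by positivity)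
  rw [← Real.exp_nat_mul, ← Real.exp_nat_mul, ← Real.exp_add, Real.exp_le_exp]
  have hx : G.kx n ≤ √(G.eig n) :=
    Real.le_sqrt_of_sq_le (by rw [eig_eq]; linarith [sq_nonneg (G.ky n)])
  have hy : G.ky n ≤ √(G.eig n) :=
    Real.le_sqrt_of_sq_le (by rw [eig_eq]; linarith [sq_nonneg (G.kx n)])
  have e : (n.1 : ℝ) * -(Real.pi / G.L₁ * δ / 4) + n.2 * -(Real.pi / G.L₂ * δ / 4) =
      -((G.kx n + G.ky n) * δ / 4) := by rw [kx, ky]; ring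
  rw [e]
  nlinarith

section Field

variable {J : ℝ × ℝ → Fin 3 → ℂ}

/-- Away from the source plane summability comes from the exponential decay alone; of the source
coefficients only a common bound D is used. -/
theorem exists_majorant (hcut : ∀ n : Idx, G.eig n.1 ≠ G.k ^ 2)
    (hJ : MemLp J 2 (volume.restrict G.Ω)) {δ : ℝ} (hδ : 0 < δ) :
    ∃ u : ModeIdx → ℝ, Summable u ∧ ∀ (p : ModeIdx) (x : ℝ × ℝ), ∀ t < 0, δ ≤ |t + G.L| →
      ‖G.profile J p.1.1 p.2 t • G.Φ p.1.1 p.2 x‖ ≤ u p := by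
  obtain ⟨K, hK, hprof⟩ := G.exists_norm_profile_le hcut J
  obtain ⟨C, hC, hΦ⟩ := G.exists_norm_mode_le
  have hk := G.k_pos
  set D : ℝ := √(∑' p : ModeIdx, G.sourceNorm J p.1 ^ 2)
  have hD : ∀ p : ModeIdx, G.sourceNorm J p.1 ≤ D := fun p =>
    Real.le_sqrt_of_sq_le ((G.summable_sourceNorm_sq hJ).le_tsum p fun _ _ => sq_nonneg _)
  refine ⟨fun p => C * (K * D * ((2 / δ + G.k) * Real.exp (G.k * δ / 2) *
    Real.exp (-(√(G.eig p.1.1) * δ / 2)))), ?_, fun p x t ht hδt => ?_⟩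
  · exact ((((summable_modeIdx (fun _ => (Real.exp_pos _).le)
      (G.summable_exp_sqrt_eig hδ)).mul_left _).mul_left _).mul_left _)
  · have hd := G.sourceNorm_nonneg J p.1
    have hi := G.β_im_nonneg p.1.1
    beta_reduce
    rw [norm_smul]
    calc ‖G.profile J p.1.1 p.2 t‖ * ‖G.Φ p.1.1 p.2 x‖
        ≤ ‖G.profile J p.1.1 p.2 t‖ * (C * G.modeNorm p) := by gcongr; exact hΦ p x
      _ = C * (‖G.profile J p.1.1 p.2 t‖ * G.modeNorm p) := by ring
      _ ≤ C * (K * G.sourceNorm J p.1 *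
          (‖G.β p.1.1‖ * Real.exp (-((G.β p.1.1).im * |t + G.L|)))) := by
        exact mul_le_mul_of_nonneg_left (hprof p t ht) hC
      _ ≤ C * (K * D * (‖G.β p.1.1‖ * Real.exp (-((G.β p.1.1).im * δ)))) := by
        gcongr; exact hD p
      _ ≤ _ := by
        have hD0 : 0 ≤ D := Real.sqrt_nonneg _
        exact mul_le_mul_of_nonneg_left (mul_le_mul_of_nonneg_left
          (G.norm_β_mul_exp_le p.1 (hcut p.1) hδ) (by positivity)) hC

/-- The sum of the mode expansion. -/
def field (J : ℝ × ℝ → Fin 3 → ℂ) (x : (ℝ × ℝ) × ℝ) : Fin 3 → ℂ :=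
  ∑' p : ModeIdx, G.profile J p.1.1 p.2 x.2 • G.Φ p.1.1 p.2 x.1

theorem hasSum_field (hcut : ∀ n : Idx, G.eig n.1 ≠ G.k ^ 2)
    (hJ : MemLp J 2 (volume.restrict G.Ω)) (x : ℝ × ℝ) {t : ℝ} (ht : t < 0) (htL : t ≠ -G.L) :
    HasSum (fun p : ModeIdx => G.profile J p.1.1 p.2 t • G.Φ p.1.1 p.2 x) (G.field J (x, t)) := by
  have hδ : 0 < |t + G.L| := abs_pos.2 fun h => htL (by linarith)
  obtain ⟨u, hu, h⟩ := G.exists_majorant hcut hJ hδ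
  exact (Summable.of_norm_bounded hu fun p => h p x t ht le_rfl).hasSum

theorem continuousOn_pw (β : ℂ) (l : ℝ) (a b c : ℂ) : ContinuousOn (pw β l a b c) {t | t ≠ -l} := by
  intro t ht
  refine ContinuousAt.continuousWithinAt ?_
  rcases lt_or_gt_of_ne ht with h | h
  · refine ContinuousAt.congr (f := fun t : ℝ => c * Complex.exp (-(Complex.I * β * t)))
      (by fun_prop) ?_
    filter_upwards [Iio_mem_nhds h] with s hs
    rw [pw, if_neg (not_lt.2 (le_of_lt hs))]
  · refine ContinuousAt.congr (f := fun t : ℝ => a * Complex.exp (Complex.I * β * t) +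
      b * Complex.exp (-(Complex.I * β * t))) (by fun_prop) ?_
    filter_upwards [Ioi_mem_nhds h] with s hs
    rw [pw, if_pos (mem_Ioi.1 hs)]

theorem continuousOn_field (hcut : ∀ n : Idx, G.eig n.1 ≠ G.k ^ 2)
    (hJ : MemLp J 2 (volume.restrict G.Ω)) :
    ContinuousOn (G.field J) (G.W \ {x | x.2 = -G.L}) := by
  intro z hz
  have ht : z.2 < 0 := hz.1.2
  have htL : z.2 ≠ -G.L := hz.2
  refine ContinuousAt.continuousWithinAt ?_
  have hδ : 0 < |z.2 + G.L| := abs_pos.2 fun h => htL (by linarith)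
  -- Half the distance to the source plane, so that the majorant holds on a whole neighbourhood of
  -- the point.
  obtain ⟨u, hu, h⟩ := G.exists_majorant hcut hJ (half_pos hδ)
  set s : Set ((ℝ × ℝ) × ℝ) := {y | y.2 < 0} ∩ {y | |z.2 + G.L| / 2 < |y.2 + G.L|}
  have ho : IsOpen s :=
    (isOpen_lt continuous_snd continuous_const).inter
      (isOpen_lt continuous_const (continuous_snd.add continuous_const).abs)
  have hc : ∀ p : ModeIdx, ContinuousOn
      (fun y : (ℝ × ℝ) × ℝ => G.profile J p.1.1 p.2 y.2 • G.Φ p.1.1 p.2 y.1) s := fun p => by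
    have h1 : ContinuousOn (fun y : (ℝ × ℝ) × ℝ => G.profile J p.1.1 p.2 y.2) s := by
      refine (continuousOn_pw _ _ _ _ _).comp continuous_snd.continuousOn fun y hy he => ?_
      have h2 : |z.2 + G.L| / 2 < |y.2 + G.L| := hy.2
      rw [he, neg_add_cancel, abs_zero] at h2
      linarith
    exact h1.smul ((G.continuous_mode p).comp continuous_fst).continuousOn
  have hf : ContinuousOn (fun y : (ℝ × ℝ) × ℝ =>
      ∑' p : ModeIdx, G.profile J p.1.1 p.2 y.2 • G.Φ p.1.1 p.2 y.1) s :=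
    continuousOn_tsum hc hu fun p y hy => h p y.1 y.2 hy.1 (le_of_lt hy.2)
  exact hf.continuousAt (ho.mem_nhds ⟨ht, half_lt_self hδ⟩)

theorem norm_dotProduct_le (a b : Fin 3 → ℂ) : ‖a ⬝ᵥ b‖ ≤ 3 * (‖a‖ * ‖b‖) := by
  refine (norm_sum_le _ _).trans ?_
  calc ∑ i, ‖a i * b i‖ ≤ ∑ _i : Fin 3, ‖a‖ * ‖b‖ := Finset.sum_le_sum fun i _ => by
        rw [norm_mul]
        exact mul_le_mul (norm_le_pi_norm a i) (norm_le_pi_norm b i) (norm_nonneg _) (norm_nonneg _)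
    _ = _ := by simp

theorem measurableSet_W : MeasurableSet G.W := G.measurableSet_Ω.prod measurableSet_Iio

theorem integrableOn_W_of_testField (V : testFields) : IntegrableOn V.1 G.W := by
  obtain ⟨R, hR, hV⟩ := exists_bound_testFields V
  refine (V.2.1.continuous.continuousOn.integrableOn_compact (((isCompact_Icc (a := (0 : ℝ))
    (b := G.L₁)).prod (isCompact_Icc (a := (0 : ℝ)) (b := G.L₂))).prod
    (isCompact_Icc (a := -R) (b := 0)))).of_forall_sdiff_eq_zero G.measurableSet_W fun y hy => ?_
  refine hV y ?_
  have h1 : y.1 ∈ Icc 0 G.L₁ ×ˢ Icc 0 G.L₂ :=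
    prod_mono Ioo_subset_Icc_self Ioo_subset_Icc_self hy.1.1
  have h2 : y.2 < 0 := hy.1.2
  by_contra hc
  refine hy.2 ⟨h1, ?_, h2.le⟩
  linarith [neg_abs_le y.2]

theorem isFieldOffSource_field (hcut : ∀ n : Idx, G.eig n.1 ≠ G.k ^ 2)
    (hJ : MemLp J 2 (volume.restrict G.Ω)) :
    G.IsFieldOffSource (G.sol hcut hJ) (G.field J) where
  continuousOn := G.continuousOn_field hcut hJ
  represents := by
    rintro V ⟨δ, hδ, hV⟩
    obtain ⟨u, hu, hub⟩ := G.exists_majorant hcut hJ hδ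
    let F : ModeIdx → (ℝ × ℝ) × ℝ → ℂ := fun p y =>
      (G.profile J p.1.1 p.2 y.2 • G.Φ p.1.1 p.2 y.1) ⬝ᵥ V.1 y
    have hVi := (G.integrableOn_W_of_testField V).norm
    have hbd : ∀ p, ∀ y ∈ G.W, ‖F p y‖ ≤ u p * (3 * ‖V.1 y‖) := fun p y hy => by
      rcases lt_or_ge |y.2 + G.L| δ with h | h
      · simp only [F, hV y h, dotProduct_zero, norm_zero, mul_zero, le_refl]
      · calc _ ≤ 3 * (‖G.profile J p.1.1 p.2 y.2 • G.Φ p.1.1 p.2 y.1‖ * ‖V.1 y‖) :=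
              norm_dotProduct_le _ _
          _ ≤ 3 * (u p * ‖V.1 y‖) := by gcongr; exact hub p y.1 y.2 hy.2 h
          _ = _ := by ring
    have hsum : ∀ y ∈ G.W, HasSum (fun p => F p y) (G.field J y ⬝ᵥ V.1 y) := fun y hy => by
      rcases lt_or_ge |y.2 + G.L| δ with h | h
      · simp only [F, hV y h, dotProduct_zero]
        exact hasSum_zero
      · have h1 := G.hasSum_field hcut hJ y.1 (t := y.2) hy.2 fun he => by
          rw [he, neg_add_cancel, abs_zero] at h
          linarith
        exact hasSum_sum fun i _ => (Pi.hasSum.1 h1 i).mul_right (V.1 y i)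
    have hmeas : ∀ p, AEStronglyMeasurable (F p) (volume.restrict G.W) := fun p => by
      have h1 : Measurable fun y : (ℝ × ℝ) × ℝ => G.profile J p.1.1 p.2 y.2 :=
        measurable_pw.comp measurable_snd
      have h2 : Continuous fun y : (ℝ × ℝ) × ℝ => G.Φ p.1.1 p.2 y.1 ⬝ᵥ V.1 y := by
        have := G.continuous_mode p
        have := V.2.1.continuous
        unfold dotProduct
        fun_prop
      have h3 : F p = fun y => G.profile J p.1.1 p.2 y.2 * (G.Φ p.1.1 p.2 y.1 ⬝ᵥ V.1 y) :=
        funext fun y => smul_dotProduct _ _ _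
      rw [h3]
      exact (h1.mul h2.measurable).aestronglyMeasurable
    have hFi : ∀ p, IntegrableOn (F p) G.W := fun p =>
      ((hVi.const_mul 3).const_mul (u p)).mono' (hmeas p)
        ((ae_restrict_iff' G.measurableSet_W).2 (ae_of_all _ (hbd p)))
    -- Continuity of the field, and with it measurability, is known only off the source plane; on
    -- the plane the integrand vanishes with V.
    have hEi : IntegrableOn (fun y => G.field J y ⬝ᵥ V.1 y) G.W := by
      have hplane : MeasurableSet {y : (ℝ × ℝ) × ℝ | y.2 = -G.L} :=
        measurableSet_eq_fun measurable_snd measurable_const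
      have hS : MeasurableSet (G.W \ {y | y.2 = -G.L}) := G.measurableSet_W.diff hplane
      have h1 : IntegrableOn (fun y => G.field J y ⬝ᵥ V.1 y) (G.W \ {y | y.2 = -G.L}) := by
        have hb : IntegrableOn (fun y => (∑' p, u p) * (3 * ‖V.1 y‖)) G.W :=
          (hVi.const_mul 3).const_mul (∑' p, u p)
        refine (hb.mono_set sdiff_subset).mono' ?_ ?_
        · refine ContinuousOn.aestronglyMeasurable ?_ hS
          have := continuousOn_pi.1 (G.continuousOn_field hcut hJ)
          have hc := continuousOn_pi.1 (V.2.1.continuous.continuousOn (s := G.W \ {y | y.2 = -G.L}))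
          exact continuousOn_finsetSum _ fun i _ => (this i).mul (hc i)
        · refine (ae_restrict_iff' hS).2 (ae_of_all _ fun y hy => ?_)
          rw [← (hsum y hy.1).tsum_eq]
          exact tsum_of_norm_bounded (hu.hasSum.mul_right (3 * ‖V.1 y‖)) fun p => hbd p y hy.1
      have h2 : IntegrableOn (fun y => G.field J y ⬝ᵥ V.1 y) (G.W ∩ {y | y.2 = -G.L}) := by
        refine (integrableOn_zero (μ := volume)).congr_fun (fun y hy => ?_)
          (G.measurableSet_W.inter hplane)
        have he : y.2 = -G.L := hy.2
        rw [hV y (by rw [he, neg_add_cancel, abs_zero]; exact hδ), dotProduct_zero]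
      have := h1.union h2
      rwa [sdiff_union_inter] at this
    refine ⟨hEi, ?_⟩
    have hInt : HasSum (fun p => ∫ y in G.W, F p y) (∫ y in G.W, G.field J y ⬝ᵥ V.1 y) := by
      refine hasSum_integral_of_dominated_convergence (fun p y => u p * (3 * ‖V.1 y‖)) hmeas
        (fun p => (ae_restrict_iff' G.measurableSet_W).2 (ae_of_all _ (hbd p)))
        (ae_of_all _ fun y => hu.mul_right _) ?_
        ((ae_restrict_iff' G.measurableSet_W).2 (ae_of_all _ hsum))
      simp only [tsum_mul_right]
      exact (hVi.const_mul 3).const_mul _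
    rw [← hInt.tsum_eq, sol_apply]
    refine tsum_congr fun p => ?_
    -- The term concentrated on the source plane is invisible to V, so the contribution of a mode is
    -- the integral against its profile; Fubini's theorem turns that into an integral over W.
    have hL : G.pair (G.Φ p.1.1 p.2) V.1 (-G.L) = 0 := G.pair_eq_zero _ fun x =>
      hV (x, -G.L) (by rw [neg_add_cancel, abs_zero]; exact hδ)
    rw [modeSol, hL, mul_zero, sub_zero, pwInt]
    have hvol : (volume : Measure ((ℝ × ℝ) × ℝ)).restrict G.W =
        (volume.restrict G.Ω).prod (volume.restrict (Iio 0)) := (Measure.prod_restrict _ _).symm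
    have hFi' : Integrable (F p) ((volume.restrict G.Ω).prod (volume.restrict (Iio 0))) :=
      hvol ▸ hFi p
    rw [hvol, integral_prod_symm _ hFi']
    refine integral_congr_ae (ae_of_all _ fun t => ?_)
    simp only [F, smul_dotProduct, smul_eq_mul, pair]
    exact (integral_const_mul _ _).symm

end Field

/-! ### Counting propagating and evanescent modes -/

theorem infinite_idx : Infinite Idx :=
  Infinite.of_injective (fun n : ℕ => (⟨(n + 1, 0), by simp⟩ : Idx)) fun a b h => by
    simpa using h

theorem finite_propagating : {n : Idx | (G.β n.1).im = 0 ∧ 0 < (G.β n.1).re}.Finite := by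
  refine ((G.finite_eig_le (G.k ^ 2)).preimage Subtype.val_injective.injOn).subset fun n hn => ?_
  by_contra hc
  exact (G.β_of_gt (not_le.1 hc)).2.ne' hn.1

theorem infinite_evanescent : {n : Idx | (G.β n.1).re = 0 ∧ 0 < (G.β n.1).im}.Infinite := by
  have := infinite_idx
  have hf := (G.finite_eig_le (G.k ^ 2)).preimage
    (f := (Subtype.val : Idx → ℕ × ℕ)) Subtype.val_injective.injOn
  refine hf.infinite_compl.mono fun n hn => ?_
  exact G.β_of_gt (not_le.1 hn)

end Waveguide

end

theorem lemma1 (G : Waveguide)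
    (hcut : ∀ n : Waveguide.Idx, G.eig n.1 ≠ G.k ^ 2)
    (J : ℝ × ℝ → Fin 3 → ℂ) (hJ : MemLp J 2 (volume.restrict G.Ω)) :
    -- the modes are eigenfunctions of the vectorial Laplacian and form an orthogonal basis
    (∀ p : Waveguide.ModeIdx, G.IsVectorEigenfunction (G.eig p.1.1) (G.Φ p.1.1 p.2)) ∧
    (∀ p q : Waveguide.ModeIdx, p ≠ q → G.innerΩ (G.Φ p.1.1 p.2) (G.Φ q.1.1 q.2) = 0) ∧
    (∀ u : ℝ × ℝ → Fin 3 → ℂ, MemLp u 2 (volume.restrict G.Ω) →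
      (∀ p : Waveguide.ModeIdx, G.innerΩ (G.Φ p.1.1 p.2) u = 0) →
      u =ᵐ[volume.restrict G.Ω] 0) ∧
    -- the boundary value problem has exactly one solution
    (∃! T : Waveguide.testFields →ₗ[ℂ] ℂ, G.IsSolution J T) ∧
    -- its mode decomposition
    (∀ T : Waveguide.testFields →ₗ[ℂ] ℂ, G.IsSolution J T →
      ∃ E : (ℝ × ℝ) × ℝ → Fin 3 → ℂ, G.IsFieldOffSource T E ∧
        (∀ x ∈ G.Ω, ∀ x₃ ∈ Ioo (-G.L) 0,
          HasSum (fun p : Waveguide.ModeIdx =>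
            (G.aPlus J p.1.1 p.2 * Complex.exp (Complex.I * G.β p.1.1 * x₃) +
              G.bPlus J p.1.1 p.2 * Complex.exp (-(Complex.I * G.β p.1.1 * x₃))) •
                G.Φ p.1.1 p.2 x) (E (x, x₃))) ∧
        (∀ x ∈ G.Ω, ∀ x₃ < -G.L,
          HasSum (fun p : Waveguide.ModeIdx =>
            (G.bMinus J p.1.1 p.2 * Complex.exp (-(Complex.I * G.β p.1.1 * x₃))) •
                G.Φ p.1.1 p.2 x) (E (x, x₃)))) ∧
    -- finitely many modes propagate, the remaining infinitely many are evanescent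
    {n : Waveguide.Idx | (G.β n.1).im = 0 ∧ 0 < (G.β n.1).re}.Finite ∧
    {n : Waveguide.Idx | (G.β n.1).re = 0 ∧ 0 < (G.β n.1).im}.Infinite ∧
    (∀ n : Waveguide.Idx, ((G.β n.1).im = 0 ∧ 0 < (G.β n.1).re) ∨
      ((G.β n.1).re = 0 ∧ 0 < (G.β n.1).im)) := by
  refine ⟨G.isVectorEigenfunction_mode, fun p q h => G.innerΩ_mode_eq_zero h,
    fun u hu h => G.ae_eq_zero_of_innerΩ_mode hu h,
    ⟨G.sol hcut hJ, G.isSolution_sol hcut hJ, fun T hT =>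
      Waveguide.IsSolution.unique G hcut hT (G.isSolution_sol hcut hJ)⟩,
    fun T hT => ?_, G.finite_propagating, G.infinite_evanescent, fun n => ?_⟩
  · obtain rfl := Waveguide.IsSolution.unique G hcut hT (G.isSolution_sol hcut hJ)
    refine ⟨G.field J, G.isFieldOffSource_field hcut hJ, fun x _ t ht => ?_, fun x _ t ht => ?_⟩
    · have h := G.hasSum_field hcut hJ x ht.2 ht.1.ne'
      simpa only [Waveguide.profile, Waveguide.pw, if_pos ht.1] using h
    · have h := G.hasSum_field hcut hJ x (ht.trans (neg_neg_of_pos G.L_pos)) ht.ne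
      simpa only [Waveguide.profile, Waveguide.pw, if_neg ht.not_gt] using h
  · exact (hcut n).lt_or_gt.imp G.β_of_lt G.β_of_gt
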